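/- Let $D_i=\mathrm{diag}(\mu_{i,1},\dots,\mu_{i,n})$, $1\le i\le l$, be invertible complex diagonal matrices, and let $F=\{F_1,\dots,F_l\}$ be an abelian family of germs of holomorphic diffeomorphisms of $(\mathbb C^n,0)$, that is, $F_i\circ F_{i'}=F_{i'}\circ F_i$ for all $i,i'$, with $F_i(0)=0$ and $DF_i(0)=D_i$. Write $|Q|=q_1+\dots+q_n$, $x^Q=x_1^{q_1}\cdots x_n^{q_n}$ and $\mu_i^Q=\mu_{i,1}^{q_1}\cdots\mu_{i,n}^{q_n}$ for $Q\in\mathbb N^n$. Let $\widehat{\mathcal O}_n^D=\{f\in\mathbb C[[x_1,\dots,x_n]] : f(D_ix)=f(x),\ 1\le i\le l\}$ be the ring of formal invariants of $D=\{D_i\}$, and let $\{x^{R}\}_{R\in S}$ be a set of non-constant monomials generating it, in the sense that these monomials are invariant and every formal invariant is a formal power series in them. Let $\mathrm{ResIdeal}$ be the ideal they generate in the ring $\mathcal O_n$ of germs of holomorphic functions at $0\in\mathbb C^n$, and let $V=\{z : z^{R}=0 \text{ for all } R\in S\}$ be its zero set. Let $\mathcal C_D$ be the non-linear formal centralizer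 of $D$: the set of $n$-tuples $G$ of formal power series of order at least $2$ with $G(D_ix)=D_iG(x)$ for all $i$. Assume: 1. $D$ is diophantine on $\mathrm{ResIdeal}$: $-\sum_{k\ge1}2^{-k}\ln\omega_k<+\infty$, where $\omega_k$ is the infimum of the non-zero values of $\max_{1\le i\le l}|\mu_i^Q-\mu_{i,j}|$ over $1\le j\le n$ and $Q\in\mathbb N^n$ with $2\le|Q|\le2^k$ and $x^Q\notin\mathrm{ResIdeal}$ (an index $k$ for which there is no such value contributes $0$ to the series); 2. $\mathcal C_D$ is generated by the monomials $x^{R}$: if $Q\in\mathbb N^n$, $|Q|\ge2$, and for some $j$ one has $\mu_i^Q=\mu_{i,j}$ for all $1\le i\le l$, then $x^Q\in\mathrm{ResIdeal}$. Then $F$ is holomorphically linearizable on $\mathrm{ResIdeal}$: there is a germ of holomorphic diffeomorphism $\Phi$ of $(\mathbb C^n,0)$, tangent to the identity at the origin and whose Taylor expansion has zero projection on $\mathcal C_D$ (no term $c\,x^Qe_j$ with $c\neq0$ and $x^Qe_j\in\mathcal C_D$), such that for every $i$ all components of $\Phi\circ F_i\circ\Phi^{-1}-D_i$ belong to $\mathrm{ResIdeal}$.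 Consequently, in the coordinates given by $\Phi$, the germ at $0$ of $V$ is invariant under each $F_i$, and $F_i$ acts on it as the linear map $D_i$: for all $z$ near $0$, $\Phi\circ F_i\circ\Phi^{-1}(z)\in V$ if and only if $z\in V$, and $\Phi\circ F_i\circ\Phi^{-1}(z)=D_iz$ for $z\in V$. -/

import Mathlib

open scoped Topology

namespace AbelianGerms

noncomputable section

/-- The monomial function `z ↦ z^Q = ∏ j, z_j ^ Q_j` on `ℂ^n`. -/
def monomialFun {n : ℕ} (Q : Fin n →₀ ℕ) (z : Fin n → ℂ) : ℂ := ∏ j, z j ^ Q j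

/-- The ring `𝒪_n` of germs at the origin of holomorphic functions on `ℂ^n`. -/
def HolGerm (n : ℕ) : Subring (Filter.Germ (𝓝 (0 : Fin n → ℂ)) ℂ) where
  carrier := {g | ∃ f : (Fin n → ℂ) → ℂ, AnalyticAt ℂ f 0 ∧ g = Filter.Germ.ofFun f}
  mul_mem' := by
    rintro _ _ ⟨f, hf, rfl⟩ ⟨g, hg, rfl⟩
    exact ⟨f * g, hf.mul hg, rfl⟩
  one_mem' := ⟨1, analyticAt_const, rfl⟩
  add_mem' := by
    rintro _ _ ⟨f, hf, rfl⟩ ⟨g, hg, rfl⟩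
    exact ⟨f + g, hf.add hg, rfl⟩
  zero_mem' := ⟨0, analyticAt_const, rfl⟩
  neg_mem' := by
    rintro _ ⟨f, hf, rfl⟩
    exact ⟨-f, hf.neg, rfl⟩

theorem analyticAt_monomialFun {n : ℕ} (Q : Fin n →₀ ℕ) (z : Fin n → ℂ) :
    AnalyticAt ℂ (monomialFun Q) z :=
  Finset.analyticAt_fun_prod _ fun j _ =>
    ((ContinuousLinearMap.proj (R := ℂ) (φ := fun _ : Fin n => ℂ) j).analyticAt z).pow (Q j)

/-- The germ of the monomial `x^Q` at the origin. -/
def monomialGerm {n : ℕ} (Q : Fin n →₀ ℕ) : HolGerm n :=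
  ⟨Filter.Germ.ofFun (monomialFun Q),
    monomialFun Q, analyticAt_monomialFun Q 0, rfl⟩

/-- The ideal of `𝒪_n` generated by the monomials `x^R`, `R ∈ S`. -/
def monomialIdeal {n : ℕ} (S : Set (Fin n →₀ ℕ)) : Ideal (HolGerm n) :=
  Ideal.span (monomialGerm '' S)

/-- The common zero set of the monomials `x^R`, `R ∈ S`; its germ at the origin is the zero
set of the ideal that they generate. -/
def zeroSet {n : ℕ} (S : Set (Fin n →₀ ℕ)) : Set (Fin n → ℂ) :=
  {z | ∀ R ∈ S, monomialFun R z = 0}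

/-- The function `f` defines a germ that belongs to the ideal `I` of `𝒪_n`. -/
def GermMem {n : ℕ} (f : (Fin n → ℂ) → ℂ) (I : Ideal (HolGerm n)) : Prop :=
  ∃ a ∈ I, (a : Filter.Germ (𝓝 (0 : Fin n → ℂ)) ℂ) = Filter.Germ.ofFun f

/-- The diagonal linear map `x ↦ (c_1 x_1, …, c_n x_n)`. -/
def diagMap {n : ℕ} (c : Fin n → ℂ) : (Fin n → ℂ) →L[ℂ] (Fin n → ℂ) :=
  ContinuousLinearMap.pi fun j => c j • ContinuousLinearMap.proj j

/-- `F_1, …, F_l` are pairwise commuting germs at the origin of holomorphic diffeomorphisms of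
`(ℂ^n, 0)`, and the linear part of `F_i` is the invertible diagonal matrix with entries
`μ_{i,1}, …, μ_{i,n}`. -/
structure IsAbelianFamily {n l : ℕ} (μ : Fin l → Fin n → ℂ)
    (F : Fin l → (Fin n → ℂ) → (Fin n → ℂ)) : Prop where
  ne_zero : ∀ i j, μ i j ≠ 0
  analyticAt : ∀ i, AnalyticAt ℂ (F i) 0
  map_zero : ∀ i, F i 0 = 0
  hasFDerivAt : ∀ i, HasFDerivAt (F i) (diagMap (μ i)) 0
  commute : ∀ i i', F i ∘ F i' =ᶠ[𝓝 0] F i' ∘ F i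

/-- The numbers `ω_k(D, I)`: the infimum (a minimum) of the nonzero values of
`max_i |μ_i^Q - μ_{i,j}|` over all `j` and all `Q` with `2 ≤ |Q| ≤ 2^k` and `x^Q ∉ I`.
If there is no such value, `ω_k = 0` here, so that `Real.log ω_k = 0`; there is then no small
divisor of order at most `2^k`, and this index contributes nothing to the series below. -/
def omegaSeq {n l : ℕ} (μ : Fin l → Fin n → ℂ) (I : Ideal (HolGerm n)) (k : ℕ) : ℝ :=
  sInf {d : ℝ | d ≠ 0 ∧ ∃ (Q : Fin n →₀ ℕ) (j : Fin n), 2 ≤ Q.degree ∧ Q.degree ≤ 2 ^ k ∧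
    monomialGerm Q ∉ I ∧ d = ⨆ i, ‖monomialFun Q (μ i) - μ i j‖}

/-- The family `D` is diophantine on `I`: `-∑_{k ≥ 1} ln ω_k(D, I) / 2^k < +∞`.
The terms `-ln ω_k` are bounded below, so this is summability. -/
def IsDiophantineOn {n l : ℕ} (μ : Fin l → Fin n → ℂ) (I : Ideal (HolGerm n)) : Prop :=
  Summable fun k : ℕ => -Real.log (omegaSeq μ I (k + 1)) / 2 ^ (k + 1)

/-- The ring of formal invariants of `D`: the formal power series `f` with
`f (D_i x) = f x` for all `i`. -/
def formalInvariants {n l : ℕ} (μ : Fin l → Fin n → ℂ) :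
    Subalgebra ℂ (MvPowerSeries (Fin n) ℂ) :=
  ⨅ i, AlgHom.equalizer (MvPowerSeries.rescaleAlgHom (μ i)) (AlgHom.id ℂ _)

/-- The monomials `x^R`, `R ∈ S`, are non-constant and generate the ring of formal invariants:
they are invariants, and every invariant is a formal power series in them, that is, agrees up to
any prescribed order with a polynomial in these monomials. -/
structure GeneratesInvariants {n l : ℕ} (μ : Fin l → Fin n → ℂ) (S : Set (Fin n →₀ ℕ)) :
    Prop where
  ne_zero : ∀ R ∈ S, R ≠ 0
  mem : ∀ R ∈ S, MvPowerSeries.monomial R (1 : ℂ) ∈ formalInvariants μ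
  dense : ∀ f ∈ formalInvariants μ, ∀ N : ℕ,
    ∃ g ∈ Algebra.adjoin ℂ ((fun R => MvPowerSeries.monomial R (1 : ℂ)) '' S),
      ∀ Q : Fin n →₀ ℕ, Q.degree ≤ N → MvPowerSeries.coeff Q g = MvPowerSeries.coeff Q f

/-- The non-linear formal centralizer of `D`: the `n`-tuples `G` of formal power series
of order at least `2` with `G (D_i x) = D_i (G x)` for all `i`. -/
def formalCentralizer {n l : ℕ} (μ : Fin l → Fin n → ℂ) :
    Set (Fin n → MvPowerSeries (Fin n) ℂ) :=
  {G | (∀ j, ∀ Q : Fin n →₀ ℕ, Q.degree < 2 → MvPowerSeries.coeff Q (G j) = 0) ∧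
    ∀ i j, MvPowerSeries.rescale (μ i) (G j) = MvPowerSeries.C (μ i j) * G j}

/-- The monomial map `x^Q e_j`, all of whose components vanish but the `j`-th, which is `x^Q`. -/
def monomialVector {n : ℕ} (Q : Fin n →₀ ℕ) (j : Fin n) : Fin n → MvPowerSeries (Fin n) ℂ :=
  Pi.single j (MvPowerSeries.monomial Q 1)

/-- `x^Q e_j` lies in the non-linear centralizer iff `|Q| ≥ 2` and `μ_i^Q = μ_{i,j}` for
all `i`. -/
theorem monomialVector_mem_iff {n l : ℕ} (μ : Fin l → Fin n → ℂ) (Q : Fin n →₀ ℕ) (j : Fin n) :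
    monomialVector Q j ∈ formalCentralizer μ ↔
      2 ≤ Q.degree ∧ ∀ i, monomialFun Q (μ i) = μ i j := by
  classical
  have hcoeff : ∀ (k : Fin n) (P : Fin n →₀ ℕ),
      MvPowerSeries.coeff P (monomialVector Q j k) = if k = j ∧ P = Q then 1 else 0 := by
    intro k P
    unfold monomialVector
    by_cases hk : k = j
    · subst hk
      simp [MvPowerSeries.coeff_monomial]
    · simp [hk]
  have hprod : ∀ i, (Q.prod fun s m => μ i s ^ m) = monomialFun Q (μ i) := fun i =>
    Finsupp.prod_fintype _ _ fun s => pow_zero _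
  constructor
  · rintro ⟨h2, hc⟩
    refine ⟨?_, fun i => ?_⟩
    · by_contra hlt
      have := h2 j Q (not_le.mp hlt)
      simp [hcoeff] at this
    · have := congrArg (MvPowerSeries.coeff Q) (hc i j)
      rw [MvPowerSeries.coeff_rescale, MvPowerSeries.coeff_C_mul, hcoeff, hprod] at this
      simpa using this
  · rintro ⟨h2, hc⟩
    refine ⟨fun k P hP => ?_, fun i k => ?_⟩
    · rw [hcoeff, if_neg]
      rintro ⟨_, rfl⟩
      omega
    · ext P
      rw [MvPowerSeries.coeff_rescale, MvPowerSeries.coeff_C_mul, hcoeff]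
      split_ifs with h
      · obtain ⟨rfl, rfl⟩ := h
        rw [hprod, hc]
      · simp

/-- The non-linear centralizer of `D` is generated by the monomials `x^R`, `R ∈ S`: whenever
`x^Q e_j` lies in it, `x^Q` belongs to the ideal generated by these monomials. -/
def CentralizerGeneratedBy {n l : ℕ} (μ : Fin l → Fin n → ℂ) (S : Set (Fin n →₀ ℕ)) : Prop :=
  ∀ (Q : Fin n →₀ ℕ) (j : Fin n),
    monomialVector Q j ∈ formalCentralizer μ → monomialGerm Q ∈ monomialIdeal S

open Classical in
/-- The projection of an `n`-tuple of formal power series onto the non-linear centralizer: it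
keeps the terms `c x^Q e_j` with `x^Q e_j` in the centralizer and drops all the others. -/
def centralizerProj {n l : ℕ} (μ : Fin l → Fin n → ℂ)
    (G : Fin n → MvPowerSeries (Fin n) ℂ) : Fin n → MvPowerSeries (Fin n) ℂ :=
  fun j Q => if monomialVector Q j ∈ formalCentralizer μ
    then MvPowerSeries.coeff Q (G j) else 0

/-- `p` is the Taylor expansion of `f` at the origin. -/
def IsTaylorExpansion {n : ℕ} (p : MvPowerSeries (Fin n) ℂ) (f : (Fin n → ℂ) → ℂ) : Prop :=
  ∀ᶠ z in 𝓝 (0 : Fin n → ℂ),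
    HasSum (fun Q : Fin n →₀ ℕ => MvPowerSeries.coeff Q p * monomialFun Q z) (f z)

/-- `Φ` is a germ of holomorphic diffeomorphism of `(ℂ^n, 0)` with inverse `Ψ`, it is tangent to
the identity at the origin, its Taylor expansion has zero projection on the non-linear
centralizer of `D`, and all components of `Φ ∘ F_i ∘ Φ⁻¹ - D_i` belong to `I`. -/
structure LinearizesOn {n l : ℕ} (μ : Fin l → Fin n → ℂ)
    (F : Fin l → (Fin n → ℂ) → (Fin n → ℂ)) (I : Ideal (HolGerm n))
    (Φ Ψ : (Fin n → ℂ) → (Fin n → ℂ)) : Prop where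
  analyticAt : AnalyticAt ℂ Φ 0
  analyticAt_inv : AnalyticAt ℂ Ψ 0
  map_zero : Φ 0 = 0
  map_zero_inv : Ψ 0 = 0
  left_inv : Ψ ∘ Φ =ᶠ[𝓝 0] id
  right_inv : Φ ∘ Ψ =ᶠ[𝓝 0] id
  tangent : HasFDerivAt Φ (ContinuousLinearMap.id ℂ (Fin n → ℂ)) 0
  normalized : ∃ p : Fin n → MvPowerSeries (Fin n) ℂ,
    (∀ j, IsTaylorExpansion (p j) fun z => Φ z j) ∧ centralizerProj μ p = 0
  linear : ∀ i j, GermMem (fun z => Φ (F i (Ψ z)) j - diagMap (μ i) z j) I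

end

end AbelianGerms

namespace AbelianGerms

noncomputable section

open scoped ENNReal NNReal
open MvPowerSeries

variable {n l : ℕ}

/-! Let `A` be the set of exponents `Q` with `x^Q` in the ideal; it is closed under adding
exponents. Since `A` is stable in this way, congruence of series off `A` survives products and
substitutions. It therefore suffices to find `Ψ`, the inverse of the wanted map, such that `F_i ∘ Ψ`
and `Ψ ∘ D_i` have the same coefficients off `A`: composing with `Ψ⁻¹` and using Dickson's lemma
turns this congruence into membership in the ideal.

With `Ψ = x + ψ` and `F_i = D_i + f_i`, the equation off `A` reads `(μ_i^Q - μ_{i,j}) ψ_{Q,j} =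
[f_{i,j}(x + ψ)]_Q`. By the centralizer hypothesis some factor on the left is nonzero. For each `(Q,
j)` the index `i` with the largest factor is used; this determines `ψ` recursively. The equations
for the other indices follow from commutation (`vanishOff_conjugacy_of_commute`).

Convergence needs no Newton iteration. The recursion preserves a ball for one weighted `ℓ¹` norm,
with weight `r^|Q| e^{-d(Q)}` off `A` and `0` on `A`. Here `d` is superadditive, grows at most
linearly, and on every product of two non-constant monomials gains the logarithm of the small
divisor. Such a `d` comes from Brjuno's counting argument: very small divisors occur on exponents
that are far apart (`isSeparated_smallDivisor`), so a splitting tree of `Q` meets few of them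
(`MarkCount.invariant`), and the diophantine series bounds their total cost
(`exists_weight_of_isDiophantineOn`).

The inverse of `Ψ` may still contain monomials of `A`. A division with remainder (`exists_division`)
replaces it by a convergent map without them whose inverse agrees with `Ψ` off `A`; as the resonant
monomials lie in `A`, this gives the normalization. On the zero set the conjugated germ is `D_i`,
and the same argument for `F_i⁻¹` yields the converse half of invariance. -/

/-! ### Weighted `ℓ¹` norms of formal power series -/

/-- The weighted `ℓ¹` norm `∑_Q |p_Q| w_Q` of a formal power series. -/
def wnorm (w : (Fin n →₀ ℕ) → ℝ≥0∞) (p : MvPowerSeries (Fin n) ℂ) : ℝ≥0∞ :=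
  ∑' Q, ‖coeff Q p‖ₑ * w Q

theorem wnorm_add_le (w : (Fin n →₀ ℕ) → ℝ≥0∞) (p q : MvPowerSeries (Fin n) ℂ) :
    wnorm w (p + q) ≤ wnorm w p + wnorm w q := by
  unfold wnorm
  rw [← ENNReal.tsum_add]
  refine ENNReal.tsum_le_tsum fun Q => ?_
  rw [← add_mul, map_add]
  gcongr
  exact enorm_add_le _ _

theorem wnorm_neg (w : (Fin n →₀ ℕ) → ℝ≥0∞) (p : MvPowerSeries (Fin n) ℂ) :
    wnorm w (-p) = wnorm w p := by
  simp [wnorm]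

theorem wnorm_zero (w : (Fin n →₀ ℕ) → ℝ≥0∞) : wnorm w 0 = 0 := by
  simp [wnorm]

theorem wnorm_sub_le (w : (Fin n →₀ ℕ) → ℝ≥0∞) (p q : MvPowerSeries (Fin n) ℂ) :
    wnorm w (p - q) ≤ wnorm w p + wnorm w q := by
  rw [sub_eq_add_neg, ← wnorm_neg w q]
  exact wnorm_add_le w p (-q)

theorem wnorm_sum_le {ι : Type*} (s : Finset ι) (w : (Fin n →₀ ℕ) → ℝ≥0∞)
    (p : ι → MvPowerSeries (Fin n) ℂ) :
    wnorm w (∑ i ∈ s, p i) ≤ ∑ i ∈ s, wnorm w (p i) :=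
  Finset.le_sum_of_subadditive (wnorm w) (wnorm_zero w).le (wnorm_add_le w) s p

theorem wnorm_monomial (w : (Fin n →₀ ℕ) → ℝ≥0∞) (Q : Fin n →₀ ℕ) (c : ℂ) :
    wnorm w (monomial Q c) = ‖c‖ₑ * w Q := by
  classical
  unfold wnorm
  rw [tsum_eq_single Q]
  · simp
  · intro P hP
    simp [coeff_monomial, hP]

theorem wnorm_mono {w v : (Fin n →₀ ℕ) → ℝ≥0∞} {p : MvPowerSeries (Fin n) ℂ}
    (h : ∀ Q, coeff Q p ≠ 0 → w Q ≤ v Q) : wnorm w p ≤ wnorm v p := by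
  refine ENNReal.tsum_le_tsum fun Q => ?_
  by_cases hQ : coeff Q p = 0
  · simp [hQ]
  · gcongr
    exact h Q hQ

/-- The weights are compared only at exponents that actually occur. This is what allows a better
weight on the product when neither factor has a constant term. -/
theorem wnorm_mul_le {u v w : (Fin n →₀ ℕ) → ℝ≥0∞} {p q : MvPowerSeries (Fin n) ℂ}
    (h : ∀ Q Q', coeff Q p ≠ 0 → coeff Q' q ≠ 0 → u (Q + Q') ≤ v Q * w Q') :
    wnorm u (p * q) ≤ wnorm v p * wnorm w q := by
  classical
  unfold wnorm
  rw [← ENNReal.tsum_mul_right]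
  simp_rw [← ENNReal.tsum_mul_left]
  rw [← ENNReal.tsum_prod (f := fun Q Q' => ‖coeff Q p‖ₑ * v Q * (‖coeff Q' q‖ₑ * w Q'))]
  rw [← (Finset.HasAntidiagonal.sigmaAntidiagonalEquivProd (A := Fin n →₀ ℕ)).tsum_eq, ENNReal.tsum_sigma']
  refine ENNReal.tsum_le_tsum fun Q => ?_
  rw [coeff_mul, tsum_fintype]
  simp only [Finset.HasAntidiagonal.sigmaAntidiagonalEquivProd_apply]
  rw [Finset.sum_coe_sort (Finset.HasAntidiagonal.antidiagonal Q)
    fun x => ‖coeff x.1 p‖ₑ * v x.1 * (‖coeff x.2 q‖ₑ * w x.2)]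
  refine (mul_le_mul_left (enorm_sum_le _ _) _).trans ?_
  rw [Finset.sum_mul]
  refine Finset.sum_le_sum fun x hx => ?_
  rw [Finset.HasAntidiagonal.mem_antidiagonal] at hx
  rw [enorm_mul]
  by_cases h1 : coeff x.1 p = 0
  · simp [h1]
  by_cases h2 : coeff x.2 q = 0
  · simp [h2]
  rw [← hx]
  calc _ ≤ ‖coeff x.1 p‖ₑ * ‖coeff x.2 q‖ₑ * (v x.1 * w x.2) := by
        gcongr; exact h _ _ h1 h2
    _ = _ := by ring

/-- The monomial `a^P = ∏_j a_j ^ P_j` in the entries of a tuple. -/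
def mpow {M : Type*} [CommMonoid M] (a : Fin n → M) (P : Fin n →₀ ℕ) : M :=
  P.prod fun j e => a j ^ e

theorem mpow_zero {M : Type*} [CommMonoid M] (a : Fin n → M) : mpow a 0 = 1 := by
  simp [mpow]

theorem mpow_add {M : Type*} [CommMonoid M] (a : Fin n → M) (P Q : Fin n →₀ ℕ) :
    mpow a (P + Q) = mpow a P * mpow a Q :=
  Finsupp.prod_add_index' (by simp) (fun _ _ _ => pow_add _ _ _)

theorem mpow_single {M : Type*} [CommMonoid M] (a : Fin n → M) (k : Fin n) :
    mpow a (Finsupp.single k 1) = a k := by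
  simp [mpow]

theorem mpow_const {M : Type*} [CommMonoid M] (s : M) (P : Fin n →₀ ℕ) :
    mpow (fun _ => s) P = s ^ P.degree := by
  rw [mpow, Finsupp.degree, Finsupp.prod, Finset.prod_pow_eq_pow_sum]
  rfl

theorem mpow_eq_monomialFun (Q : Fin n →₀ ℕ) (z : Fin n → ℂ) : mpow z Q = monomialFun Q z :=
  Finsupp.prod_fintype _ _ fun _ => pow_zero _

theorem exists_eq_single_add {P : Fin n →₀ ℕ} (hP : P ≠ 0) :
    ∃ k P', P = Finsupp.single k 1 + P' := by
  obtain ⟨k, hk⟩ := Finsupp.ne_iff.mp hP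
  refine ⟨k, P - Finsupp.single k 1, ?_⟩
  rw [add_tsub_cancel_of_le]
  simpa [Nat.one_le_iff_ne_zero] using hk

theorem exponent_induction {p : (Fin n →₀ ℕ) → Prop} (zero : p 0)
    (add : ∀ k P, p P → p (Finsupp.single k 1 + P)) (P : Fin n →₀ ℕ) : p P := by
  induction hd : P.degree generalizing P with
  | zero =>
    rw [Finsupp.degree_eq_zero_iff] at hd
    exact hd ▸ zero
  | succ d ih =>
    have hP : P ≠ 0 := by rintro rfl; simp at hd
    obtain ⟨k, P', rfl⟩ := exists_eq_single_add hP
    refine add k P' (ih P' ?_)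
    simp at hd
    omega

theorem wnorm_mpow_le {w : (Fin n →₀ ℕ) → ℝ≥0∞} (h0 : w 0 ≤ 1)
    (hw : ∀ Q Q', w (Q + Q') ≤ w Q * w Q') (a : Fin n → MvPowerSeries (Fin n) ℂ)
    (P : Fin n →₀ ℕ) : wnorm w (mpow a P) ≤ mpow (fun j => wnorm w (a j)) P := by
  induction P using exponent_induction with
  | zero =>
    rw [mpow_zero, mpow_zero, ← monomial_zero_one, wnorm_monomial]
    simpa using h0
  | add k P ih =>
    rw [mpow_add, mpow_add, mpow_single, mpow_single]
    refine (wnorm_mul_le fun Q Q' _ _ => hw Q Q').trans ?_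
    gcongr

theorem mpow_mono {a b : Fin n → ℝ≥0∞} (h : ∀ j, a j ≤ b j) (P : Fin n →₀ ℕ) :
    mpow a P ≤ mpow b P :=
  Finset.prod_le_prod' fun j _ => pow_le_pow_left₀ (zero_le) (h j) _

theorem constantCoeff_mpow {a : Fin n → MvPowerSeries (Fin n) ℂ}
    (ha : ∀ j, constantCoeff (a j) = 0) {P : Fin n →₀ ℕ} (hP : P ≠ 0) :
    constantCoeff (mpow a P) = 0 := by
  obtain ⟨k, P', rfl⟩ := exists_eq_single_add hP
  rw [mpow_add, mpow_single, map_mul, ha, zero_mul]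

/-- One gain suffices: split off a single variable factor, use the gain in that one product of two
series without constant term, and bound the remaining power by submultiplicativity. Degree at least
`2` guarantees that the second factor is not constant. -/
theorem wnorm_mpow_le_of_gain {u w : (Fin n →₀ ℕ) → ℝ≥0∞} (h0 : w 0 ≤ 1)
    (hw : ∀ Q Q', w (Q + Q') ≤ w Q * w Q')
    (hu : ∀ Q Q', Q ≠ 0 → Q' ≠ 0 → u (Q + Q') ≤ w Q * w Q')
    {a : Fin n → MvPowerSeries (Fin n) ℂ} (ha : ∀ j, constantCoeff (a j) = 0)
    {P : Fin n →₀ ℕ} (hP : 2 ≤ P.degree) :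
    wnorm u (mpow a P) ≤ mpow (fun j => wnorm w (a j)) P := by
  have hP0 : P ≠ 0 := by rintro rfl; simp at hP
  obtain ⟨k, P', rfl⟩ := exists_eq_single_add hP0
  have hP' : P' ≠ 0 := by rintro rfl; simp at hP
  rw [mpow_add, mpow_add, mpow_single, mpow_single]
  refine (wnorm_mul_le (v := w) (w := w) fun Q Q' hQ hQ' => hu Q Q' ?_ ?_).trans ?_
  · rintro rfl; exact hQ (ha k)
  · rintro rfl; exact hQ' (constantCoeff_mpow ha hP')
  · gcongr
    exact wnorm_mpow_le h0 hw a P'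

theorem coeff_subst_eq {a : Fin n → MvPowerSeries (Fin n) ℂ} (ha : HasSubst a)
    (f : MvPowerSeries (Fin n) ℂ) (Q : Fin n →₀ ℕ) :
    coeff Q (subst a f) = ∑ᶠ P, coeff P f * coeff Q (mpow a P) :=
  coeff_subst ha f Q

theorem finite_support_coeff_subst {a : Fin n → MvPowerSeries (Fin n) ℂ} (ha : HasSubst a)
    (f : MvPowerSeries (Fin n) ℂ) (Q : Fin n →₀ ℕ) :
    (Function.support fun P => coeff P f * coeff Q (mpow a P)).Finite :=
  coeff_subst_finite ha f Q

theorem enorm_finsum_le {ι : Type*} {f : ι → ℂ} (hf : (Function.support f).Finite) :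
    ‖∑ᶠ i, f i‖ₑ ≤ ∑' i, ‖f i‖ₑ := by
  rw [finsum_eq_sum f hf]
  exact (enorm_sum_le _ _).trans (ENNReal.sum_le_tsum _)

theorem wnorm_subst_le_tsum (u : (Fin n →₀ ℕ) → ℝ≥0∞) {a : Fin n → MvPowerSeries (Fin n) ℂ}
    (ha : HasSubst a) (f : MvPowerSeries (Fin n) ℂ) :
    wnorm u (subst a f) ≤ ∑' P, ‖coeff P f‖ₑ * wnorm u (mpow a P) := by
  unfold wnorm
  simp_rw [← ENNReal.tsum_mul_left]
  rw [ENNReal.tsum_comm]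
  refine ENNReal.tsum_le_tsum fun Q => ?_
  rw [coeff_subst_eq ha]
  refine (mul_le_mul_left (enorm_finsum_le (finite_support_coeff_subst ha f Q)) _).trans ?_
  rw [← ENNReal.tsum_mul_right]
  simp only [enorm_mul, mul_assoc, le_refl]

theorem wnorm_subst_le {w : (Fin n →₀ ℕ) → ℝ≥0∞} (h0 : w 0 ≤ 1)
    (hw : ∀ Q Q', w (Q + Q') ≤ w Q * w Q') {a : Fin n → MvPowerSeries (Fin n) ℂ}
    (ha : HasSubst a) {s : ℝ≥0∞} (hs : ∀ j, wnorm w (a j) ≤ s) (f : MvPowerSeries (Fin n) ℂ) :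
    wnorm w (subst a f) ≤ wnorm (fun P => s ^ P.degree) f := by
  refine (wnorm_subst_le_tsum w ha f).trans (ENNReal.tsum_le_tsum fun P => ?_)
  gcongr
  exact (wnorm_mpow_le h0 hw a P).trans ((mpow_mono hs P).trans_eq (mpow_const s P))

/-- If the weight `u` gains over the submultiplicative weight `w` on products without constant
terms, then so does the substitution into a power series of order at least `2`. -/
theorem wnorm_subst_le_of_gain {u w : (Fin n →₀ ℕ) → ℝ≥0∞} (h0 : w 0 ≤ 1)
    (hw : ∀ Q Q', w (Q + Q') ≤ w Q * w Q')
    (hu : ∀ Q Q', Q ≠ 0 → Q' ≠ 0 → u (Q + Q') ≤ w Q * w Q')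
    {a : Fin n → MvPowerSeries (Fin n) ℂ} (ha : ∀ j, constantCoeff (a j) = 0)
    {s : ℝ≥0∞} (hs : ∀ j, wnorm w (a j) ≤ s) {f : MvPowerSeries (Fin n) ℂ}
    (hf : ∀ P : Fin n →₀ ℕ, P.degree < 2 → coeff P f = 0) :
    wnorm u (subst a f) ≤ wnorm (fun P => s ^ P.degree) f := by
  refine (wnorm_subst_le_tsum u (hasSubst_of_constantCoeff_zero ha) f).trans
    (ENNReal.tsum_le_tsum fun P => ?_)
  by_cases hP : P.degree < 2
  · simp [hf P hP]
  gcongr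
  exact (wnorm_mpow_le_of_gain h0 hw hu ha (not_lt.mp hP)).trans
    ((mpow_mono hs P).trans_eq (mpow_const s P))

theorem pow_add_weight_le (s : ℝ≥0∞) (Q Q' : Fin n →₀ ℕ) :
    s ^ (Q + Q').degree ≤ s ^ Q.degree * s ^ Q'.degree := by
  rw [← pow_add, map_add]

/-! ### Congruences modulo sets of exponents -/

/-- All coefficients of `p` at exponents outside `A` vanish. -/
def VanishOff (A : Set (Fin n →₀ ℕ)) (p : MvPowerSeries (Fin n) ℂ) : Prop :=
  ∀ Q, Q ∉ A → coeff Q p = 0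

namespace VanishOff

variable {A B C : Set (Fin n →₀ ℕ)} {p q : MvPowerSeries (Fin n) ℂ}

theorem zero : VanishOff A (0 : MvPowerSeries (Fin n) ℂ) := fun _ _ => by simp

theorem mono (h : A ⊆ B) (hp : VanishOff A p) : VanishOff B p :=
  fun Q hQ => hp Q fun hA => hQ (h hA)

theorem add (hp : VanishOff A p) (hq : VanishOff A q) : VanishOff A (p + q) :=
  fun Q hQ => by rw [map_add, hp Q hQ, hq Q hQ, add_zero]

theorem sub (hp : VanishOff A p) (hq : VanishOff A q) : VanishOff A (p - q) :=
  fun Q hQ => by rw [map_sub, hp Q hQ, hq Q hQ, sub_zero]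

theorem neg (hp : VanishOff A p) : VanishOff A (-p) :=
  fun Q hQ => by rw [map_neg, hp Q hQ, neg_zero]

theorem mul (hp : VanishOff A p) (hq : VanishOff B q)
    (h : ∀ Q ∈ A, ∀ Q' ∈ B, Q + Q' ∈ C) : VanishOff C (p * q) := by
  classical
  intro Q hQ
  rw [coeff_mul]
  refine Finset.sum_eq_zero fun x hx => ?_
  rw [Finset.HasAntidiagonal.mem_antidiagonal] at hx
  by_cases h1 : x.1 ∈ A
  · by_cases h2 : x.2 ∈ B
    · exact absurd (hx ▸ h _ h1 _ h2) hQ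
    · rw [hq _ h2, mul_zero]
  · rw [hp _ h1, zero_mul]

theorem mul_left (hA : IsUpperSet A) (p : MvPowerSeries (Fin n) ℂ) (hq : VanishOff A q) :
    VanishOff A (p * q) :=
  mul (A := Set.univ) (fun Q hQ => absurd (Set.mem_univ Q) hQ) hq
    fun _ _ _ hQ' => hA le_add_self hQ'

theorem mul_right (hA : IsUpperSet A) (hp : VanishOff A p) (q : MvPowerSeries (Fin n) ℂ) :
    VanishOff A (p * q) :=
  mul_comm q p ▸ mul_left hA q hp

theorem sum {ι : Type*} {s : Finset ι} {p : ι → MvPowerSeries (Fin n) ℂ}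
    (h : ∀ i ∈ s, VanishOff A (p i)) : VanishOff A (∑ i ∈ s, p i) :=
  fun Q hQ => by
    rw [map_sum]
    exact Finset.sum_eq_zero fun i hi => h i hi Q hQ

/-- Telescoping: `aa' - bb' = (a - b)a' + b(a' - b')`, one variable at a time. -/
theorem mpow_sub {a b : Fin n → MvPowerSeries (Fin n) ℂ} (hA : IsUpperSet A)
    (h : ∀ j, VanishOff A (a j - b j)) (P : Fin n →₀ ℕ) :
    VanishOff A (mpow a P - mpow b P) := by
  induction P using exponent_induction with
  | zero => simpa [mpow_zero] using zero
  | add k P ih =>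
    have : mpow a (Finsupp.single k 1 + P) - mpow b (Finsupp.single k 1 + P)
        = (a k - b k) * mpow a P + b k * (mpow a P - mpow b P) := by
      simp only [mpow_add, mpow_single]; ring
    rw [this]
    exact (mul_right hA (h k) _).add (mul_left hA _ ih)

theorem subst_sub_of_mpow {a b : Fin n → MvPowerSeries (Fin n) ℂ} (ha : HasSubst a)
    (hb : HasSubst b) {f : MvPowerSeries (Fin n) ℂ}
    (h : ∀ P, coeff P f ≠ 0 → VanishOff A (mpow a P - mpow b P)) :
    VanishOff A (subst a f - subst b f) := by
  intro Q hQ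
  rw [map_sub, coeff_subst_eq ha, coeff_subst_eq hb, sub_eq_zero]
  refine finsum_congr fun P => ?_
  by_cases hP : coeff P f = 0
  · simp [hP]
  · have := h P hP Q hQ
    rw [map_sub, sub_eq_zero] at this
    rw [this]

/-- Substituting congruent tuples gives congruent series. -/
theorem subst_sub {a b : Fin n → MvPowerSeries (Fin n) ℂ} (ha : HasSubst a)
    (hb : HasSubst b) (hA : IsUpperSet A) (h : ∀ j, VanishOff A (a j - b j))
    (f : MvPowerSeries (Fin n) ℂ) : VanishOff A (subst a f - subst b f) :=
  subst_sub_of_mpow ha hb fun P _ => mpow_sub hA h P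

theorem compl_zero_iff : VanishOff {(0 : Fin n →₀ ℕ)}ᶜ p ↔ constantCoeff p = 0 := by
  simp [VanishOff]

/-- Substituting congruent tuples without constant term into a series of order at least `2` gives
a congruence of one degree more. -/
theorem subst_sub_of_gain {a b : Fin n → MvPowerSeries (Fin n) ℂ}
    (ha : ∀ j, constantCoeff (a j) = 0) (hb : ∀ j, constantCoeff (b j) = 0) (hA : IsUpperSet A)
    (hAB : ∀ Q ∈ A, ∀ Q', Q' ≠ 0 → Q + Q' ∈ B) (h : ∀ j, VanishOff A (a j - b j))
    {f : MvPowerSeries (Fin n) ℂ} (hf : ∀ P : Fin n →₀ ℕ, P.degree < 2 → coeff P f = 0) :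
    VanishOff B (subst a f - subst b f) := by
  refine subst_sub_of_mpow (hasSubst_of_constantCoeff_zero ha) (hasSubst_of_constantCoeff_zero hb)
    fun P hP => ?_
  have hP2 : 2 ≤ P.degree := not_lt.mp fun h => hP (hf P h)
  have hP0 : P ≠ 0 := by rintro rfl; simp at hP2
  obtain ⟨k, P', rfl⟩ := exists_eq_single_add hP0
  have hP' : P' ≠ 0 := by rintro rfl; simp at hP2
  have : mpow a (Finsupp.single k 1 + P') - mpow b (Finsupp.single k 1 + P')
      = (a k - b k) * mpow a P' + (mpow a P' - mpow b P') * b k := by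
    simp only [mpow_add, mpow_single]; ring
  rw [this]
  exact ((h k).mul (compl_zero_iff.mpr (constantCoeff_mpow ha hP')) fun Q hQ Q' hQ' =>
    hAB Q hQ Q' hQ').add
    ((mpow_sub hA h P').mul (compl_zero_iff.mpr (hb k)) fun Q hQ Q' hQ' => hAB Q hQ Q' hQ')

end VanishOff

/-! ### The degree filtration and formal fixed points -/

/-- The exponents of degree at least `K`. -/
def degGE (n K : ℕ) : Set (Fin n →₀ ℕ) := {Q | K ≤ Q.degree}

theorem isUpperSet_degGE (K : ℕ) : IsUpperSet (degGE n K) :=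
  fun _ _ h hQ => le_trans (show K ≤ _ from hQ) (Finsupp.degree_mono h)

theorem eq_of_forall_vanishOff_degGE {p q : MvPowerSeries (Fin n) ℂ}
    (h : ∀ K, VanishOff (degGE n K) (p - q)) : p = q := by
  ext Q
  have := h (Q.degree + 1) Q (by simp [degGE])
  rwa [map_sub, sub_eq_zero] at this

/-- A map on tuples of power series that improves congruences by one degree has a fixed point,
which lies in every invariant closed ball for a weighted norm. -/
theorem exists_fixedPoint {ι : Type*}
    (T : (ι → MvPowerSeries (Fin n) ℂ) → ι → MvPowerSeries (Fin n) ℂ)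
    (hT : ∀ K p q, (∀ j, VanishOff (degGE n K) (p j - q j)) →
      ∀ j, VanishOff (degGE n (K + 1)) (T p j - T q j)) :
    ∃ p, T p = p ∧ ∀ (w : (Fin n →₀ ℕ) → ℝ≥0∞) (R : ι → ℝ≥0∞),
      (∀ q, (∀ j, wnorm w (q j) ≤ R j) → ∀ j, wnorm w (T q j) ≤ R j) →
        ∀ j, wnorm w (p j) ≤ R j := by
  set x : ℕ → ι → MvPowerSeries (Fin n) ℂ := fun k => T^[k] 0 with hx
  have hxs : ∀ k, x (k + 1) = T (x k) := fun k => Function.iterate_succ_apply' T k 0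
  have hstep : ∀ k j, VanishOff (degGE n k) (x (k + 1) j - x k j) := by
    intro k
    induction k with
    | zero => intro j Q hQ; simp [degGE] at hQ
    | succ k ih =>
      intro j
      rw [hxs (k + 1), hxs k]
      exact hT k _ _ (by rw [← hxs k]; exact ih) j
  have hanti : ∀ {k m : ℕ}, k ≤ m → degGE n m ⊆ degGE n k := fun h Q hQ => le_trans h hQ
  have hlate : ∀ k m j, k ≤ m → VanishOff (degGE n k) (x m j - x k j) := by
    intro k m j hkm
    induction m, hkm using Nat.le_induction with
    | base => simpa using VanishOff.zero
    | succ m hkm ih =>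
      have := ((hstep m j).mono (hanti hkm)).add ih
      simpa using this
  -- The iterates stabilize degree by degree: coefficients of degree `d` no longer change after step
  -- `d + 1`.
  let p : ι → MvPowerSeries (Fin n) ℂ := fun j Q => coeff Q (x (Q.degree + 1) j)
  have hpc : ∀ j Q, coeff Q (p j) = coeff Q (x (Q.degree + 1) j) := fun j Q => rfl
  have hcoeff : ∀ k j Q, Q.degree < k → coeff Q (p j) = coeff Q (x k j) := by
    intro k j Q hQ
    have := hlate (Q.degree + 1) k j hQ Q (by simp [degGE])
    rw [map_sub, sub_eq_zero] at this
    rw [hpc, this]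
  have hp : ∀ k j, VanishOff (degGE n k) (p j - x k j) := by
    intro k j Q hQ
    rw [map_sub, hcoeff k j Q (by simpa [degGE] using hQ), sub_self]
  refine ⟨p, ?_, fun w R hR j => ?_⟩
  · funext j
    refine eq_of_forall_vanishOff_degGE fun K => ?_
    have h1 := (hT K p (x K) (hp K) j).mono (hanti K.le_succ)
    have h2 := (hp (K + 1) j).mono (hanti K.le_succ)
    rw [← hxs] at h1
    simpa using h1.sub h2
  · have hxR : ∀ k j, wnorm w (x k j) ≤ R j := by
      intro k
      induction k with
      | zero => intro j; simp [hx, wnorm_zero]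
      | succ k ih => rw [hxs]; exact hR _ ih
    unfold wnorm
    -- Only a limit of coefficients is available, not of norms. But each finite partial sum of the
    -- norm of `p` is a partial sum for one sufficiently late iterate, and all iterates stay in the
    -- ball because the iteration starts at `0`.
    rw [ENNReal.tsum_eq_iSup_sum]
    refine iSup_le fun s => ?_
    refine le_trans ?_ (hxR (s.sup Finsupp.degree + 1) j)
    refine le_trans (le_of_eq (Finset.sum_congr rfl fun Q hQ => ?_)) (ENNReal.sum_le_tsum s)
    rw [hcoeff _ j Q (Nat.lt_succ_of_le (Finset.le_sup (f := Finsupp.degree) hQ))]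

/-! ### Brjuno's counting argument -/

/-- `MarkCount s Q c`: the exponent `Q` can be split into pieces along a binary tree in which `c`
inner nodes, each with two nonzero children, carry an exponent of `s` and are counted. -/
inductive MarkCount {n : ℕ} (s : Set (Fin n →₀ ℕ)) : (Fin n →₀ ℕ) → ℕ → Prop
  | leaf (Q : Fin n →₀ ℕ) : MarkCount s Q 0
  | add {Q Q' : Fin n →₀ ℕ} {c c' : ℕ} :
      MarkCount s Q c → MarkCount s Q' c' → MarkCount s (Q + Q') (c + c')
  | mark {Q Q' : Fin n →₀ ℕ} {c c' : ℕ} : Q ≠ 0 → Q' ≠ 0 → Q + Q' ∈ s →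
      MarkCount s Q c → MarkCount s Q' c' → MarkCount s (Q + Q') (c + c' + 1)

/-- The exponents in `s` have degree at least `M` and comparable ones differ by at least `M` in
degree. -/
structure IsSeparated {n : ℕ} (s : Set (Fin n →₀ ℕ)) (M : ℕ) : Prop where
  le_degree : ∀ Q ∈ s, M ≤ Q.degree
  add_le_degree : ∀ Q ∈ s, ∀ P ∈ s, P ≤ Q → P ≠ Q → P.degree + M ≤ Q.degree

/-- The bound `c * M ≤ 2 * Q.degree` alone does not survive the induction; two levels of slack do.
Joining two trees with positive counts yields the larger slack. A new mark costs `M` and consumes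
one level of slack, but if the slack was measured at an earlier marked exponent `P`, then separation
raises the degree by `M`, hence the right side by `2 * M`, which pays for the mark and restores the
larger slack. -/
theorem MarkCount.invariant {s : Set (Fin n →₀ ℕ)} {M : ℕ} (hs : IsSeparated s M)
    {Q : Fin n →₀ ℕ} {c : ℕ} (h : MarkCount s Q c) :
    c = 0 ∨ (∃ P ∈ s, P ≤ Q ∧ (c + 1) * M ≤ 2 * P.degree) ∨ (c + 2) * M ≤ 2 * Q.degree := by
  -- The witness `P` is kept below one of the two children, not merely below their sum: as the other
  -- child is nonzero, `P` then differs from `Q + Q'` in the marked case, so separation applies.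
  have hadd : ∀ {Q Q' : Fin n →₀ ℕ} {c c' : ℕ},
      (c = 0 ∨ (∃ P ∈ s, P ≤ Q ∧ (c + 1) * M ≤ 2 * P.degree) ∨ (c + 2) * M ≤ 2 * Q.degree) →
      (c' = 0 ∨ (∃ P ∈ s, P ≤ Q' ∧ (c' + 1) * M ≤ 2 * P.degree) ∨
        (c' + 2) * M ≤ 2 * Q'.degree) →
      c + c' = 0 ∨ (∃ P ∈ s, (P ≤ Q ∨ P ≤ Q') ∧ (c + c' + 1) * M ≤ 2 * P.degree) ∨
        (c + c' + 2) * M ≤ 2 * (Q + Q').degree := by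
    intro Q Q' c c' h h'
    have hsplit : ∀ {R : Fin n →₀ ℕ} {e : ℕ},
        ((∃ P ∈ s, P ≤ R ∧ (e + 1) * M ≤ 2 * P.degree) ∨ (e + 2) * M ≤ 2 * R.degree) →
        (e + 1) * M ≤ 2 * R.degree := by
      rintro R e (⟨P, -, hP, h⟩ | h)
      · have := Finsupp.degree_mono hP
        omega
      · nlinarith
    rw [map_add]
    rcases h with rfl | h
    · rcases h' with rfl | ⟨P, hPs, hP, h'⟩ | h'
      · simp
      · exact Or.inr (Or.inl ⟨P, hPs, Or.inr hP, by simpa using h'⟩)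
      · refine Or.inr (Or.inr ?_)
        rw [zero_add]; omega
    · rcases h' with rfl | h'
      · rcases h with ⟨P, hPs, hP, h⟩ | h
        · exact Or.inr (Or.inl ⟨P, hPs, Or.inl hP, by simpa using h⟩)
        · refine Or.inr (Or.inr ?_)
          rw [add_zero]; omega
      · have h1 := hsplit h
        have h2 := hsplit h'
        refine Or.inr (Or.inr ?_)
        nlinarith
  induction h with
  | leaf Q => exact Or.inl rfl
  | @add Q Q' c c' _ _ ih ih' =>
    rcases hadd ih ih' with h | ⟨P, hPs, hP, h⟩ | h
    · exact Or.inl h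
    · exact Or.inr (Or.inl ⟨P, hPs, hP.elim (fun h => h.trans le_self_add)
        (fun h => h.trans le_add_self), h⟩)
    · exact Or.inr (Or.inr h)
  | @mark Q Q' c c' hQ hQ' hm _ _ ih ih' =>
    refine Or.inr ?_
    rcases hadd ih ih' with h | ⟨P, hPs, hP, h⟩ | h
    · refine Or.inl ⟨Q + Q', hm, le_rfl, ?_⟩
      have := hs.le_degree _ hm
      rw [h]
      omega
    · have hle : P ≤ Q + Q' := hP.elim (fun h => h.trans le_self_add) fun h => h.trans le_add_self
      have hne : P ≠ Q + Q' := by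
        rintro rfl
        rcases hP with hP | hP
        · exact hQ' (by simpa using hP)
        · exact hQ (by simpa using hP)
      have := hs.add_le_degree _ hm _ hPs hle hne
      right
      nlinarith
    · exact Or.inl ⟨Q + Q', hm, le_rfl, by linarith⟩

theorem MarkCount.mul_le {s : Set (Fin n →₀ ℕ)} {M : ℕ} (hs : IsSeparated s M)
    {Q : Fin n →₀ ℕ} {c : ℕ} (h : MarkCount s Q c) : c * M ≤ 2 * Q.degree := by
  rcases h.invariant hs with rfl | ⟨P, -, hP, h⟩ | h
  · simp
  · have := Finsupp.degree_mono hP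
    nlinarith
  · nlinarith

/-- The maximal number of counted nodes in a splitting of `Q`. -/
def maxMark (s : Set (Fin n →₀ ℕ)) (Q : Fin n →₀ ℕ) : ℕ := sSup {c | MarkCount s Q c}

section maxMark

variable {s : Set (Fin n →₀ ℕ)} {M : ℕ}

theorem bddAbove_markCount (hs : IsSeparated s M) (hM : 0 < M) (Q : Fin n →₀ ℕ) :
    BddAbove {c | MarkCount s Q c} :=
  ⟨2 * Q.degree, fun _ hc => (Nat.le_mul_of_pos_right _ hM).trans (MarkCount.mul_le hs hc)⟩

theorem markCount_maxMark (hs : IsSeparated s M) (hM : 0 < M) (Q : Fin n →₀ ℕ) :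
    MarkCount s Q (maxMark s Q) :=
  Nat.sSup_mem ⟨0, MarkCount.leaf Q⟩ (bddAbove_markCount hs hM Q)

theorem maxMark_mul_le (hs : IsSeparated s M) (hM : 0 < M) (Q : Fin n →₀ ℕ) :
    maxMark s Q * M ≤ 2 * Q.degree :=
  (markCount_maxMark hs hM Q).mul_le hs

theorem maxMark_add_le (hs : IsSeparated s M) (hM : 0 < M) (Q Q' : Fin n →₀ ℕ) :
    maxMark s Q + maxMark s Q' ≤ maxMark s (Q + Q') :=
  le_csSup (bddAbove_markCount hs hM _)
    ((markCount_maxMark hs hM Q).add (markCount_maxMark hs hM Q'))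

theorem maxMark_add_lt (hs : IsSeparated s M) (hM : 0 < M) {Q Q' : Fin n →₀ ℕ} (hQ : Q ≠ 0)
    (hQ' : Q' ≠ 0) (h : Q + Q' ∈ s) :
    maxMark s Q + maxMark s Q' + 1 ≤ maxMark s (Q + Q') :=
  le_csSup (bddAbove_markCount hs hM _)
    (MarkCount.mark hQ hQ' h (markCount_maxMark hs hM Q) (markCount_maxMark hs hM Q'))

end maxMark

/-- The counting argument for small divisors: divisors `δ Q j` of size `e^{-b (m+1)}` that occur
only on a `2 ^ (m + 1)`-separated set of exponents are absorbed by an exponential weight. -/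
theorem exists_weight_of_isSeparated {J : Type*} [Fintype J] {A : Set (Fin n →₀ ℕ)}
    {δ : (Fin n →₀ ℕ) → J → ℝ} {b : ℕ → ℝ} (hb : ∀ m, 0 ≤ b m)
    (hsum : Summable fun m => b (m + 1) / 2 ^ (m + 1)) {s : ℕ → J → Set (Fin n →₀ ℕ)}
    (hs : ∀ m j, IsSeparated (s m j) (2 ^ (m + 1)))
    (hδ : ∀ Q ∉ A, 2 ≤ Q.degree → ∀ j,
      -Real.log (δ Q j) ≤ b 0 ∨ ∃ m, Q ∈ s m j ∧ -Real.log (δ Q j) ≤ b (m + 1)) :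
    ∃ (d : (Fin n →₀ ℕ) → ℝ) (C : ℝ), (∀ Q, 0 ≤ d Q) ∧ (∀ Q, d Q ≤ C * Q.degree) ∧
      (∀ Q Q', d Q + d Q' ≤ d (Q + Q')) ∧
      ∀ Q Q', Q ≠ 0 → Q' ≠ 0 → Q + Q' ∉ A → ∀ j,
        d Q + d Q' - Real.log (δ (Q + Q') j) ≤ d (Q + Q') := by
  classical
  have hM : ∀ m : ℕ, 0 < 2 ^ (m + 1) := fun m => by positivity
  -- The cost at scale `m`: at most `2 |Q| / 2 ^ (m + 1)` marks for each component, each costing `b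
  -- (m + 1)`. The series over `m` converges by `hsum`.
  let t : (Fin n →₀ ℕ) → ℕ → ℝ := fun Q m => b (m + 1) * ∑ j, (maxMark (s m j) Q : ℝ)
  have ht0 : ∀ Q m, 0 ≤ t Q m := fun Q m => mul_nonneg (hb _) (by positivity)
  have htle : ∀ Q m, t Q m ≤ 2 * Fintype.card J * Q.degree * (b (m + 1) / 2 ^ (m + 1)) := by
    intro Q m
    have h1 : ∀ j ∈ Finset.univ, (maxMark (s m j) Q : ℝ) ≤ 2 * Q.degree / 2 ^ (m + 1) := by
      intro j _
      rw [le_div_iff₀ (by positivity)]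
      exact_mod_cast maxMark_mul_le (hs m j) (hM m) Q
    have h2 := Finset.sum_le_card_nsmul _ _ _ h1
    rw [Finset.card_univ, nsmul_eq_mul] at h2
    calc t Q m ≤ b (m + 1) * (Fintype.card J * (2 * Q.degree / 2 ^ (m + 1))) :=
          mul_le_mul_of_nonneg_left h2 (hb _)
      _ = _ := by ring
  have hts : ∀ Q, Summable (t Q) := fun Q =>
    Summable.of_nonneg_of_le (ht0 Q) (htle Q) (hsum.mul_left _)
  have htadd : ∀ Q Q' m, t Q m + t Q' m ≤ t (Q + Q') m := by
    intro Q Q' m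
    rw [← mul_add, ← Finset.sum_add_distrib]
    refine mul_le_mul_of_nonneg_left (Finset.sum_le_sum fun j _ => ?_) (hb _)
    exact_mod_cast maxMark_add_le (hs m j) (hM m) Q Q'
  have hdeg : ∀ Q Q' : Fin n →₀ ℕ, Q.degree - 1 + (Q'.degree - 1) ≤ (Q + Q').degree - 1 := by
    intro Q Q'
    rw [map_add]
    omega
  have htsum : ∀ Q Q', ∑' m, t Q m + ∑' m, t Q' m ≤ ∑' m, t (Q + Q') m := fun Q Q' => by
    rw [← (hts Q).tsum_add (hts Q')]
    exact ((hts Q).add (hts Q')).tsum_le_tsum (htadd Q Q') (hts _)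
  -- The divisors of cost `b 0` need no counting: a binary splitting of `Q` into nonzero pieces has
  -- at most `|Q| - 1` inner nodes. In the same way, `|Q| - 1` rises by at least one when two
  -- nonzero exponents are added.
  refine ⟨fun Q => (Q.degree - 1 : ℕ) * b 0 + ∑' m, t Q m,
    b 0 + 2 * Fintype.card J * ∑' m, b (m + 1) / 2 ^ (m + 1), fun Q => ?_, fun Q => ?_,
    fun Q Q' => ?_, fun Q Q' hQ hQ' hA j => ?_⟩
  · exact add_nonneg (mul_nonneg (Nat.cast_nonneg _) (hb 0)) (tsum_nonneg (ht0 Q))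
  · have h1 : ((Q.degree - 1 : ℕ) : ℝ) * b 0 ≤ Q.degree * b 0 :=
      mul_le_mul_of_nonneg_right (by exact_mod_cast Nat.sub_le _ _) (hb 0)
    have h2 := (hts Q).tsum_le_tsum (htle Q) (hsum.mul_left _)
    rw [tsum_mul_left] at h2
    dsimp only
    linarith
  · have h1 : (((Q.degree - 1 : ℕ) : ℝ) + (Q'.degree - 1 : ℕ)) * b 0
        ≤ ((Q + Q').degree - 1 : ℕ) * b 0 :=
      mul_le_mul_of_nonneg_right (by exact_mod_cast hdeg Q Q') (hb 0)
    have := htsum Q Q'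
    dsimp only
    linarith
  · have hQd : Q.degree ≠ 0 := fun h => hQ ((Finsupp.degree_eq_zero_iff Q).mp h)
    have hQd' : Q'.degree ≠ 0 := fun h => hQ' ((Finsupp.degree_eq_zero_iff Q').mp h)
    have h2 : 2 ≤ (Q + Q').degree := by rw [map_add]; omega
    dsimp only
    rcases hδ _ hA h2 j with h | ⟨m, hm, h⟩
    · have hd : Q.degree - 1 + (Q'.degree - 1) + 1 ≤ (Q + Q').degree - 1 := by
        rw [map_add]; omega
      have h1 : (((Q.degree - 1 : ℕ) : ℝ) + (Q'.degree - 1 : ℕ) + 1) * b 0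
          ≤ ((Q + Q').degree - 1 : ℕ) * b 0 :=
        mul_le_mul_of_nonneg_right (by exact_mod_cast hd) (hb 0)
      have := htsum Q Q'
      linarith
    · have h1 : (((Q.degree - 1 : ℕ) : ℝ) + (Q'.degree - 1 : ℕ)) * b 0
          ≤ ((Q + Q').degree - 1 : ℕ) * b 0 :=
        mul_le_mul_of_nonneg_right (by exact_mod_cast hdeg Q Q') (hb 0)
      have h3 := ((hts Q).hasSum.add (hts Q').hasSum).add (hasSum_ite_eq m (b (m + 1)))
      have h4 := hasSum_le (fun k => ?_) h3 (hts (Q + Q')).hasSum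
      · linarith
      · split_ifs with hk
        · subst hk
          rw [← mul_add, ← Finset.sum_add_distrib, ← mul_add_one]
          refine mul_le_mul_of_nonneg_left ?_ (hb _)
          rw [← Finset.add_sum_erase _ _ (Finset.mem_univ j),
            ← Finset.add_sum_erase _ _ (Finset.mem_univ j), add_right_comm]
          refine add_le_add (by exact_mod_cast maxMark_add_lt (hs k j) (hM k) hQ hQ' hm)
            (Finset.sum_le_sum fun j _ => ?_)
          exact_mod_cast maxMark_add_le (hs k j) (hM k) Q Q'
        · simpa using htadd Q Q' k

/-! ### Small divisors off the ideal -/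

/-- The exponents `Q` with `x^Q ∈ I`. -/
def exponentSet (I : Ideal (HolGerm n)) : Set (Fin n →₀ ℕ) := {Q | monomialGerm Q ∈ I}

theorem monomialFun_add (Q Q' : Fin n →₀ ℕ) (z : Fin n → ℂ) :
    monomialFun (Q + Q') z = monomialFun Q z * monomialFun Q' z := by
  simp only [← mpow_eq_monomialFun, mpow_add]

theorem monomialFun_single (k : Fin n) (z : Fin n → ℂ) :
    monomialFun (Finsupp.single k 1) z = z k := by
  rw [← mpow_eq_monomialFun, mpow_single]

theorem monomialGerm_add (Q Q' : Fin n →₀ ℕ) :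
    (monomialGerm (Q + Q') : HolGerm n) = monomialGerm Q * monomialGerm Q' := by
  refine Subtype.ext ?_
  change Filter.Germ.ofFun (monomialFun (Q + Q')) = Filter.Germ.ofFun (monomialFun Q * monomialFun Q')
  congr 1
  exact funext fun z => monomialFun_add Q Q' z

theorem isUpperSet_exponentSet (I : Ideal (HolGerm n)) : IsUpperSet (exponentSet I) := by
  intro Q Q' h hQ
  obtain ⟨P, rfl⟩ := exists_add_of_le h
  change monomialGerm (Q + P) ∈ I
  rw [monomialGerm_add]
  exact I.mul_mem_right _ hQ

/-- The small divisor `max_i |μ_i^Q - μ_{i,j}|`. -/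
def smallDivisor (μ : Fin l → Fin n → ℂ) (Q : Fin n →₀ ℕ) (j : Fin n) : ℝ :=
  ⨆ i, ‖monomialFun Q (μ i) - μ i j‖

theorem norm_le_smallDivisor (μ : Fin l → Fin n → ℂ) (Q : Fin n →₀ ℕ) (j : Fin n) (i : Fin l) :
    ‖monomialFun Q (μ i) - μ i j‖ ≤ smallDivisor μ Q j :=
  le_ciSup (f := fun i => ‖monomialFun Q (μ i) - μ i j‖) (Set.finite_range _).bddAbove i

theorem smallDivisor_nonneg (μ : Fin l → Fin n → ℂ) (Q : Fin n →₀ ℕ) (j : Fin n) :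
    0 ≤ smallDivisor μ Q j :=
  Real.iSup_nonneg fun _ => norm_nonneg _

theorem smallDivisor_le {μ : Fin l → Fin n → ℂ} {Q : Fin n →₀ ℕ} {j : Fin n} {c : ℝ} (hc : 0 ≤ c)
    (h : ∀ i, ‖monomialFun Q (μ i) - μ i j‖ ≤ c) : smallDivisor μ Q j ≤ c :=
  Real.iSup_le h hc

theorem exists_norm_eq_smallDivisor {μ : Fin l → Fin n → ℂ} {Q : Fin n →₀ ℕ} {j : Fin n}
    (h : smallDivisor μ Q j ≠ 0) :
    ∃ i, ‖monomialFun Q (μ i) - μ i j‖ = smallDivisor μ Q j := by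
  rcases isEmpty_or_nonempty (Fin l) with hl | hl
  · exact absurd (Real.iSup_of_isEmpty _) h
  · exact exists_eq_ciSup_of_finite

theorem finite_omegaSeq_set (μ : Fin l → Fin n → ℂ) (I : Ideal (HolGerm n)) (k : ℕ) :
    {d : ℝ | d ≠ 0 ∧ ∃ (Q : Fin n →₀ ℕ) (j : Fin n), 2 ≤ Q.degree ∧ Q.degree ≤ 2 ^ k ∧
      monomialGerm Q ∉ I ∧ d = ⨆ i, ‖monomialFun Q (μ i) - μ i j‖}.Finite := by
  refine (((Finsupp.finite_of_degree_le (σ := Fin n) (2 ^ k)).prod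
    (Set.finite_univ (α := Fin n))).image fun x => smallDivisor μ x.1 x.2).subset ?_
  rintro d ⟨-, Q, j, -, hQ, -, rfl⟩
  exact ⟨(Q, j), ⟨hQ, Set.mem_univ _⟩, rfl⟩

theorem omegaSeq_le {μ : Fin l → Fin n → ℂ} {I : Ideal (HolGerm n)} {k : ℕ} {Q : Fin n →₀ ℕ}
    {j : Fin n} (h2 : 2 ≤ Q.degree) (hk : Q.degree ≤ 2 ^ k) (hQ : Q ∉ exponentSet I)
    (h0 : smallDivisor μ Q j ≠ 0) : omegaSeq μ I k ≤ smallDivisor μ Q j :=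
  csInf_le (finite_omegaSeq_set μ I k).bddBelow ⟨h0, Q, j, h2, hk, hQ, rfl⟩

/-- Only finitely many exponents have bounded degree, so the infimum is attained at a nonzero value.
-/
theorem omegaSeq_pos {μ : Fin l → Fin n → ℂ} {I : Ideal (HolGerm n)} {k : ℕ} {Q : Fin n →₀ ℕ}
    {j : Fin n} (h2 : 2 ≤ Q.degree) (hk : Q.degree ≤ 2 ^ k) (hQ : Q ∉ exponentSet I)
    (h0 : smallDivisor μ Q j ≠ 0) : 0 < omegaSeq μ I k := by
  have hne : {d : ℝ | d ≠ 0 ∧ ∃ (Q : Fin n →₀ ℕ) (j : Fin n), 2 ≤ Q.degree ∧ Q.degree ≤ 2 ^ k ∧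
      monomialGerm Q ∉ I ∧ d = ⨆ i, ‖monomialFun Q (μ i) - μ i j‖}.Nonempty :=
    ⟨_, h0, Q, j, h2, hk, hQ, rfl⟩
  obtain ⟨h, P, i, -, -, -, hd⟩ := hne.csInf_mem (finite_omegaSeq_set μ I k)
  refine lt_of_le_of_ne ?_ (Ne.symm h)
  exact (smallDivisor_nonneg μ P i).trans_eq hd.symm

/-- Exponents off `I` with small divisors of size less than a small multiple `θ ω_k` are
`2 ^ k`-separated. -/
theorem isSeparated_smallDivisor {μ : Fin l → Fin n → ℂ} {I : Ideal (HolGerm n)} {k : ℕ}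
    {j : Fin n} {a b θ : ℝ} (ha : 0 < a) (hμa : ∀ i j, a ≤ ‖μ i j‖) (hμb : ∀ i j, ‖μ i j‖ ≤ b)
    (hres : ∀ Q ∉ exponentSet I, 2 ≤ Q.degree → ∀ j, smallDivisor μ Q j ≠ 0)
    (hω : 0 < omegaSeq μ I k) (hθ1 : θ ≤ 1) (hθω : θ * omegaSeq μ I k ≤ a / 2)
    (hθb : 8 * b * θ ≤ a) :
    IsSeparated {Q | Q ∉ exponentSet I ∧ 2 ≤ Q.degree ∧
      smallDivisor μ Q j < θ * omegaSeq μ I k} (2 ^ k) := by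
  set ω := omegaSeq μ I k with hω_def
  constructor
  · rintro Q ⟨hQ, h2, hlt⟩
    by_contra! hk
    have := omegaSeq_le h2 hk.le hQ (hres Q hQ h2 j)
    nlinarith
  · rintro Q ⟨hQ, h2, hlt⟩ P ⟨hP, hP2, hPlt⟩ hle hne
    by_contra! hk
    obtain ⟨R, rfl⟩ := exists_add_of_le hle
    have hR : R ≠ 0 := by rintro rfl; simp at hne
    have hP0 : P ≠ 0 := by rintro rfl; simp at hP2
    obtain ⟨m, P', hPm⟩ := exists_eq_single_add hP0
    have hRd : R.degree ≠ 0 := fun h => hR ((Finsupp.degree_eq_zero_iff R).mp h)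
    -- If `μ^P` and `μ^(P+R)` are both close to `μ_j`, then `μ^R` is close to `1`, so `x_m x^R`
    -- nearly resonates with the component `m`. Taking `m` from `P` makes `e_m + R` a divisor of `P
    -- + R`, hence an exponent off the ideal, and its degree `1 + |R|` is at most `2 ^ k`: this
    -- contradicts the definition of `ω_k`.
    have hQ' : Finsupp.single m 1 + R ∉ exponentSet I := fun h =>
      hQ (isUpperSet_exponentSet I (by rw [hPm]; gcongr; exact le_self_add) h)
    have hd : (Finsupp.single m 1 + R).degree = 1 + R.degree := by simp
    have h2' : 2 ≤ (Finsupp.single m 1 + R).degree := by omega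
    rw [map_add] at hk
    have h1 := omegaSeq_le (j := m) h2' (k := k) (by omega) hQ' (hres _ hQ' h2' m)
    have h3 : smallDivisor μ (Finsupp.single m 1 + R) m ≤ ω / 2 := by
      refine smallDivisor_le (by linarith) fun i => ?_
      have e1 : a / 2 ≤ ‖monomialFun P (μ i)‖ := by
        have e2 := (norm_le_smallDivisor μ P j i).trans hPlt.le
        have e3 := norm_sub_norm_le (μ i j) (monomialFun P (μ i))
        rw [norm_sub_rev] at e3
        have := hμa i j
        linarith
      have e4 : ‖monomialFun P (μ i)‖ * ‖monomialFun R (μ i) - 1‖ ≤ 2 * (θ * ω) := by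
        rw [← norm_mul]
        have : monomialFun P (μ i) * (monomialFun R (μ i) - 1) =
            (monomialFun (P + R) (μ i) - μ i j) - (monomialFun P (μ i) - μ i j) := by
          rw [monomialFun_add]; ring
        rw [this]
        refine (norm_sub_le _ _).trans ?_
        have e2 := (norm_le_smallDivisor μ P j i).trans hPlt.le
        have e3 := (norm_le_smallDivisor μ (P + R) j i).trans hlt.le
        linarith
      have e5 : a / 2 * ‖monomialFun R (μ i) - 1‖ ≤ 2 * (θ * ω) :=
        (mul_le_mul_of_nonneg_right e1 (norm_nonneg _)).trans e4
      have e6 : monomialFun (Finsupp.single m 1 + R) (μ i) - μ i m =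
          μ i m * (monomialFun R (μ i) - 1) := by
        rw [monomialFun_add, monomialFun_single]; ring
      rw [e6, norm_mul]
      have hb0 : 0 ≤ b := (norm_nonneg _).trans (hμb i m)
      have e7 : ‖μ i m‖ * ‖monomialFun R (μ i) - 1‖ ≤ b * ‖monomialFun R (μ i) - 1‖ :=
        mul_le_mul_of_nonneg_right (hμb i m) (norm_nonneg _)
      refine e7.trans ?_
      have e8 : a * (b * ‖monomialFun R (μ i) - 1‖) ≤ a * (ω / 2) := by
        have e9 := mul_le_mul_of_nonneg_left e5 hb0
        have e10 := mul_le_mul_of_nonneg_right hθb hω.le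
        nlinarith
      exact le_of_mul_le_mul_left e8 ha
    linarith

/-- Under the diophantine condition the small divisors off `I` are absorbed by a superadditive
function of at most linear growth. -/
theorem exists_weight_of_isDiophantineOn {μ : Fin l → Fin n → ℂ} {I : Ideal (HolGerm n)}
    (hμ : ∀ i j, μ i j ≠ 0)
    (hres : ∀ Q ∉ exponentSet I, 2 ≤ Q.degree → ∀ j, smallDivisor μ Q j ≠ 0)
    (hD : IsDiophantineOn μ I) :
    ∃ (d : (Fin n →₀ ℕ) → ℝ) (C : ℝ), (∀ Q, 0 ≤ d Q) ∧ (∀ Q, d Q ≤ C * Q.degree) ∧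
      (∀ Q Q', d Q + d Q' ≤ d (Q + Q')) ∧
      ∀ Q Q', Q ≠ 0 → Q' ≠ 0 → Q + Q' ∉ exponentSet I → ∀ j,
        d Q + d Q' - Real.log (smallDivisor μ (Q + Q') j) ≤ d (Q + Q') := by
  by_cases hex : ∃ (Q : Fin n →₀ ℕ) (_ : Fin n), Q ∉ exponentSet I ∧ 2 ≤ Q.degree
  swap
  · push Not at hex
    refine ⟨0, 0, fun _ => le_rfl, fun _ => by simp, fun _ _ => by simp,
      fun Q Q' hQ hQ' hA j => ?_⟩
    have hQd : Q.degree ≠ 0 := fun h => hQ ((Finsupp.degree_eq_zero_iff Q).mp h)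
    have hQd' : Q'.degree ≠ 0 := fun h => hQ' ((Finsupp.degree_eq_zero_iff Q').mp h)
    have := hex _ j hA
    rw [map_add] at this
    omega
  -- A divisor of degree exactly `2` is already counted in `ω_1`. Its value `W` thus bounds every
  -- `ω_k` with `k ≥ 1`, all of these are positive, and one `θ` serves all scales.
  obtain ⟨Q₀, j₀, hQ₀, h2₀⟩ : ∃ (Q : Fin n →₀ ℕ) (_ : Fin n),
      Q ∉ exponentSet I ∧ Q.degree = 2 := by
    obtain ⟨Q, j, hQ, h2⟩ := hex
    obtain ⟨k, P, rfl⟩ := exists_eq_single_add (P := Q) (by rintro rfl; simp at h2)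
    obtain ⟨k', P', rfl⟩ := exists_eq_single_add (P := P) (by rintro rfl; simp at h2)
    refine ⟨Finsupp.single k 1 + Finsupp.single k' 1, j, fun h => hQ ?_, by simp⟩
    refine isUpperSet_exponentSet I ?_ h
    rw [← add_assoc]
    exact le_self_add
  obtain ⟨a, ha, hμa⟩ : ∃ a, 0 < a ∧ ∀ i j, a ≤ ‖μ i j‖ := by
    rcases isEmpty_or_nonempty (Fin l × Fin n) with h | h
    · exact ⟨1, one_pos, fun i j => (h.false (i, j)).elim⟩
    · obtain ⟨x, hx⟩ := Finite.exists_min fun x : Fin l × Fin n => ‖μ x.1 x.2‖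
      exact ⟨_, norm_pos_iff.mpr (hμ x.1 x.2), fun i j => hx (i, j)⟩
  obtain ⟨b, hb, hμb⟩ : ∃ b, 0 < b ∧ ∀ i j, ‖μ i j‖ ≤ b := by
    obtain ⟨b, hb⟩ := (Set.finite_range fun x : Fin l × Fin n => ‖μ x.1 x.2‖).bddAbove
    exact ⟨max b 1, by positivity, fun i j => le_max_of_le_left (hb ⟨(i, j), rfl⟩)⟩
  set W := smallDivisor μ Q₀ j₀ with hW_def
  have hW0 : W ≠ 0 := hres Q₀ hQ₀ h2₀.ge j₀
  have hW : 0 < W := lt_of_le_of_ne (smallDivisor_nonneg _ _ _) hW0.symm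
  have hpow : ∀ m : ℕ, 2 ≤ 2 ^ (m + 1) := fun m => by
    rw [pow_succ]; have := Nat.one_le_two_pow (n := m); omega
  have hωpos : ∀ m, 0 < omegaSeq μ I (m + 1) := fun m =>
    omegaSeq_pos h2₀.ge (h2₀.le.trans (hpow m)) hQ₀ hW0
  have hωW : ∀ m, omegaSeq μ I (m + 1) ≤ W := fun m =>
    omegaSeq_le h2₀.ge (h2₀.le.trans (hpow m)) hQ₀ hW0
  set θ := min 1 (min (a / (2 * W)) (a / (8 * b))) with hθ_def
  have hθ : 0 < θ := by positivity
  have hθ1 : θ ≤ 1 := min_le_left _ _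
  have hθW : θ * W ≤ a / 2 := by
    have : θ ≤ a / (2 * W) := (min_le_right _ _).trans (min_le_left _ _)
    rw [le_div_iff₀ (by positivity)] at this
    linarith
  have hθb : 8 * b * θ ≤ a := by
    have : θ ≤ a / (8 * b) := (min_le_right _ _).trans (min_le_right _ _)
    rw [le_div_iff₀ (by positivity)] at this
    linarith
  let β : ℕ → ℝ := fun m => max 0 (-Real.log (θ * omegaSeq μ I (m + 1)))
  have hβsum : Summable fun m => β m / 2 ^ (m + 1) := by
    have h1 : Summable fun m : ℕ => |Real.log θ| * (1 / 2) ^ (m + 1) :=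
      ((summable_nat_add_iff 1).mpr summable_geometric_two).mul_left _
    refine Summable.of_nonneg_of_le (fun m => by positivity) (fun m => ?_) (h1.add hD.abs)
    rw [abs_div, abs_of_pos (show (0 : ℝ) < 2 ^ (m + 1) by positivity), one_div, inv_pow,
      ← div_eq_mul_inv, ← add_div]
    gcongr
    refine max_le (by positivity) ?_
    rw [Real.log_mul hθ.ne' (hωpos m).ne', abs_neg]
    have := neg_abs_le (Real.log θ)
    have := neg_abs_le (Real.log (omegaSeq μ I (m + 1)))
    linarith
  have hlog : ∀ {x : ℝ} {m : ℕ}, θ * omegaSeq μ I (m + 1) ≤ x → -Real.log x ≤ β m := by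
    intro x m hx
    have := Real.log_le_log (mul_pos hθ (hωpos m)) hx
    exact le_max_of_le_right (by linarith)
  refine exists_weight_of_isSeparated (b := β)
    (s := fun m j => {Q | Q ∉ exponentSet I ∧ 2 ≤ Q.degree ∧
      smallDivisor μ Q j < θ * omegaSeq μ I (m + 1)}) (fun m => le_max_left _ _) ?_
    (fun m j => isSeparated_smallDivisor ha hμa hμb hres (hωpos m) hθ1
      ((mul_le_mul_of_nonneg_left (hωW m) hθ.le).trans hθW) hθb) ?_
  -- The cost `β (m + 1)` comes from `ω_{m+2}` but is divided by `2 ^ (m + 1)`, the separation at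
  -- scale `m`; the index shift loses a factor `2`.
  · have := ((summable_nat_add_iff 1).mpr hβsum).mul_left 2
    refine this.congr fun m => ?_
    rw [pow_succ (2 : ℝ) (m + 1)]
    field_simp
  · intro Q hQ h2 j
    by_cases h0 : θ * omegaSeq μ I (0 + 1) ≤ smallDivisor μ Q j
    · exact Or.inl (hlog h0)
    -- Choose the first threshold `θ ω` not exceeding the divisor. It bounds the cost, while failure
    -- at the preceding threshold places `Q` in the corresponding separated set.
    have hex : ∃ m, θ * omegaSeq μ I (m + 1) ≤ smallDivisor μ Q j := by
      refine ⟨Q.degree, ?_⟩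
      have h3 : Q.degree ≤ 2 ^ (Q.degree + 1) := (Nat.lt_two_pow_self.trans
        (Nat.pow_lt_pow_right one_lt_two Q.degree.lt_succ_self)).le
      have h1 := omegaSeq_le h2 h3 hQ (hres Q hQ h2 j)
      exact (mul_le_of_le_one_left (hωpos _).le hθ1).trans h1
    classical
    obtain ⟨m, hm⟩ : ∃ m, Nat.find hex = m + 1 :=
      Nat.exists_eq_succ_of_ne_zero fun h => h0 (h ▸ Nat.find_spec hex)
    exact Or.inr ⟨m, ⟨hQ, h2, not_le.mp (Nat.find_min hex (by omega))⟩,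
      hlog (hm ▸ Nat.find_spec hex)⟩

/-! ### Convergence on polydiscs and the calculus of Taylor expansions -/

/-- The weight `s ^ |Q|` of the polydisc of radius `s`. -/
def polyWeight (n : ℕ) (s : ℝ≥0∞) (Q : Fin n →₀ ℕ) : ℝ≥0∞ := s ^ Q.degree

theorem polyWeight_zero (s : ℝ≥0∞) : polyWeight n s 0 ≤ 1 := by simp [polyWeight]

theorem polyWeight_add (s : ℝ≥0∞) (Q Q' : Fin n →₀ ℕ) :
    polyWeight n s (Q + Q') ≤ polyWeight n s Q * polyWeight n s Q' :=
  pow_add_weight_le s Q Q'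

theorem wnorm_polyWeight_mono {s t : ℝ≥0∞} (h : s ≤ t) (p : MvPowerSeries (Fin n) ℂ) :
    wnorm (polyWeight n s) p ≤ wnorm (polyWeight n t) p :=
  wnorm_mono fun _ _ => pow_le_pow_left₀ zero_le h _

/-- On polydiscs of smaller radius the norm of a series of order `k` shrinks like the `k`-th
power. -/
theorem wnorm_polyWeight_mul_le {k : ℕ} {p : MvPowerSeries (Fin n) ℂ} (hp : VanishOff (degGE n k) p)
    {c : ℝ≥0∞} (hc : c ≤ 1) (s : ℝ≥0∞) :
    wnorm (polyWeight n (c * s)) p ≤ c ^ k * wnorm (polyWeight n s) p := by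
  unfold wnorm
  rw [← ENNReal.tsum_mul_left]
  refine ENNReal.tsum_le_tsum fun Q => ?_
  by_cases hQ : Q ∈ degGE n k
  · rw [polyWeight, mul_pow, mul_left_comm]
    exact mul_le_mul_left (pow_le_pow_right_of_le_one' hc hQ) _
  · simp [hp Q hQ]

theorem norm_monomialFun_le {r : ℝ} {z : Fin n → ℂ} (hz : ‖z‖ ≤ r) (Q : Fin n →₀ ℕ) :
    ‖monomialFun Q z‖ ≤ r ^ Q.degree := by
  rw [monomialFun, norm_prod, ← mpow_const, mpow, Finsupp.prod_fintype _ _ fun _ => pow_zero _]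
  refine Finset.prod_le_prod (fun _ _ => norm_nonneg _) fun j _ => ?_
  rw [norm_pow]
  exact pow_le_pow_left₀ (norm_nonneg _) ((norm_le_pi_norm z j).trans hz) _

theorem summable_norm_iff_wnorm {r : ℝ≥0} {p : MvPowerSeries (Fin n) ℂ} :
    wnorm (polyWeight n r) p ≠ ∞ ↔ Summable fun Q : Fin n →₀ ℕ => ‖coeff Q p‖ * (r : ℝ) ^ Q.degree := by
  have : wnorm (polyWeight n r) p =
      ∑' Q : Fin n →₀ ℕ, ((‖coeff Q p‖₊ * r ^ Q.degree : ℝ≥0) : ℝ≥0∞) := by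
    simp [wnorm, polyWeight, enorm]
  rw [this, ENNReal.tsum_coe_ne_top_iff_summable, ← NNReal.summable_coe]
  simp

/-- The sum of a power series, where it converges. -/
def evalSeries (p : MvPowerSeries (Fin n) ℂ) (z : Fin n → ℂ) : ℂ :=
  ∑' Q, coeff Q p * monomialFun Q z

theorem norm_term_le {r : ℝ≥0} {z : Fin n → ℂ} (hz : ‖z‖ ≤ r) (p : MvPowerSeries (Fin n) ℂ)
    (Q : Fin n →₀ ℕ) : ‖coeff Q p * monomialFun Q z‖ ≤ ‖coeff Q p‖ * (r : ℝ) ^ Q.degree := by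
  rw [norm_mul]
  gcongr
  exact norm_monomialFun_le hz Q

theorem summable_norm_term {r : ℝ≥0} {z : Fin n → ℂ} (hz : ‖z‖ ≤ r) {p : MvPowerSeries (Fin n) ℂ}
    (hp : wnorm (polyWeight n r) p ≠ ∞) :
    Summable fun Q => ‖coeff Q p * monomialFun Q z‖ :=
  Summable.of_nonneg_of_le (fun _ => norm_nonneg _) (norm_term_le hz p)
    (summable_norm_iff_wnorm.mp hp)

theorem hasSum_evalSeries {r : ℝ≥0} {z : Fin n → ℂ} (hz : ‖z‖ ≤ r) {p : MvPowerSeries (Fin n) ℂ}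
    (hp : wnorm (polyWeight n r) p ≠ ∞) :
    HasSum (fun Q => coeff Q p * monomialFun Q z) (evalSeries p z) :=
  (summable_norm_term hz hp).of_norm.hasSum

theorem enorm_evalSeries_le {r : ℝ≥0} {z : Fin n → ℂ} (hz : ‖z‖ ≤ r)
    (p : MvPowerSeries (Fin n) ℂ) : ‖evalSeries p z‖ₑ ≤ wnorm (polyWeight n r) p := by
  by_cases hp : wnorm (polyWeight n r) p = ∞
  · simp [hp]
  refine enorm_tsum_le_tsum_enorm.trans (ENNReal.tsum_le_tsum fun Q => ?_)
  rw [enorm_mul]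
  gcongr
  have := norm_monomialFun_le hz Q
  rw [polyWeight, enorm_eq_nnnorm, ← ENNReal.coe_pow, ENNReal.coe_le_coe]
  exact_mod_cast this

theorem coeff_mul_mul_monomialFun (p q : MvPowerSeries (Fin n) ℂ) (z : Fin n → ℂ)
    (Q : Fin n →₀ ℕ) :
    coeff Q (p * q) * monomialFun Q z = ∑ x ∈ Finset.HasAntidiagonal.antidiagonal Q,
      coeff x.1 p * monomialFun x.1 z * (coeff x.2 q * monomialFun x.2 z) := by
  classical
  rw [coeff_mul, Finset.sum_mul]
  refine Finset.sum_congr rfl fun x hx => ?_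
  rw [Finset.HasAntidiagonal.mem_antidiagonal] at hx
  rw [← hx, monomialFun_add]
  ring

theorem evalSeries_mul {r : ℝ≥0} {z : Fin n → ℂ} (hz : ‖z‖ ≤ r) {p q : MvPowerSeries (Fin n) ℂ}
    (hp : wnorm (polyWeight n r) p ≠ ∞) (hq : wnorm (polyWeight n r) q ≠ ∞) :
    evalSeries (p * q) z = evalSeries p z * evalSeries q z := by
  have h1 := summable_norm_term hz hp
  have h2 := summable_norm_term hz hq
  have h3 := summable_mul_of_summable_norm h1 h2
  have h4 := Summable.tsum_mul_tsum_eq_tsum_sum_antidiagonal h1.of_norm h2.of_norm h3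
  unfold evalSeries
  rw [h4]
  exact tsum_congr (coeff_mul_mul_monomialFun p q z)

theorem evalSeries_one (z : Fin n → ℂ) : evalSeries (1 : MvPowerSeries (Fin n) ℂ) z = 1 := by
  classical
  unfold evalSeries
  rw [tsum_eq_single 0]
  · simp [monomialFun]
  · intro Q hQ
    simp [coeff_one, hQ]

theorem wnorm_mpow_ne_top {r : ℝ≥0} {a : Fin n → MvPowerSeries (Fin n) ℂ}
    (ha : ∀ j, wnorm (polyWeight n r) (a j) ≠ ∞) (P : Fin n →₀ ℕ) :
    wnorm (polyWeight n r) (mpow a P) ≠ ∞ :=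
  ne_top_of_le_ne_top (ENNReal.prod_ne_top fun j _ => ENNReal.pow_ne_top (ha j))
    (wnorm_mpow_le (polyWeight_zero _) (polyWeight_add _) a P)

theorem evalSeries_mpow {r : ℝ≥0} {z : Fin n → ℂ} (hz : ‖z‖ ≤ r)
    {a : Fin n → MvPowerSeries (Fin n) ℂ} (ha : ∀ j, wnorm (polyWeight n r) (a j) ≠ ∞)
    (P : Fin n →₀ ℕ) :
    evalSeries (mpow a P) z = monomialFun P fun j => evalSeries (a j) z := by
  rw [← mpow_eq_monomialFun]
  induction P using exponent_induction with
  | zero => rw [mpow_zero, mpow_zero, evalSeries_one]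
  | add k P ih =>
    rw [mpow_add, mpow_add, mpow_single, mpow_single,
      evalSeries_mul hz (ha k) (wnorm_mpow_ne_top ha P), ih]

/-- The double series over outer and inner exponents is absolutely summable, being dominated by the
norm of `p` at radius `s`; exchanging the sums identifies formal substitution with composition. -/
theorem evalSeries_subst {r s : ℝ≥0} {z : Fin n → ℂ} (hz : ‖z‖ ≤ r)
    {a : Fin n → MvPowerSeries (Fin n) ℂ} (ha : ∀ j, constantCoeff (a j) = 0)
    (has : ∀ j, wnorm (polyWeight n r) (a j) ≤ s) {p : MvPowerSeries (Fin n) ℂ}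
    (hp : wnorm (polyWeight n s) p ≠ ∞) :
    evalSeries (subst a p) z = evalSeries p fun j => evalSeries (a j) z := by
  have hsub := hasSubst_of_constantCoeff_zero ha
  have hfin : ∀ j, wnorm (polyWeight n r) (a j) ≠ ∞ :=
    fun j => ne_top_of_le_ne_top ENNReal.coe_ne_top (has j)
  have hsum : Summable (Function.uncurry fun P Q : Fin n →₀ ℕ =>
      coeff P p * (coeff Q (mpow a P) * monomialFun Q z)) := by
    refine Summable.of_norm ?_
    refine (NNReal.summable_coe (f := fun x : (Fin n →₀ ℕ) × (Fin n →₀ ℕ) =>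
      ‖coeff x.1 p * (coeff x.2 (mpow a x.1) * monomialFun x.2 z)‖₊)).mpr ?_
    rw [← ENNReal.tsum_coe_ne_top_iff_summable, ENNReal.tsum_prod
      (f := fun P Q => ((‖coeff P p * (coeff Q (mpow a P) * monomialFun Q z)‖₊ : ℝ≥0) : ℝ≥0∞))]
    refine ne_top_of_le_ne_top hp (ENNReal.tsum_le_tsum fun P => ?_)
    have h1 : ∀ Q, ((‖coeff P p * (coeff Q (mpow a P) * monomialFun Q z)‖₊ : ℝ≥0) : ℝ≥0∞) ≤
        ‖coeff P p‖ₑ * (‖coeff Q (mpow a P)‖ₑ * polyWeight n r Q) := by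
      intro Q
      rw [← enorm_eq_nnnorm, enorm_mul, enorm_mul]
      gcongr
      have := norm_monomialFun_le hz Q
      rw [polyWeight, enorm_eq_nnnorm, ← ENNReal.coe_pow, ENNReal.coe_le_coe]
      exact_mod_cast this
    refine (ENNReal.tsum_le_tsum h1).trans ?_
    rw [ENNReal.tsum_mul_left]
    gcongr
    exact (wnorm_mpow_le (polyWeight_zero _) (polyWeight_add _) a P).trans
      ((mpow_mono has P).trans_eq (mpow_const _ P))
  unfold evalSeries
  calc ∑' Q, coeff Q (subst a p) * monomialFun Q z
      = ∑' Q, ∑' P, coeff P p * (coeff Q (mpow a P) * monomialFun Q z) := by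
        refine tsum_congr fun Q => ?_
        rw [coeff_subst_eq hsub, ← tsum_eq_finsum (L := .unconditional _) (finite_support_coeff_subst hsub p Q),
          ← tsum_mul_right]
        simp only [mul_assoc]
    _ = ∑' P, ∑' Q, coeff P p * (coeff Q (mpow a P) * monomialFun Q z) := hsum.tsum_comm
    _ = _ := by
        refine tsum_congr fun P => ?_
        rw [tsum_mul_left]
        congr 1
        exact evalSeries_mpow hz hfin P

theorem eventually_norm_le {r : ℝ≥0} (hr : 0 < r) : ∀ᶠ z : Fin n → ℂ in 𝓝 0, ‖z‖ ≤ r := by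
  filter_upwards [Metric.closedBall_mem_nhds (0 : Fin n → ℂ) (NNReal.coe_pos.mpr hr)] with z hz
  simpa using hz

namespace IsTaylorExpansion

variable {p q : MvPowerSeries (Fin n) ℂ} {f g : (Fin n → ℂ) → ℂ}

theorem of_wnorm {r : ℝ≥0} (hr : 0 < r) (hp : wnorm (polyWeight n r) p ≠ ∞) :
    IsTaylorExpansion p (evalSeries p) := by
  filter_upwards [eventually_norm_le hr] with z hz using hasSum_evalSeries hz hp

theorem congr (hp : IsTaylorExpansion p f) (h : f =ᶠ[𝓝 0] g) : IsTaylorExpansion p g := by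
  filter_upwards [hp, h] with z hz hfg using hfg ▸ hz

theorem eventuallyEq (hp : IsTaylorExpansion p f) : f =ᶠ[𝓝 0] evalSeries p := by
  filter_upwards [hp] with z hz using hz.tsum_eq.symm

theorem add (hp : IsTaylorExpansion p f) (hq : IsTaylorExpansion q g) :
    IsTaylorExpansion (p + q) fun z => f z + g z := by
  filter_upwards [hp, hq] with z hz hz'
  simpa only [map_add, add_mul] using hz.add hz'

theorem sub (hp : IsTaylorExpansion p f) (hq : IsTaylorExpansion q g) :
    IsTaylorExpansion (p - q) fun z => f z - g z := by
  filter_upwards [hp, hq] with z hz hz'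
  simpa only [map_sub, sub_mul] using hz.sub hz'

theorem monomial (Q : Fin n →₀ ℕ) (c : ℂ) :
    IsTaylorExpansion (monomial Q c) fun z => c * monomialFun Q z := by
  classical
  refine Filter.Eventually.of_forall fun z => ?_
  convert! hasSum_ite_eq Q (c * monomialFun Q z) using 2 with P
  rw [coeff_monomial]
  split_ifs with h
  · rw [h]
  · rw [zero_mul]

theorem X (j : Fin n) : IsTaylorExpansion (X j) fun z => z j := by
  have := monomial (Finsupp.single j 1) 1
  simp only [monomialFun_single, one_mul] at this
  exact this

theorem exists_radius (hp : IsTaylorExpansion p f) :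
    ∃ r : ℝ≥0, 0 < r ∧ wnorm (polyWeight n r) p ≠ ∞ := by
  obtain ⟨ε, hε, h⟩ := Metric.eventually_nhds_iff.mp hp
  have hε2 : (0 : ℝ) ≤ ε / 2 := by positivity
  refine ⟨⟨ε / 2, hε2⟩, by exact_mod_cast half_pos hε, summable_norm_iff_wnorm.mpr ?_⟩
  -- At the point with all coordinates `ε / 2` each monomial takes the value `(ε / 2) ^ |Q|`, and an
  -- unconditionally convergent series of complex numbers converges absolutely.
  have hz := h (y := fun _ => ((ε / 2 : ℝ) : ℂ)) (by
    rw [dist_zero_right]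
    refine lt_of_le_of_lt ((pi_norm_le_iff_of_nonneg hε2).mpr fun j => ?_) (half_lt_self hε)
    rw [Complex.norm_real, Real.norm_of_nonneg hε2])
  refine hz.summable.norm.congr fun Q => ?_
  rw [← mpow_eq_monomialFun, mpow_const, norm_mul, norm_pow, Complex.norm_real,
    Real.norm_of_nonneg hε2]
  rfl

theorem exists_radius_le {ι : Type*} [Finite ι] {p : ι → MvPowerSeries (Fin n) ℂ}
    {f : ι → (Fin n → ℂ) → ℂ} (hp : ∀ i, IsTaylorExpansion (p i) (f i)) :
    ∃ r : ℝ≥0, 0 < r ∧ ∀ i, wnorm (polyWeight n r) (p i) ≠ ∞ := by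
  choose r hr h using fun i => (hp i).exists_radius
  rcases isEmpty_or_nonempty ι with hι | hι
  · exact ⟨1, one_pos, fun i => hι.elim i⟩
  · obtain ⟨i₀, hi₀⟩ := Finite.exists_min r
    exact ⟨r i₀, hr i₀, fun i => ne_top_of_le_ne_top (h i)
      (wnorm_polyWeight_mono (ENNReal.coe_le_coe.mpr (hi₀ i)) _)⟩

theorem mul (hp : IsTaylorExpansion p f) (hq : IsTaylorExpansion q g) :
    IsTaylorExpansion (p * q) fun z => f z * g z := by
  obtain ⟨r, hr, h⟩ := hp.exists_radius
  obtain ⟨s, hs, h'⟩ := hq.exists_radius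
  have hm : 0 < min r s := lt_min hr hs
  have h1 := ne_top_of_le_ne_top h
    (wnorm_polyWeight_mono (ENNReal.coe_le_coe.mpr (min_le_left r s)) p)
  have h2 := ne_top_of_le_ne_top h'
    (wnorm_polyWeight_mono (ENNReal.coe_le_coe.mpr (min_le_right r s)) q)
  have h3 : wnorm (polyWeight n (min r s : ℝ≥0)) (p * q) ≠ ∞ :=
    ne_top_of_le_ne_top (ENNReal.mul_ne_top h1 h2)
      (wnorm_mul_le fun Q Q' _ _ => polyWeight_add _ Q Q')
  refine (of_wnorm hm h3).congr ?_
  filter_upwards [hp.eventuallyEq, hq.eventuallyEq, eventually_norm_le hm] with z e1 e2 hz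
  rw [e1, e2, evalSeries_mul hz h1 h2]

/-- Without constant terms the norms decrease at least linearly with the radius, so they can be made
small enough for an outer series to be evaluated. -/
theorem exists_wnorm_le {ι : Type*} [Finite ι] {p : ι → MvPowerSeries (Fin n) ℂ}
    {f : ι → (Fin n → ℂ) → ℂ} (hp : ∀ i, IsTaylorExpansion (p i) (f i))
    (h0 : ∀ i, constantCoeff (p i) = 0) {s : ℝ≥0} (hs : 0 < s) :
    ∃ r : ℝ≥0, 0 < r ∧ ∀ i, wnorm (polyWeight n r) (p i) ≤ s := by
  obtain ⟨r, hr, h⟩ := exists_radius_le hp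
  have := Fintype.ofFinite ι
  set N : ℝ≥0 := ∑ i, (wnorm (polyWeight n r) (p i)).toNNReal
  have hN : ∀ i, wnorm (polyWeight n r) (p i) ≤ N := fun i => by
    rw [← ENNReal.coe_toNNReal (h i)]
    exact ENNReal.coe_le_coe.mpr (Finset.single_le_sum
      (f := fun i => (wnorm (polyWeight n r) (p i)).toNNReal) (fun _ _ => zero_le)
      (Finset.mem_univ i))
  set c : ℝ≥0 := min 1 (s / (N + 1)) with hc
  have hc0 : 0 < c := lt_min one_pos (div_pos hs (by positivity))
  refine ⟨c * r, mul_pos hc0 hr, fun i => ?_⟩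
  have hv : VanishOff (degGE n 1) (p i) := by
    intro Q hQ
    have : Q = 0 := (Finsupp.degree_eq_zero_iff Q).mp (by simpa [degGE] using hQ)
    rw [this]; exact h0 i
  rw [ENNReal.coe_mul]
  refine (wnorm_polyWeight_mul_le hv (by exact_mod_cast min_le_left _ _) _).trans ?_
  rw [pow_one]
  refine (mul_le_mul_right (hN i) _).trans ?_
  rw [← ENNReal.coe_mul, ENNReal.coe_le_coe]
  calc c * N ≤ s / (N + 1) * (N + 1) := by
        gcongr
        · exact min_le_right _ _
        · exact le_self_add
    _ = s := div_mul_cancel₀ _ (by positivity)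

theorem comp {a : Fin n → MvPowerSeries (Fin n) ℂ} {G : (Fin n → ℂ) → Fin n → ℂ}
    (hp : IsTaylorExpansion p f) (ha : ∀ j, IsTaylorExpansion (a j) fun z => G z j)
    (h0 : ∀ j, constantCoeff (a j) = 0) : IsTaylorExpansion (subst a p) fun z => f (G z) := by
  obtain ⟨s, hs, hps⟩ := hp.exists_radius
  obtain ⟨ε, hε, he⟩ := Metric.eventually_nhds_iff.mp hp.eventuallyEq
  set t : ℝ≥0 := min s ⟨ε / 2, by positivity⟩
  have ht : 0 < t := lt_min hs (by exact_mod_cast half_pos hε)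
  have hpt : wnorm (polyWeight n t) p ≠ ∞ := ne_top_of_le_ne_top hps
    (wnorm_polyWeight_mono (ENNReal.coe_le_coe.mpr (min_le_left _ _)) p)
  obtain ⟨r, hr, hra⟩ := exists_wnorm_le ha h0 ht
  refine (of_wnorm hr (ne_top_of_le_ne_top hpt (wnorm_subst_le (polyWeight_zero _)
    (polyWeight_add _) (hasSubst_of_constantCoeff_zero h0) hra p))).congr ?_
  have hG : ∀ᶠ z in 𝓝 0, ∀ j, G z j = evalSeries (a j) z :=
    Filter.eventually_all.mpr fun j => (ha j).eventuallyEq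
  filter_upwards [hG, eventually_norm_le hr] with z hGz hz
  rw [evalSeries_subst hz h0 hra hpt, ← funext hGz]
  refine (he ?_).symm
  rw [dist_zero_right]
  have : ‖G z‖ ≤ t := (pi_norm_le_iff_of_nonneg t.2).mpr fun j => by
    have := (enorm_evalSeries_le hz (a j)).trans (hra j)
    rw [← hGz j, enorm_eq_nnnorm, ENNReal.coe_le_coe] at this
    exact_mod_cast this
  have ht2 : (t : ℝ) ≤ ε / 2 := by
    have : t ≤ ⟨ε / 2, by positivity⟩ := min_le_right _ _
    exact_mod_cast this
  linarith

end IsTaylorExpansion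

/-! ### Taylor expansions and analytic germs -/

theorem exists_prod_eq_monomialFun {k : ℕ} {Q : Fin n →₀ ℕ} (hQ : Q.degree = k) :
    ∃ v : Fin k → Fin n, ∀ z, ∏ i, z (v i) = monomialFun Q z := by
  induction k generalizing Q with
  | zero =>
    rw [Finsupp.degree_eq_zero_iff] at hQ
    subst hQ
    exact ⟨Fin.elim0, fun z => by simp [monomialFun]⟩
  | succ k ih =>
    obtain ⟨m, P, rfl⟩ := exists_eq_single_add (P := Q) (by rintro rfl; simp at hQ)
    obtain ⟨v, hv⟩ := ih (Q := P) (by simp at hQ; omega)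
    refine ⟨Fin.cons m v, fun z => ?_⟩
    rw [Fin.prod_univ_succ, monomialFun_add, monomialFun_single]
    simp [hv]

/-- The monomial `x^Q` of degree `k`, as the diagonal of a multilinear map of norm at most `1`. -/
theorem exists_multilinear_monomial {k : ℕ} {Q : Fin n →₀ ℕ} (hQ : Q.degree = k) :
    ∃ M : ContinuousMultilinearMap ℂ (fun _ : Fin k => Fin n → ℂ) ℂ,
      (∀ z, (M fun _ => z) = monomialFun Q z) ∧ ‖M‖ ≤ 1 := by
  obtain ⟨v, hv⟩ := exists_prod_eq_monomialFun hQ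
  refine ⟨(ContinuousMultilinearMap.mkPiAlgebra ℂ (Fin k) ℂ).compContinuousLinearMap
    fun i => ContinuousLinearMap.proj (v i), fun z => by simpa using hv z, ?_⟩
  refine ContinuousMultilinearMap.opNorm_le_bound zero_le_one fun m => ?_
  rw [one_mul]
  simp only [ContinuousMultilinearMap.compContinuousLinearMap_apply,
    ContinuousMultilinearMap.mkPiAlgebra_apply, ContinuousLinearMap.proj_apply, norm_prod]
  exact Finset.prod_le_prod (fun _ _ => norm_nonneg _) fun i _ => norm_le_pi_norm _ _

instance fintypeDegree (n k : ℕ) : Fintype {Q : Fin n →₀ ℕ // Q.degree = k} :=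
  (Finsupp.finite_of_degree_eq k).fintype

/-- The formal multilinear series with the given coefficients. -/
def toFormalMultilinearSeries (p : MvPowerSeries (Fin n) ℂ) :
    FormalMultilinearSeries ℂ (Fin n → ℂ) ℂ :=
  fun k => ∑ Q : {Q : Fin n →₀ ℕ // Q.degree = k},
    coeff Q.1 p • (exists_multilinear_monomial Q.2).choose

theorem toFormalMultilinearSeries_apply (p : MvPowerSeries (Fin n) ℂ) (k : ℕ) (z : Fin n → ℂ) :
    (toFormalMultilinearSeries p k fun _ => z) =
      ∑ Q : {Q : Fin n →₀ ℕ // Q.degree = k}, coeff Q.1 p * monomialFun Q.1 z := by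
  simp only [toFormalMultilinearSeries, sum_apply,
    smul_apply, smul_eq_mul]
  exact Finset.sum_congr rfl fun Q _ => by
    rw [(exists_multilinear_monomial Q.2).choose_spec.1]

theorem IsTaylorExpansion.hasFPowerSeriesAt {p : MvPowerSeries (Fin n) ℂ} {f : (Fin n → ℂ) → ℂ}
    (hp : IsTaylorExpansion p f) : HasFPowerSeriesAt f (toFormalMultilinearSeries p) 0 := by
  obtain ⟨r, hr, hpr⟩ := hp.exists_radius
  obtain ⟨ε, hε, he⟩ := Metric.eventually_nhds_iff.mp hp
  have hsum := summable_norm_iff_wnorm.mp hpr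
  refine ⟨min r (ENNReal.ofReal ε), ?_, lt_min (by exact_mod_cast hr) (by simpa using hε), ?_⟩
  · refine (min_le_left _ _).trans ((toFormalMultilinearSeries p).le_radius_of_bound
      (∑' Q : Fin n →₀ ℕ, ‖coeff Q p‖ * (r : ℝ) ^ Q.degree) fun k => ?_)
    have h1 : ‖toFormalMultilinearSeries p k‖ ≤
        ∑ Q : {Q : Fin n →₀ ℕ // Q.degree = k}, ‖coeff Q.1 p‖ := by
      refine norm_sum_le_of_le _ fun Q _ => ?_
      rw [norm_smul]
      exact mul_le_of_le_one_right (norm_nonneg _)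
        (exists_multilinear_monomial Q.2).choose_spec.2
    calc _ ≤ (∑ Q : {Q : Fin n →₀ ℕ // Q.degree = k}, ‖coeff Q.1 p‖) * (r : ℝ) ^ k := by gcongr
      _ = ∑ Q : {Q : Fin n →₀ ℕ // Q.degree = k}, ‖coeff Q.1 p‖ * (r : ℝ) ^ Q.1.degree := by
          rw [Finset.sum_mul]
          exact Finset.sum_congr rfl fun Q _ => by rw [Q.2]
      _ = ∑' Q : {Q : Fin n →₀ ℕ // Q.degree = k}, ‖coeff Q.1 p‖ * (r : ℝ) ^ Q.1.degree :=
          (tsum_fintype _).symm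
      _ ≤ _ := hsum.tsum_subtype_le (fun Q : Fin n →₀ ℕ => ‖coeff Q p‖ * (r : ℝ) ^ Q.degree)
          {Q : Fin n →₀ ℕ | Q.degree = k} (fun Q => by positivity)
  · intro y hy
    have hyε : dist y 0 < ε := by
      have := Metric.mem_eball.mp (Metric.eball_subset_eball (min_le_right _ _) hy)
      rwa [edist_dist, ENNReal.ofReal_lt_ofReal_iff hε] at this
    have h1 := ((Equiv.sigmaFiberEquiv (Finsupp.degree : (Fin n →₀ ℕ) → ℕ)).hasSum_iff.mpr
      (he hyε)).sigma (fun k => hasSum_fintype _)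
    rw [zero_add]
    exact h1.congr_fun fun k => toFormalMultilinearSeries_apply p k y

theorem eq_single_of_degree_eq_one {Q : Fin n →₀ ℕ} (hQ : Q.degree = 1) :
    ∃ k, Q = Finsupp.single k 1 := by
  obtain ⟨k, P, rfl⟩ := exists_eq_single_add (P := Q) (by rintro rfl; simp at hQ)
  have : P = 0 := by
    rw [← Finsupp.degree_eq_zero_iff]
    simp at hQ
    omega
  exact ⟨k, by rw [this, add_zero]⟩

namespace IsTaylorExpansion

variable {p q : MvPowerSeries (Fin n) ℂ} {f g : (Fin n → ℂ) → ℂ}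

theorem analyticAt (hp : IsTaylorExpansion p f) : AnalyticAt ℂ f 0 :=
  ⟨_, hp.hasFPowerSeriesAt⟩

theorem hasFDerivAt (hp : IsTaylorExpansion p f) :
    HasFDerivAt f (∑ k, coeff (Finsupp.single k 1) p •
      (ContinuousLinearMap.proj k : (Fin n → ℂ) →L[ℂ] ℂ)) 0 := by
  convert! hp.hasFPowerSeriesAt.hasFDerivAt using 1
  ext1 z
  let e : Fin n → {Q : Fin n →₀ ℕ // Q.degree = 1} := fun k => ⟨Finsupp.single k 1, by simp⟩
  have he : Function.Bijective e := by
    constructor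
    · intro k k' h
      exact Finsupp.single_left_injective one_ne_zero (congrArg Subtype.val h)
    · rintro ⟨Q, hQ⟩
      obtain ⟨k, rfl⟩ := eq_single_of_degree_eq_one hQ
      exact ⟨k, rfl⟩
  have h1 := toFormalMultilinearSeries_apply p 1 z
  rw [← he.sum_comp (fun Q => coeff Q.1 p * monomialFun Q.1 z)] at h1
  simp only [e, monomialFun_single] at h1
  rw [continuousMultilinearCurryFin1_apply]
  have h2 : (Fin.snoc 0 z : Fin 1 → Fin n → ℂ) = fun _ => z := by
    funext i
    rw [Fin.eq_zero i]
    rfl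
  rw [h2, h1]
  simp

theorem apply_zero (hp : IsTaylorExpansion p f) : f 0 = constantCoeff p := by
  have h := hp.self_of_nhds
  refine h.unique ?_
  convert! hasSum_ite_eq (0 : Fin n →₀ ℕ) (constantCoeff p) using 2 with Q
  split_ifs with hQ
  · subst hQ
    simp [monomialFun]
  · obtain ⟨k, P, rfl⟩ := exists_eq_single_add hQ
    rw [monomialFun_add, monomialFun_single]
    simp

/-- Each homogeneous part vanishes as a function, hence as a polynomial, since `ℂ` is infinite. -/
theorem eq_zero (hp : IsTaylorExpansion p f) (hf : f =ᶠ[𝓝 0] 0) : p = 0 := by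
  ext Q
  have h1 := (hp.congr hf).hasFPowerSeriesAt.apply_eq_zero Q.degree
  let P : MvPolynomial (Fin n) ℂ :=
    ∑ R : {R : Fin n →₀ ℕ // R.degree = Q.degree}, MvPolynomial.monomial R.1 (coeff R.1 p)
  have h2 : P = 0 := by
    refine MvPolynomial.funext fun z => ?_
    rw [map_zero, ← h1 z, toFormalMultilinearSeries_apply]
    simp only [P, map_sum, MvPolynomial.eval_monomial]
    exact Finset.sum_congr rfl fun R _ => by rw [← mpow_eq_monomialFun]; rfl
  have h3 : MvPolynomial.coeff Q P = coeff Q p := by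
    simp only [P, MvPolynomial.coeff_sum, MvPolynomial.coeff_monomial]
    rw [Finset.sum_eq_single ⟨Q, rfl⟩]
    · simp
    · rintro ⟨R, hR⟩ - hne
      exact if_neg fun h => hne (Subtype.ext h)
    · simp
  rw [← h3, h2]
  simp

theorem unique (hp : IsTaylorExpansion p f) (hq : IsTaylorExpansion q g) (h : f =ᶠ[𝓝 0] g) :
    p = q := by
  refine sub_eq_zero.mp ((hp.sub hq).eq_zero ?_)
  filter_upwards [h] with z hz
  simp [hz]

end IsTaylorExpansion

/-- Expand each multilinear term in the standard basis and collect words with the same exponent. The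
term of order `k` splits into `n ^ k` words, which is compensated by shrinking the radius by the
factor `n + 1`. -/
theorem exists_isTaylorExpansion {f : (Fin n → ℂ) → ℂ} (hf : AnalyticAt ℂ f 0) :
    ∃ p, IsTaylorExpansion p f := by
  classical
  obtain ⟨q, r, hq⟩ := hf
  obtain ⟨ρ, hρ0, hρ⟩ := ENNReal.lt_iff_exists_nnreal_btwn.mp (hq.r_pos.trans_le hq.r_le)
  have hρ0' : 0 < ρ := by exact_mod_cast hρ0
  have hqs := q.summable_norm_mul_pow hρ
  let τ : ℝ≥0 := ρ / (n + 1)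
  have hτ : 0 < τ := by positivity
  have hτρ : (n : ℝ) * τ ≤ ρ := by
    have : (n : ℝ≥0) * τ ≤ ρ := by
      calc (n : ℝ≥0) * τ ≤ (n + 1) * (ρ / (n + 1)) := by gcongr; exact le_self_add
        _ = ρ := mul_div_cancel₀ _ (by positivity)
    exact_mod_cast this
  let e : Fin n → Fin n → ℂ := fun j => Pi.single j 1
  let a : (Σ k : ℕ, Fin k → Fin n) → ℂ := fun x => q x.1 fun i => e (x.2 i)
  let ex : (Σ k : ℕ, Fin k → Fin n) → (Fin n →₀ ℕ) := fun x => ∑ i, Finsupp.single (x.2 i) 1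
  have hmon : ∀ (x : Σ k : ℕ, Fin k → Fin n) (z : Fin n → ℂ),
      monomialFun (ex x) z = ∏ i, z (x.2 i) := by
    rintro ⟨k, v⟩ z
    have : ∀ s : Finset (Fin k), monomialFun (∑ i ∈ s, Finsupp.single (v i) 1) z
        = ∏ i ∈ s, z (v i) := by
      intro s
      induction s using Finset.induction_on with
      | empty => simp [monomialFun]
      | insert i s hi ih =>
        rw [Finset.sum_insert hi, Finset.prod_insert hi, monomialFun_add, monomialFun_single, ih]
    exact this Finset.univ
  have ha : ∀ x, ‖a x‖ ≤ ‖q x.1‖ := by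
    intro x
    refine (ContinuousMultilinearMap.le_opNorm _ _).trans ?_
    refine mul_le_of_le_one_right (norm_nonneg _) (Finset.prod_le_one (fun _ _ => norm_nonneg _)
      fun i _ => ?_)
    simp [e, Pi.norm_single]
  have hterm : ∀ (k : ℕ) (z : Fin n → ℂ), (q k fun _ => z) =
      ∑ v : Fin k → Fin n, a ⟨k, v⟩ * monomialFun (ex ⟨k, v⟩) z := by
    intro k z
    have hz : z = ∑ j, z j • e j := by
      funext m
      simp [e, Pi.single_apply]
    conv_lhs => rw [hz]
    rw [ContinuousMultilinearMap.map_sum]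
    refine Finset.sum_congr rfl fun v _ => ?_
    rw [ContinuousMultilinearMap.map_smul_univ, hmon, smul_eq_mul, mul_comm]
  have hsummable : ∀ z : Fin n → ℂ, ‖z‖ ≤ τ → Summable fun x => ‖a x * monomialFun (ex x) z‖ := by
    intro z hz
    have hb : ∀ x : Σ k : ℕ, Fin k → Fin n,
        ‖a x * monomialFun (ex x) z‖ ≤ ‖q x.1‖ * (τ : ℝ) ^ x.1 := by
      intro x
      rw [norm_mul, hmon, norm_prod]
      refine mul_le_mul (ha x) ?_ (by positivity) (norm_nonneg _)
      refine (Finset.prod_le_prod (fun _ _ => norm_nonneg _)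
        fun i _ => (norm_le_pi_norm z _).trans hz).trans ?_
      simp
    refine Summable.of_nonneg_of_le (fun _ => norm_nonneg _) hb ?_
    refine (summable_sigma_of_nonneg fun x => by positivity).mpr ⟨fun k => ?_, ?_⟩
    · exact (hasSum_fintype _).summable
    · refine Summable.of_nonneg_of_le (fun k => by positivity) (fun k => ?_) hqs
      have hcard : ∑' _ : Fin k → Fin n, ‖q k‖ * (τ : ℝ) ^ k = (n : ℝ) ^ k * (‖q k‖ * τ ^ k) := by
        rw [tsum_fintype, Finset.sum_const, Finset.card_univ, Fintype.card_fun, Fintype.card_fin,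
          Fintype.card_fin, nsmul_eq_mul]
        push_cast
        rfl
      refine hcard.trans_le ?_
      calc (n : ℝ) ^ k * (‖q k‖ * (τ : ℝ) ^ k) = ‖q k‖ * ((n : ℝ) * τ) ^ k := by
            rw [mul_pow]; ring
        _ ≤ ‖q k‖ * (ρ : ℝ) ^ k := by gcongr
  refine ⟨fun Q => ∑' x : {x // ex x = Q}, a x.1, ?_⟩
  filter_upwards [eventually_norm_le hτ, Metric.eball_mem_nhds (0 : Fin n → ℂ) hq.r_pos]
    with z hz hzr
  have h1 := hq.hasSum hzr
  rw [zero_add] at h1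
  have h2 : HasSum (fun x => a x * monomialFun (ex x) z) (f z) := by
    have h3 := (hsummable z hz).of_norm
    have h4 := h3.hasSum.sigma fun k => hasSum_fintype _
    have h5 : (fun k => ∑ v : Fin k → Fin n, a ⟨k, v⟩ * monomialFun (ex ⟨k, v⟩) z)
        = fun k => q k fun _ => z := funext fun k => (hterm k z).symm
    rw [h5] at h4
    rw [← h4.unique h1]
    exact h3.hasSum
  have h6 := (Equiv.sigmaFiberEquiv ex).hasSum_iff.mpr h2
  have h7 := h6.sigma fun Q => (h6.summable.sigma_factor Q).hasSum
  refine h7.congr_fun fun Q => Eq.symm ?_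
  rw [show coeff Q (fun Q => ∑' x : {x // ex x = Q}, a x.1 : MvPowerSeries (Fin n) ℂ)
    = ∑' x : {x // ex x = Q}, a x.1 from rfl, ← tsum_mul_right]
  refine tsum_congr fun x => ?_
  change a x.1 * monomialFun (ex x.1) z = _
  rw [x.2]

/-- The analytic inverse function theorem for germs of self-maps at the origin. -/
theorem exists_inverse_germ {G : (Fin n → ℂ) → Fin n → ℂ} (hG : AnalyticAt ℂ G 0) (h0 : G 0 = 0)
    {e : (Fin n → ℂ) ≃L[ℂ] (Fin n → ℂ)} (he : HasFDerivAt G (e : (Fin n → ℂ) →L[ℂ] Fin n → ℂ) 0) :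
    ∃ H : (Fin n → ℂ) → Fin n → ℂ, AnalyticAt ℂ H 0 ∧ H 0 = 0 ∧ H ∘ G =ᶠ[𝓝 0] id ∧
      G ∘ H =ᶠ[𝓝 0] id ∧ HasFDerivAt H (e.symm : (Fin n → ℂ) →L[ℂ] Fin n → ℂ) 0 := by
  have hs : HasStrictFDerivAt G (e : (Fin n → ℂ) →L[ℂ] Fin n → ℂ) 0 := by
    have := hG.hasStrictFDerivAt
    rwa [he.fderiv] at this
  have h1 := (hs.toOpenPartialHomeomorph G).analyticAt_symm' (a := 0) (i := e)
    hs.mem_toOpenPartialHomeomorph_source hG he.fderiv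
  have h2 := hs.to_localInverse
  have h3 := hs.eventually_right_inverse
  have h4 := hs.localInverse_apply_image
  rw [h0] at h2 h3 h4
  refine ⟨hs.localInverse G e 0, ?_, h4, hs.eventually_left_inverse, h3, h2.hasFDerivAt⟩
  have h5 : hs.toOpenPartialHomeomorph G 0 = 0 := h0
  rw [h5] at h1
  exact h1

/-! ### Monomial ideals and division with remainder -/

theorem vanishOff_degGE_iff {k : ℕ} {p : MvPowerSeries (Fin n) ℂ} :
    VanishOff (degGE n k) p ↔ ∀ Q : Fin n →₀ ℕ, Q.degree < k → coeff Q p = 0 := by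
  simp [VanishOff, degGE]

/-- Dickson's lemma: an upper set of exponents is generated by finitely many of its elements. -/
theorem exists_finset_generators (A : Set (Fin n →₀ ℕ)) :
    ∃ (s : Finset (Fin n →₀ ℕ)) (ρ : (Fin n →₀ ℕ) → (Fin n →₀ ℕ)),
      (∀ R ∈ s, R ∈ A) ∧ ∀ Q ∈ A, ρ Q ∈ s ∧ ρ Q ≤ Q := by
  have hfin : {Q | Minimal (· ∈ A) Q}.Finite :=
    WellQuasiOrderedLE.finite_of_isAntichain (setOfPred_minimal_antichain _)
  have h : ∀ Q, ∃ R, Q ∈ A → R ∈ hfin.toFinset ∧ R ≤ Q := by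
    intro Q
    by_cases hQ : Q ∈ A
    · obtain ⟨R, hR, hm⟩ := exists_minimal_le_of_wellFoundedLT (· ∈ A) Q hQ
      exact ⟨R, fun _ => ⟨hfin.mem_toFinset.mpr hm, hR⟩⟩
    · exact ⟨0, fun h => absurd h hQ⟩
  choose ρ hρ using h
  exact ⟨hfin.toFinset, ρ, fun R hR => (hfin.mem_toFinset.mp hR).prop, hρ⟩

open Classical in
/-- The part of a power series supported outside `A`. -/
def offPart (A : Set (Fin n →₀ ℕ)) (p : MvPowerSeries (Fin n) ℂ) : MvPowerSeries (Fin n) ℂ :=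
  fun Q => if Q ∈ A then 0 else coeff Q p

open Classical in
/-- The quotient by `x^R` of the part of a power series supported on the exponents of `A` that are
assigned to the generator `R` by `ρ`. -/
def monomialQuot (A : Set (Fin n →₀ ℕ)) (ρ : (Fin n →₀ ℕ) → (Fin n →₀ ℕ)) (R : Fin n →₀ ℕ)
    (p : MvPowerSeries (Fin n) ℂ) : MvPowerSeries (Fin n) ℂ :=
  fun P => if R + P ∈ A ∧ ρ (R + P) = R then coeff (R + P) p else 0

open Classical in
theorem coeff_offPart (A : Set (Fin n →₀ ℕ)) (p : MvPowerSeries (Fin n) ℂ) (Q : Fin n →₀ ℕ) :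
    coeff Q (offPart A p) = if Q ∈ A then 0 else coeff Q p := rfl

open Classical in
theorem coeff_monomialQuot (A : Set (Fin n →₀ ℕ)) (ρ : (Fin n →₀ ℕ) → (Fin n →₀ ℕ))
    (R : Fin n →₀ ℕ) (p : MvPowerSeries (Fin n) ℂ) (P : Fin n →₀ ℕ) :
    coeff P (monomialQuot A ρ R p) =
      if R + P ∈ A ∧ ρ (R + P) = R then coeff (R + P) p else 0 := rfl

theorem coeff_offPart_of_mem {A : Set (Fin n →₀ ℕ)} {Q : Fin n →₀ ℕ} (hQ : Q ∈ A)
    (p : MvPowerSeries (Fin n) ℂ) : coeff Q (offPart A p) = 0 := by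
  rw [coeff_offPart, if_pos hQ]

theorem offPart_sub (A : Set (Fin n →₀ ℕ)) (p q : MvPowerSeries (Fin n) ℂ) :
    offPart A (p - q) = offPart A p - offPart A q := by
  ext Q
  simp only [coeff_offPart, map_sub]
  split_ifs <;> simp

theorem monomialQuot_sub (A : Set (Fin n →₀ ℕ)) (ρ : (Fin n →₀ ℕ) → (Fin n →₀ ℕ))
    (R : Fin n →₀ ℕ) (p q : MvPowerSeries (Fin n) ℂ) :
    monomialQuot A ρ R (p - q) = monomialQuot A ρ R p - monomialQuot A ρ R q := by
  ext Q
  simp only [coeff_monomialQuot, map_sub]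
  split_ifs <;> simp

theorem VanishOff.offPart {A B : Set (Fin n →₀ ℕ)} {p : MvPowerSeries (Fin n) ℂ}
    (hp : VanishOff B p) : VanishOff B (offPart A p) := by
  intro Q hQ
  rw [coeff_offPart, hp Q hQ, ite_self]

theorem VanishOff.monomialQuot {A B : Set (Fin n →₀ ℕ)} {ρ : (Fin n →₀ ℕ) → (Fin n →₀ ℕ)}
    {R : Fin n →₀ ℕ} {p : MvPowerSeries (Fin n) ℂ} (hp : VanishOff B p) :
    VanishOff {P | R + P ∈ B} (monomialQuot A ρ R p) := by
  intro Q hQ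
  rw [coeff_monomialQuot, hp _ hQ, ite_self]

theorem wnorm_offPart_le (w : (Fin n →₀ ℕ) → ℝ≥0∞) (A : Set (Fin n →₀ ℕ))
    (p : MvPowerSeries (Fin n) ℂ) : wnorm w (offPart A p) ≤ wnorm w p := by
  refine ENNReal.tsum_le_tsum fun Q => ?_
  rw [coeff_offPart]
  split_ifs <;> simp

/-- Shifting by `R` is injective on exponents, so division by `x^R` costs exactly the factor `s ^
|R|` and preserves convergence for `s` positive. -/
theorem wnorm_monomialQuot_mul_le (s : ℝ≥0∞) (A : Set (Fin n →₀ ℕ))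
    (ρ : (Fin n →₀ ℕ) → (Fin n →₀ ℕ)) (R : Fin n →₀ ℕ) (p : MvPowerSeries (Fin n) ℂ) :
    s ^ R.degree * wnorm (polyWeight n s) (monomialQuot A ρ R p) ≤ wnorm (polyWeight n s) p := by
  unfold wnorm
  rw [← ENNReal.tsum_mul_left]
  refine le_trans (ENNReal.tsum_le_tsum fun P => ?_) (ENNReal.tsum_comp_le_tsum_of_injective
    (add_right_injective R) fun Q => ‖coeff Q p‖ₑ * polyWeight n s Q)
  rw [coeff_monomialQuot, polyWeight, polyWeight, map_add, pow_add, mul_left_comm]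
  gcongr
  split_ifs <;> simp

theorem eq_offPart_add_sum {A : Set (Fin n →₀ ℕ)} {s : Finset (Fin n →₀ ℕ)}
    {ρ : (Fin n →₀ ℕ) → (Fin n →₀ ℕ)} (hρ : ∀ Q ∈ A, ρ Q ∈ s ∧ ρ Q ≤ Q)
    (p : MvPowerSeries (Fin n) ℂ) :
    p = offPart A p + ∑ R ∈ s, monomialQuot A ρ R p * monomial R 1 := by
  classical
  ext Q
  have h1 : ∀ R ∈ s, coeff Q (monomialQuot A ρ R p * monomial R (1 : ℂ)) =
      if R = ρ Q then (if Q ∈ A then coeff Q p else 0) else 0 := by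
    intro R _
    rw [coeff_mul_monomial]
    by_cases hRQ : R ≤ Q
    · rw [if_pos hRQ, coeff_monomialQuot, add_tsub_cancel_of_le hRQ, mul_one]
      by_cases h : R = ρ Q
      · simp [h]
      · simp [h, Ne.symm h]
    · rw [if_neg hRQ]
      split_ifs with h hA
      · exact absurd (h ▸ (hρ Q hA).2) hRQ
      · rfl
      · rfl
  rw [map_add, map_sum, Finset.sum_congr rfl h1, coeff_offPart, Finset.sum_ite_eq']
  by_cases hA : Q ∈ A
  · simp [hA, (hρ Q hA).1]
  · simp [hA]

section GermMem

variable {I : Ideal (HolGerm n)} {f g : (Fin n → ℂ) → ℂ}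

theorem GermMem.congr (hf : GermMem f I) (h : f =ᶠ[𝓝 0] g) : GermMem g I := by
  obtain ⟨a, ha, hfa⟩ := hf
  exact ⟨a, ha, hfa.trans (Filter.Germ.coe_eq.mpr h)⟩

theorem GermMem.sum {ι : Type*} {s : Finset ι} {f : ι → (Fin n → ℂ) → ℂ}
    (hf : ∀ i ∈ s, GermMem (f i) I) : GermMem (fun z => ∑ i ∈ s, f i z) I := by
  classical
  induction s using Finset.induction_on with
  | empty => exact ⟨0, I.zero_mem, by simp; rfl⟩
  | insert i s hi ih =>
    obtain ⟨a, ha, h⟩ := hf i (Finset.mem_insert_self i s)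
    obtain ⟨b, hb, h'⟩ := ih fun i hi => hf i (Finset.mem_insert_of_mem hi)
    refine ⟨a + b, I.add_mem ha hb, ?_⟩
    simp only [Finset.sum_insert hi]
    rw [Subring.coe_add, h, h']
    rfl

theorem GermMem.mul_monomialFun {Q : Fin n →₀ ℕ} (hQ : Q ∈ exponentSet I)
    (hf : AnalyticAt ℂ f 0) : GermMem (fun z => f z * monomialFun Q z) I :=
  ⟨⟨Filter.Germ.ofFun f, f, hf, rfl⟩ * monomialGerm Q, I.mul_mem_left _ hQ, rfl⟩

/-- A germ whose Taylor expansion only involves monomials of `I` belongs to `I`. -/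
theorem IsTaylorExpansion.germMem {p : MvPowerSeries (Fin n) ℂ} (hp : IsTaylorExpansion p f)
    (h : VanishOff (exponentSet I) p) : GermMem f I := by
  obtain ⟨s, ρ, hs, hρ⟩ := exists_finset_generators (exponentSet I)
  obtain ⟨r, hr, hpr⟩ := hp.exists_radius
  have hoff : offPart (exponentSet I) p = 0 := by
    ext Q
    rw [coeff_offPart]
    split_ifs with hQ
    · simp
    · rw [h Q hQ, map_zero]
  have hq : ∀ R, wnorm (polyWeight n r) (monomialQuot (exponentSet I) ρ R p) ≠ ∞ := by
    intro R htop
    have := wnorm_monomialQuot_mul_le r (exponentSet I) ρ R p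
    rw [htop, ENNReal.mul_top (pow_ne_zero _ (by exact_mod_cast hr.ne'))] at this
    exact hpr (top_le_iff.mp this)
  have hterm := fun R => IsTaylorExpansion.of_wnorm hr (hq R)
  refine (GermMem.sum fun R hR => GermMem.mul_monomialFun (hs R hR) (hterm R).analyticAt).congr ?_
  have hall : ∀ᶠ z in 𝓝 (0 : Fin n → ℂ), ∀ R ∈ s,
      HasSum (fun Q => coeff Q (monomialQuot (exponentSet I) ρ R p * MvPowerSeries.monomial R 1) *
        monomialFun Q z) (evalSeries (monomialQuot (exponentSet I) ρ R p) z * monomialFun R z) := by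
    rw [Filter.eventually_all_finset]
    intro R _
    have := (hterm R).mul (IsTaylorExpansion.monomial R 1)
    simp only [one_mul] at this
    exact this
  filter_upwards [hall, hp] with z hz hpz
  have h1 := hasSum_sum hz
  refine h1.unique ?_
  convert! hpz using 2 with Q
  conv_rhs => rw [eq_offPart_add_sum hρ p, hoff, zero_add, map_sum, Finset.sum_mul]

/-- The property passes from the generating monomials through sums and multiples, each time on a
possibly smaller neighbourhood of `0`. -/
theorem GermMem.eventually_eq_zero {S : Set (Fin n →₀ ℕ)} (hf : GermMem f (monomialIdeal S)) :
    ∀ᶠ z in 𝓝 (0 : Fin n → ℂ), z ∈ zeroSet S → f z = 0 := by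
  obtain ⟨a, ha, h⟩ := hf
  have key : ∀ a ∈ monomialIdeal S, ∀ f : (Fin n → ℂ) → ℂ,
      (a : Filter.Germ (𝓝 (0 : Fin n → ℂ)) ℂ) = Filter.Germ.ofFun f →
      ∀ᶠ z in 𝓝 (0 : Fin n → ℂ), z ∈ zeroSet S → f z = 0 := by
    intro a ha
    refine Submodule.span_induction (p := fun (a : HolGerm n) _ => ∀ f : (Fin n → ℂ) → ℂ,
      (a : Filter.Germ (𝓝 (0 : Fin n → ℂ)) ℂ) = Filter.Germ.ofFun f →
      ∀ᶠ z in 𝓝 (0 : Fin n → ℂ), z ∈ zeroSet S → f z = 0) ?_ ?_ ?_ ?_ ha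
    · rintro _ ⟨R, hR, rfl⟩ f hf
      filter_upwards [Filter.Germ.coe_eq.mp hf] with z hz hzS
      rw [← hz]
      exact hzS R hR
    · intro f hf
      filter_upwards [(show (fun _ => (0 : ℂ)) =ᶠ[𝓝 0] f from Filter.Germ.coe_eq.mp hf)] with z hz _
      exact hz.symm
    · rintro ⟨_, f₁, hf₁, rfl⟩ ⟨_, f₂, hf₂, rfl⟩ _ _ h1 h2 f hf
      filter_upwards [h1 f₁ rfl, h2 f₂ rfl, (show f₁ + f₂ =ᶠ[𝓝 0] f from Filter.Germ.coe_eq.mp hf)]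
        with z hz1 hz2 hz hzS
      rw [← hz, Pi.add_apply, hz1 hzS, hz2 hzS, add_zero]
    · rintro ⟨_, f₁, hf₁, rfl⟩ ⟨_, f₂, hf₂, rfl⟩ _ h2 f hf
      filter_upwards [h2 f₂ rfl, (show f₁ * f₂ =ᶠ[𝓝 0] f from Filter.Germ.coe_eq.mp hf)] with z hz2 hz hzS
      rw [← hz, Pi.mul_apply, hz2 hzS, mul_zero]
  exact key a ha f h

end GermMem

/-- Division of a convergent power series by convergent power series `g R` with leading monomials
`x^R` that generate the monomials of `A`; the remainder has no monomial in `A`. -/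
theorem exists_division {A : Set (Fin n →₀ ℕ)} {s : Finset (Fin n →₀ ℕ)}
    {ρ : (Fin n →₀ ℕ) → (Fin n →₀ ℕ)} (hρ : ∀ Q ∈ A, ρ Q ∈ s ∧ ρ Q ≤ Q)
    {g : (Fin n →₀ ℕ) → MvPowerSeries (Fin n) ℂ} {s₀ : ℝ≥0} (hs₀ : 0 < s₀)
    (hg : ∀ R ∈ s, wnorm (polyWeight n s₀) (g R) ≠ ∞)
    (hlead : ∀ R ∈ s, VanishOff (degGE n (R.degree + 1)) (monomial R 1 - g R))
    {f : MvPowerSeries (Fin n) ℂ} (hf : wnorm (polyWeight n s₀) f ≠ ∞)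
    (hf2 : VanishOff (degGE n 2) f) :
    ∃ (q : (Fin n →₀ ℕ) → MvPowerSeries (Fin n) ℂ) (r : MvPowerSeries (Fin n) ℂ),
      f = ∑ R ∈ s, q R * g R + r ∧ VanishOff Aᶜ r ∧ VanishOff (degGE n 2) r ∧
      ∃ t : ℝ≥0, 0 < t ∧ wnorm (polyWeight n t) r ≠ ∞ := by
  let Λ : MvPowerSeries (Fin n) ℂ → MvPowerSeries (Fin n) ℂ :=
    fun F => ∑ R ∈ s, monomialQuot A ρ R F * (monomial R 1 - g R)
  have hΛsub : ∀ F G, Λ F - Λ G = Λ (F - G) := by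
    intro F G
    simp only [Λ, monomialQuot_sub, sub_mul, Finset.sum_sub_distrib]
  have hΛdeg : ∀ K F, VanishOff (degGE n K) F → VanishOff (degGE n (K + 1)) (Λ F) := by
    intro K F hF
    refine VanishOff.sum fun R hR => VanishOff.mul hF.monomialQuot (hlead R hR) ?_
    intro Q hQ Q' hQ'
    simp only [degGE, Set.mem_ofPred_eq, map_add] at *
    omega
  -- Solve `F = f + Λ F`. Splitting `F` into its part off `A` and its multiples of `x^R`, and moving
  -- `Λ F` to the other side, replaces each `x^R` by `g R` and leaves the part off `A` as remainder.
  obtain ⟨F, hF, hFw⟩ := exists_fixedPoint (ι := Unit) (fun F u => f + Λ (F u)) (by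
    intro K p q h u
    rw [add_sub_add_left_eq_sub, hΛsub]
    exact hΛdeg K _ (h u))
  set F₀ := F () with hF₀
  have hfix : F₀ = f + Λ F₀ := (congrFun hF ()).symm
  have hstep : ∀ K, K + 1 ≤ 2 → VanishOff (degGE n K) F₀ → VanishOff (degGE n (K + 1)) F₀ := by
    intro K hK h
    rw [hfix]
    exact (hf2.mono fun Q hQ => hK.trans hQ).add (hΛdeg K _ h)
  have hF2 : VanishOff (degGE n 2) F₀ :=
    hstep 1 le_rfl (hstep 0 (by omega) fun Q hQ => by simp [degGE] at hQ)
  -- the radius on which the iteration contracts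
  let κ : ℝ≥0∞ := ∑ R ∈ s, (s₀ ^ R.degree : ℝ≥0∞)⁻¹ * wnorm (polyWeight n s₀) (monomial R 1 - g R)
  have hs₀' : (s₀ : ℝ≥0∞) ≠ 0 := by exact_mod_cast hs₀.ne'
  have hκ : κ ≠ ∞ := by
    refine (ENNReal.sum_lt_top.mpr fun R hR => ENNReal.mul_lt_top ?_ ?_).ne
    · exact ENNReal.inv_lt_top.mpr (pos_iff_ne_zero.mpr (pow_ne_zero _ hs₀'))
    · refine (lt_of_le_of_lt (wnorm_sub_le _ _ _) (ENNReal.add_lt_top.mpr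
        ⟨?_, lt_top_iff_ne_top.mpr (hg R hR)⟩))
      rw [wnorm_monomial, polyWeight]
      exact ENNReal.mul_lt_top (by simp) (ENNReal.pow_lt_top ENNReal.coe_lt_top)
  -- On radius `c * s₀`, dividing by `x^R` costs `(c * s₀) ^ |R|`, while `x^R - g R` has order `|R|
  -- + 1` and supplies `c ^ (|R| + 1)`. The net factor is `c * κ`, made at most `1 / 2` here.
  set c : ℝ≥0 := min 1 (1 / (2 * (κ.toNNReal + 1))) with hc
  have hc0 : 0 < c := by positivity
  have hc1 : (c : ℝ≥0∞) ≤ 1 := by exact_mod_cast min_le_left _ _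
  have hcκ : (c : ℝ≥0∞) * κ ≤ 2⁻¹ := by
    rw [← ENNReal.coe_toNNReal hκ, ← ENNReal.coe_mul,
      show (2⁻¹ : ℝ≥0∞) = ((2⁻¹ : ℝ≥0) : ℝ≥0∞) by rw [ENNReal.coe_inv two_ne_zero]; rfl,
      ENNReal.coe_le_coe]
    calc c * κ.toNNReal ≤ 1 / (2 * (κ.toNNReal + 1)) * (κ.toNNReal + 1) := by
          gcongr
          · exact min_le_right _ _
          · exact le_self_add
      _ = 2⁻¹ := by field_simp
  have hΛnorm : ∀ F, wnorm (polyWeight n (c * s₀)) (Λ F) ≤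
      2⁻¹ * wnorm (polyWeight n (c * s₀)) F := by
    intro F
    set W := wnorm (polyWeight n (c * s₀)) F with hW
    have hterm : ∀ R ∈ s, wnorm (polyWeight n (c * s₀))
        (monomialQuot A ρ R F * (monomial R 1 - g R)) ≤
        c * ((s₀ ^ R.degree : ℝ≥0∞)⁻¹ * wnorm (polyWeight n s₀) (monomial R 1 - g R)) * W := by
      intro R hR
      refine (wnorm_mul_le fun Q Q' _ _ => polyWeight_add _ Q Q').trans ?_
      have h1 := wnorm_monomialQuot_mul_le (c * s₀ : ℝ≥0∞) A ρ R F
      have h2 := wnorm_polyWeight_mul_le (hlead R hR) hc1 s₀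
      set x := wnorm (polyWeight n (c * s₀)) (monomialQuot A ρ R F)
      set y := wnorm (polyWeight n s₀) (monomial R 1 - g R)
      have hpow0 : (s₀ ^ R.degree : ℝ≥0∞) ≠ 0 := pow_ne_zero _ hs₀'
      have hpowt : (s₀ ^ R.degree : ℝ≥0∞) ≠ ∞ := ENNReal.pow_ne_top ENNReal.coe_ne_top
      calc x * wnorm (polyWeight n (c * s₀)) (monomial R 1 - g R)
          ≤ x * (c ^ (R.degree + 1) * y) := by gcongr
        _ = ((s₀ ^ R.degree : ℝ≥0∞) * (s₀ ^ R.degree : ℝ≥0∞)⁻¹) * (x * (c ^ (R.degree + 1) * y)) := by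
            rw [ENNReal.mul_inv_cancel hpow0 hpowt, one_mul]
        _ = c * ((s₀ ^ R.degree : ℝ≥0∞)⁻¹ * y) * ((c * s₀) ^ R.degree * x) := by
            rw [mul_pow, pow_succ]; ring
        _ ≤ _ := by gcongr
    calc wnorm (polyWeight n (c * s₀)) (Λ F) ≤ _ := wnorm_sum_le s _ _
      _ ≤ ∑ R ∈ s, c * ((s₀ ^ R.degree : ℝ≥0∞)⁻¹ *
          wnorm (polyWeight n s₀) (monomial R 1 - g R)) * W := Finset.sum_le_sum hterm
      _ = c * κ * W := by rw [← Finset.sum_mul, ← Finset.mul_sum]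
      _ ≤ _ := by gcongr
  have hFnorm := hFw (polyWeight n (c * s₀)) (fun _ => 2 * wnorm (polyWeight n (c * s₀)) f) (by
    intro q hq u
    refine (wnorm_add_le _ _ _).trans ?_
    rw [two_mul]
    gcongr
    refine (hΛnorm _).trans ((mul_le_mul_right (hq u) _).trans_eq ?_)
    rw [← mul_assoc, ENNReal.inv_mul_cancel two_ne_zero ENNReal.ofNat_ne_top, one_mul]) ()
  refine ⟨fun R => monomialQuot A ρ R F₀, offPart A F₀, ?_, ?_, hF2.offPart, c * s₀,
    mul_pos hc0 hs₀, ?_⟩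
  · have h1 := eq_offPart_add_sum hρ F₀
    have h2 : f = F₀ - Λ F₀ := by rw [eq_sub_iff_add_eq]; exact hfix.symm
    rw [h2]
    have h3 : ∑ R ∈ s, monomialQuot A ρ R F₀ * monomial R 1 = F₀ - offPart A F₀ :=
      eq_sub_of_add_eq' h1.symm
    simp only [Λ, mul_sub, Finset.sum_sub_distrib, h3]
    ring
  · intro Q hQ
    exact coeff_offPart_of_mem (not_not.mp hQ) _
  · rw [ENNReal.coe_mul]
    refine ne_top_of_le_ne_top ?_ ((wnorm_offPart_le _ _ _).trans hFnorm)
    refine ENNReal.mul_ne_top ENNReal.ofNat_ne_top (ne_top_of_le_ne_top hf ?_)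
    exact wnorm_polyWeight_mono (mul_le_of_le_one_left zero_le hc1) f

/-! ### Formal conjugacy for commuting families -/

theorem constantCoeff_eq_zero_of_vanishOff {k : ℕ} {p : MvPowerSeries (Fin n) ℂ} (hk : 0 < k)
    (hp : VanishOff (degGE n k) p) : constantCoeff p = 0 :=
  vanishOff_degGE_iff.mp hp 0 (by simpa using hk)

theorem VanishOff.rescale {A : Set (Fin n →₀ ℕ)} {p : MvPowerSeries (Fin n) ℂ} (hp : VanishOff A p)
    (c : Fin n → ℂ) : VanishOff A (rescale c p) := by
  intro Q hQ
  rw [coeff_rescale, hp Q hQ, mul_zero]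

theorem VanishOff.C_mul {A : Set (Fin n →₀ ℕ)} {p : MvPowerSeries (Fin n) ℂ} (hp : VanishOff A p)
    (c : ℂ) : VanishOff A (C c * p) := by
  intro Q hQ
  rw [coeff_C_mul, hp Q hQ, mul_zero]

theorem VanishOff.mpow {a : Fin n → MvPowerSeries (Fin n) ℂ} (ha : ∀ j, constantCoeff (a j) = 0)
    (P : Fin n →₀ ℕ) : VanishOff (degGE n P.degree) (mpow a P) := by
  induction P using exponent_induction with
  | zero => intro Q hQ; simp [degGE] at hQ
  | add m P ih =>
    rw [mpow_add, mpow_single]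
    refine (VanishOff.compl_zero_iff.mpr (ha m)).mul ih fun Q hQ Q' hQ' => ?_
    have hQ : Q ≠ 0 := hQ
    have hQd : Q.degree ≠ 0 := fun h => hQ ((Finsupp.degree_eq_zero_iff Q).mp h)
    have hQ' : P.degree ≤ Q'.degree := hQ'
    change (Finsupp.single m 1 + P).degree ≤ (Q + Q').degree
    simp only [map_add, Finsupp.degree_single]
    omega

theorem VanishOff.mul_degGE {k k' : ℕ} {p q : MvPowerSeries (Fin n) ℂ}
    (hp : VanishOff (degGE n k) p) (hq : VanishOff (degGE n k') q) :
    VanishOff (degGE n (k + k')) (p * q) :=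
  hp.mul hq fun Q hQ Q' hQ' => by
    change k + k' ≤ (Q + Q').degree
    rw [map_add]
    exact Nat.add_le_add hQ hQ'

/-- Powers of tuples that agree up to first order have the same leading part. -/
theorem VanishOff.mpow_sub_degGE {a b : Fin n → MvPowerSeries (Fin n) ℂ}
    (ha : ∀ j, constantCoeff (a j) = 0) (hb : ∀ j, constantCoeff (b j) = 0)
    (h : ∀ j, VanishOff (degGE n 2) (a j - b j)) (P : Fin n →₀ ℕ) :
    VanishOff (degGE n (P.degree + 1)) (AbelianGerms.mpow a P - AbelianGerms.mpow b P) := by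
  induction P using exponent_induction with
  | zero => simpa [mpow_zero] using VanishOff.zero
  | add k P ih =>
    have h1 : AbelianGerms.mpow a (Finsupp.single k 1 + P) -
        AbelianGerms.mpow b (Finsupp.single k 1 + P) =
        (a k - b k) * AbelianGerms.mpow a P +
          b k * (AbelianGerms.mpow a P - AbelianGerms.mpow b P) := by
      simp only [mpow_add, mpow_single]; ring
    have hbk : VanishOff (degGE n 1) (b k) := by
      have := VanishOff.mpow hb (Finsupp.single k 1)
      rwa [mpow_single, Finsupp.degree_single] at this
    have hdeg : (Finsupp.single k 1 + P).degree + 1 = 2 + P.degree := by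
      simp only [map_add, Finsupp.degree_single]
      omega
    rw [h1, hdeg]
    refine ((h k).mul_degGE (VanishOff.mpow ha P)).add ?_
    have := hbk.mul_degGE ih
    rwa [show 1 + (P.degree + 1) = 2 + P.degree by omega] at this

theorem VanishOff.subst {a : Fin n → MvPowerSeries (Fin n) ℂ} (ha : ∀ j, constantCoeff (a j) = 0)
    {k : ℕ} {f : MvPowerSeries (Fin n) ℂ} (hf : VanishOff (degGE n k) f) :
    VanishOff (degGE n k) (subst a f) := by
  intro Q hQ
  rw [coeff_subst_eq (hasSubst_of_constantCoeff_zero ha)]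
  refine finsum_eq_zero_of_forall_eq_zero fun P => ?_
  by_cases hP : P ∈ degGE n k
  · rw [VanishOff.mpow ha P Q fun h => hQ (le_trans (show k ≤ P.degree from hP) h), mul_zero]
  · rw [hf P hP, zero_mul]

theorem rescale_subst (c : Fin n → ℂ) {a : Fin n → MvPowerSeries (Fin n) ℂ}
    (ha : ∀ j, constantCoeff (a j) = 0) (f : MvPowerSeries (Fin n) ℂ) :
    rescale c (subst a f) = subst (fun j => rescale c (a j)) f := by
  simp only [rescale_eq_subst]
  exact subst_comp_subst_apply (hasSubst_of_constantCoeff_zero ha) (HasSubst.smul_X c) f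

theorem constantCoeff_rescale (c : Fin n → ℂ) {p : MvPowerSeries (Fin n) ℂ}
    (hp : constantCoeff p = 0) : constantCoeff (rescale c p) = 0 := by
  rw [← coeff_zero_eq_constantCoeff_apply] at hp ⊢
  rw [coeff_rescale, hp, mul_zero]

theorem rescale_X (c : Fin n → ℂ) (j : Fin n) :
    rescale c (X j : MvPowerSeries (Fin n) ℂ) = C (c j) * X j := by
  classical
  ext Q
  rw [coeff_rescale, coeff_C_mul, coeff_X]
  split_ifs with h
  · rw [h]; simp
  · simp

/-- A tuple of formal power series with linear part `diag (c_1, …, c_n)`. -/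
def HasDiagLinearPart (c : Fin n → ℂ) (f : Fin n → MvPowerSeries (Fin n) ℂ) : Prop :=
  ∀ j, VanishOff (degGE n 2) (f j - C (c j) * X j)

namespace HasDiagLinearPart

variable {c : Fin n → ℂ} {f : Fin n → MvPowerSeries (Fin n) ℂ}

theorem constantCoeff_eq_zero (hf : HasDiagLinearPart c f) (j : Fin n) :
    constantCoeff (f j) = 0 := by
  have := constantCoeff_eq_zero_of_vanishOff two_pos (hf j)
  simpa using this

theorem subst_eq (_ : HasDiagLinearPart c f) {a : Fin n → MvPowerSeries (Fin n) ℂ}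
    (ha : ∀ j, constantCoeff (a j) = 0) (j : Fin n) :
    subst a (f j) = C (c j) * a j + subst a (f j - C (c j) * X j) := by
  have hs := hasSubst_of_constantCoeff_zero ha
  rw [subst_sub hs, subst_mul hs, subst_X hs, subst_C]
  ring

end HasDiagLinearPart

/-- For a commuting family, a formal conjugacy with the linear parts off `A` holds as soon as every
coefficient is resolved for one member of the family without resonance there. -/
theorem vanishOff_conjugacy_of_commute {μ : Fin l → Fin n → ℂ}
    {Fs : Fin l → Fin n → MvPowerSeries (Fin n) ℂ} (hlin : ∀ i, HasDiagLinearPart (μ i) (Fs i))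
    (hcomm : ∀ i i' j, subst (Fs i') (Fs i j) = subst (Fs i) (Fs i' j))
    {A : Set (Fin n →₀ ℕ)} (hA : IsUpperSet A) {Ψ : Fin n → MvPowerSeries (Fin n) ℂ}
    (hΨ : ∀ j, VanishOff (degGE n 2) (Ψ j - X j))
    (hsel : ∀ Q ∉ A, 2 ≤ Q.degree → ∀ j, ∃ i, monomialFun Q (μ i) ≠ μ i j ∧
      coeff Q (subst Ψ (Fs i j) - rescale (μ i) (Ψ j)) = 0) (i : Fin l) (j : Fin n) :
    VanishOff A (subst Ψ (Fs i j) - rescale (μ i) (Ψ j)) := by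
  have hΨ0 : ∀ j, constantCoeff (Ψ j) = 0 := fun j => by
    have := constantCoeff_eq_zero_of_vanishOff two_pos (hΨ j)
    simpa using this
  have hsΨ := hasSubst_of_constantCoeff_zero hΨ0
  let E : Fin l → Fin n → MvPowerSeries (Fin n) ℂ :=
    fun i j => subst Ψ (Fs i j) - rescale (μ i) (Ψ j)
  have hE2 : ∀ i j, VanishOff (degGE n 2) (E i j) := by
    intro i j
    have h1 : E i j = C (μ i j) * (Ψ j - X j) + subst Ψ (Fs i j - C (μ i j) * X j)
        - rescale (μ i) (Ψ j - X j) := by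
      simp only [E]
      rw [(hlin i).subst_eq hΨ0, map_sub, rescale_X]
      ring
    rw [h1]
    exact (((hΨ j).C_mul _).add (VanishOff.subst hΨ0 (hlin i j))).sub ((hΨ j).rescale _)
  -- Expand `F_i ∘ F_{i'} ∘ Ψ` modulo degree `K + 1` and `A`. The nonlinear part of `F_i` raises the
  -- order of the error `E_{i'}` by one, so only its linear part sees that error.
  have hexpand : ∀ K, 2 ≤ K → (∀ i j, VanishOff (A ∪ degGE n K) (E i j)) → ∀ i i' j,
      VanishOff (A ∪ degGE n (K + 1)) (subst Ψ (subst (Fs i') (Fs i j)) -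
        (rescale (μ i') (rescale (μ i) (Ψ j)) + rescale (μ i') (E i j) +
          C (μ i j) * E i' j)) := by
    intro K hK hEK i i' j
    have hG0 : ∀ k, constantCoeff (rescale (μ i') (Ψ k)) = 0 := fun k =>
      constantCoeff_rescale _ (hΨ0 k)
    have hS0 : ∀ k, constantCoeff (subst Ψ (Fs i' k)) = 0 := fun k =>
      constantCoeff_subst_eq_zero hsΨ hΨ0 ((hlin i').constantCoeff_eq_zero k)
    rw [subst_comp_subst_apply (hasSubst_of_constantCoeff_zero
      (hlin i').constantCoeff_eq_zero) hsΨ, (hlin i).subst_eq hS0]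
    have h1 : rescale (μ i') (E i j) + rescale (μ i') (rescale (μ i) (Ψ j)) =
        C (μ i j) * rescale (μ i') (Ψ j) +
          subst (fun k => rescale (μ i') (Ψ k)) (Fs i j - C (μ i j) * X j) := by
      rw [← (hlin i).subst_eq hG0, ← rescale_subst _ hΨ0, ← map_add]
      simp [E]
    have h2 := VanishOff.subst_sub_of_gain (B := A ∪ degGE n (K + 1)) hS0 hG0
      (hA.union (isUpperSet_degGE K)) (fun Q hQ Q' hQ' => ?_) (hEK i')
      (vanishOff_degGE_iff.mp (hlin i j))
    · refine Eq.subst (motive := VanishOff _) ?_ h2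
      have hE : E i' j = subst Ψ (Fs i' j) - rescale (μ i') (Ψ j) := rfl
      linear_combination C (μ i j) * hE + h1
    · rcases hQ with hQ | hQ
      · exact Or.inl (hA le_self_add hQ)
      · right
        have hQd : Q'.degree ≠ 0 := fun h => hQ' ((Finsupp.degree_eq_zero_iff Q').mp h)
        have hQ : K ≤ Q.degree := hQ
        change K + 1 ≤ (Q + Q').degree
        rw [map_add]
        omega
  have key : ∀ K, 2 ≤ K → ∀ i j, VanishOff (A ∪ degGE n K) (E i j) := by
    intro K hK
    induction K, hK using Nat.le_induction with
    | base => exact fun i j => (hE2 i j).mono Set.subset_union_right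
    | succ K hK ih =>
      intro i' j Q hQ
      have hQA : Q ∉ A := fun h => hQ (Or.inl h)
      by_cases hQK : K ≤ Q.degree
      swap
      · exact ih i' j Q (by rintro (h | h); exacts [hQA h, hQK h])
      -- Commutation makes the two expansions equal: `(μ_i^Q - μ_{i,j}) E_{i'} = (μ_{i'}^Q -
      -- μ_{i',j}) E_i` at the exponent `Q`. For the selected `i` the right side is zero and the
      -- factor on the left is not.
      obtain ⟨i, hne, hi⟩ := hsel Q hQA (hK.trans hQK) j
      have h1 := hexpand K hK ih i i' j Q hQ
      have h2 := hexpand K hK ih i' i j Q hQ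
      rw [hcomm i' i j] at h2
      have hi : coeff Q (E i j) = 0 := hi
      simp only [map_sub, map_add, coeff_rescale, coeff_C_mul, hi] at h1 h2
      have h3 : (monomialFun Q (μ i) - μ i j) * coeff Q (E i' j) = 0 := by
        rw [← mpow_eq_monomialFun, mpow]
        linear_combination h1 - h2
      exact (mul_eq_zero.mp h3).resolve_left (sub_ne_zero.mpr hne)
  intro Q hQ
  refine key (Q.degree + 2) (by omega) i j Q ?_
  rintro (h | h)
  · exact hQ h
  · have : Q.degree + 2 ≤ Q.degree := h
    omega

/-! ### Convergent solution of the conjugacy equation -/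

/-- The convergent solution of the conjugacy equation off `I`, for a commuting family of
convergent power series, under the diophantine condition. -/
theorem exists_convergent_conjugacy {μ : Fin l → Fin n → ℂ} {I : Ideal (HolGerm n)}
    (hμ : ∀ i j, μ i j ≠ 0)
    (hres : ∀ Q ∉ exponentSet I, 2 ≤ Q.degree → ∀ j, smallDivisor μ Q j ≠ 0)
    (hD : IsDiophantineOn μ I)
    {Fs : Fin l → Fin n → MvPowerSeries (Fin n) ℂ} (hlin : ∀ i, HasDiagLinearPart (μ i) (Fs i))
    (hcomm : ∀ i i' j, subst (Fs i') (Fs i j) = subst (Fs i) (Fs i' j))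
    {s₀ : ℝ≥0} (hs₀ : 0 < s₀) (hconv : ∀ i j, wnorm (polyWeight n s₀) (Fs i j) ≠ ∞) :
    ∃ Ψ : Fin n → MvPowerSeries (Fin n) ℂ, (∀ j, VanishOff (degGE n 2) (Ψ j - X j)) ∧
      (∃ r : ℝ≥0, 0 < r ∧ ∀ j, wnorm (polyWeight n r) (Ψ j) ≠ ∞) ∧
      ∀ i j, VanishOff (exponentSet I) (subst Ψ (Fs i j) - rescale (μ i) (Ψ j)) := by
  classical
  set A := exponentSet I with hA_def
  have hA : IsUpperSet A := isUpperSet_exponentSet I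
  obtain ⟨d, D, hd0, hdD, hdadd, hdgain⟩ := exists_weight_of_isDiophantineOn hμ hres hD
  have hsel : ∀ Q, Q ∉ A → 2 ≤ Q.degree → ∀ j, ∃ i,
      ‖monomialFun Q (μ i) - μ i j‖ = smallDivisor μ Q j :=
    fun Q hQ h2 j => exists_norm_eq_smallDivisor (hres Q hQ h2 j)
  choose sel hsel using hsel
  have hpos : ∀ Q, Q ∉ A → 2 ≤ Q.degree → ∀ j, 0 < smallDivisor μ Q j := fun Q hQ h2 j =>
    lt_of_le_of_ne (smallDivisor_nonneg μ Q j) (hres Q hQ h2 j).symm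
  let ff : Fin l → Fin n → MvPowerSeries (Fin n) ℂ := fun i j => Fs i j - C (μ i j) * X j
  have hff : ∀ i j, VanishOff (degGE n 2) (ff i j) := hlin
  let L : Set (Fin n →₀ ℕ) := (degGE n 2)ᶜ
  -- Truncating below degree `2` makes the substitution legitimate for every tuple, as the fixed
  -- point theorem requires; the fixed point itself has order at least `2`, so nothing is lost
  -- there.
  let Y : (Fin n → MvPowerSeries (Fin n) ℂ) → Fin n → MvPowerSeries (Fin n) ℂ :=
    fun ψ k => X k + offPart L (ψ k)
  have hY0 : ∀ ψ k, constantCoeff (Y ψ k) = 0 := by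
    intro ψ k
    have : constantCoeff (offPart L (ψ k)) = 0 :=
      coeff_offPart_of_mem (A := L) (Q := 0) (by simp [L, degGE]) _
    simp [Y, this]
  let T : (Fin n → MvPowerSeries (Fin n) ℂ) → Fin n → MvPowerSeries (Fin n) ℂ := fun ψ j Q =>
    if h : Q ∉ A ∧ 2 ≤ Q.degree then
      coeff Q (subst (Y ψ) (ff (sel Q h.1 h.2 j) j)) /
        (monomialFun Q (μ (sel Q h.1 h.2 j)) - μ (sel Q h.1 h.2 j) j)
    else 0
  have hTpos : ∀ ψ j Q (h : Q ∉ A ∧ 2 ≤ Q.degree), coeff Q (T ψ j) =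
      coeff Q (subst (Y ψ) (ff (sel Q h.1 h.2 j) j)) /
        (monomialFun Q (μ (sel Q h.1 h.2 j)) - μ (sel Q h.1 h.2 j) j) :=
    fun ψ j Q h => dif_pos h
  have hTneg : ∀ ψ j Q, ¬ (Q ∉ A ∧ 2 ≤ Q.degree) → coeff Q (T ψ j) = 0 :=
    fun ψ j Q h => dif_neg h
  obtain ⟨ψ, hψ, hψw⟩ := exists_fixedPoint T (by
    intro K p q h j Q hQ
    rw [map_sub]
    by_cases hc : Q ∉ A ∧ 2 ≤ Q.degree
    · rw [hTpos _ _ _ hc, hTpos _ _ _ hc, ← sub_div, ← map_sub]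
      rw [VanishOff.subst_sub_of_gain (A := degGE n K) (B := degGE n (K + 1)) (hY0 p) (hY0 q)
        (isUpperSet_degGE K) ?_ ?_ (vanishOff_degGE_iff.mp (hff _ j)) Q hQ, zero_div]
      · intro Q hQ Q' hQ'
        have hQd : Q'.degree ≠ 0 := fun h => hQ' ((Finsupp.degree_eq_zero_iff Q').mp h)
        have hQ : K ≤ Q.degree := hQ
        change K + 1 ≤ (Q + Q').degree
        rw [map_add]
        omega
      · intro k
        simp only [Y, add_sub_add_left_eq_sub, ← offPart_sub]
        exact (h k).offPart
    · rw [hTneg _ _ _ hc, hTneg _ _ _ hc, sub_zero])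
  have hψ2 : ∀ j, VanishOff (degGE n 2) (ψ j) := by
    intro j Q hQ
    rw [← hψ]
    exact hTneg _ _ _ fun h => hQ h.2
  have hψA : ∀ j, VanishOff Aᶜ (ψ j) := by
    intro j Q hQ
    rw [← hψ]
    exact hTneg _ _ _ fun h => hQ h.1
  have hYψ : Y ψ = fun k => X k + ψ k := by
    funext k
    have : offPart L (ψ k) = ψ k := by
      ext Q
      rw [coeff_offPart]
      split_ifs with h
      · exact (hψ2 k Q h).symm
      · rfl
    simp only [Y, this]
  -- the radius on which the weighted ball is invariant
  set N : ℝ≥0∞ := ∑ i, ∑ j, wnorm (polyWeight n s₀) (ff i j) with hN_def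
  have hN : N ≠ ∞ := by
    refine ENNReal.sum_ne_top.mpr fun i _ => ENNReal.sum_ne_top.mpr fun j _ => ?_
    refine ne_top_of_le_ne_top ?_ (wnorm_sub_le _ _ _)
    refine ENNReal.add_ne_top.mpr ⟨hconv i j, ?_⟩
    rw [X, ← monomial_zero_eq_C_apply, monomial_mul_monomial, wnorm_monomial, polyWeight]
    exact ENNReal.mul_ne_top enorm_ne_top (ENNReal.pow_ne_top ENNReal.coe_ne_top)
  -- For `ψ` in the ball of radius `r`, `x + ψ` has norm at most `r + r = c * s₀`. Since the
  -- nonlinear parts have order `2`, their norms at that radius sum to at most `c ^ 2 * N ≤ r`, so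
  -- the ball is preserved.
  set c : ℝ≥0 := min 1 (s₀ / (2 * (N.toNNReal + 1))) with hc_def
  have hc0 : 0 < c := by positivity
  have hc1 : (c : ℝ≥0∞) ≤ 1 := by exact_mod_cast min_le_left _ _
  set r : ℝ≥0 := c * s₀ / 2 with hr_def
  have hr : 0 < r := by positivity
  have h2r : (r : ℝ≥0∞) + r = c * s₀ := by
    rw [← ENNReal.coe_add, ← ENNReal.coe_mul, hr_def, add_halves]
  have hcN : (c : ℝ≥0∞) ^ 2 * N ≤ r := by
    rw [← ENNReal.coe_toNNReal hN, ← ENNReal.coe_pow, ← ENNReal.coe_mul, ENNReal.coe_le_coe]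
    calc c ^ 2 * N.toNNReal ≤ c * (s₀ / (2 * (N.toNNReal + 1))) * (N.toNNReal + 1) := by
          rw [pow_two]
          gcongr
          · exact min_le_right _ _
          · exact le_self_add
      _ = r := by rw [hr_def]; field_simp
  -- Weight zero on `A` discards the coefficients on which the equation is not imposed. This is
  -- compatible with products: if a sum of exponents is off `A`, so are both summands.
  let w : (Fin n →₀ ℕ) → ℝ≥0∞ := fun Q =>
    if Q ∈ A then 0 else polyWeight n r Q * ENNReal.ofReal (Real.exp (-d Q))
  have hwle : ∀ Q, w Q ≤ polyWeight n r Q := by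
    intro Q
    simp only [w]
    split_ifs
    · exact zero_le
    · refine mul_le_of_le_one_right zero_le ?_
      rw [ENNReal.ofReal_le_one, Real.exp_le_one_iff]
      linarith [hd0 Q]
  have hw0 : w 0 ≤ 1 := (hwle 0).trans (polyWeight_zero _)
  have hwadd : ∀ Q Q', w (Q + Q') ≤ w Q * w Q' := by
    intro Q Q'
    by_cases hQQ : Q + Q' ∈ A
    · simp [w, hQQ]
    have hQ : Q ∉ A := fun h => hQQ (hA le_self_add h)
    have hQ' : Q' ∉ A := fun h => hQQ (hA le_add_self h)
    simp only [w, hQQ, hQ, hQ', if_false]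
    rw [mul_mul_mul_comm, ← ENNReal.ofReal_mul (Real.exp_nonneg _), ← Real.exp_add]
    gcongr
    · exact polyWeight_add _ _ _
    · linarith [hdadd Q Q']
  have hgain : ∀ j Q Q', Q ≠ 0 → Q' ≠ 0 →
      w (Q + Q') * (ENNReal.ofReal (smallDivisor μ (Q + Q') j))⁻¹ ≤ w Q * w Q' := by
    intro j Q Q' hQ0 hQ0'
    by_cases hQQ : Q + Q' ∈ A
    · simp [w, hQQ]
    have hQ : Q ∉ A := fun h => hQQ (hA le_self_add h)
    have hQ' : Q' ∉ A := fun h => hQQ (hA le_add_self h)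
    have hQd : Q.degree ≠ 0 := fun h => hQ0 ((Finsupp.degree_eq_zero_iff Q).mp h)
    have hQd' : Q'.degree ≠ 0 := fun h => hQ0' ((Finsupp.degree_eq_zero_iff Q').mp h)
    have hδ := hpos _ hQQ (by rw [map_add]; omega) j
    simp only [w, hQQ, hQ, hQ', if_false]
    rw [mul_mul_mul_comm, ← ENNReal.ofReal_mul (Real.exp_nonneg _), ← Real.exp_add,
      ← ENNReal.ofReal_inv_of_pos hδ, mul_assoc, ← ENNReal.ofReal_mul (Real.exp_nonneg _)]
    refine mul_le_mul' (polyWeight_add _ _ _) (ENNReal.ofReal_le_ofReal ?_)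
    rw [← Real.exp_log (inv_pos.mpr hδ), ← Real.exp_add, Real.log_inv]
    refine Real.exp_le_exp.mpr ?_
    linarith [hdgain Q Q' hQ0 hQ0' hQQ j]
  have hball := hψw w (fun _ => r) (by
    intro q hq j
    have hYs : ∀ k, wnorm w (Y q k) ≤ c * s₀ := by
      intro k
      refine (wnorm_add_le _ _ _).trans ?_
      rw [← h2r]
      refine add_le_add ?_ ((wnorm_offPart_le _ _ _).trans (hq k))
      rw [X, wnorm_monomial]
      simpa [polyWeight] using hwle (Finsupp.single k 1)
    have hsub : ∀ i, wnorm (fun Q => w Q * (ENNReal.ofReal (smallDivisor μ Q j))⁻¹)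
        (subst (Y q) (ff i j)) ≤ c ^ 2 * wnorm (polyWeight n s₀) (ff i j) := fun i =>
      (wnorm_subst_le_of_gain hw0 hwadd (hgain j) (hY0 q) hYs
        (vanishOff_degGE_iff.mp (hff i j))).trans (wnorm_polyWeight_mul_le (hff i j) hc1 _)
    -- The selected index varies with `Q`; bounding its term by the sum over all `i` turns the
    -- estimate into finitely many norms.
    have hterm : ∀ Q, ‖coeff Q (T q j)‖ₑ * w Q ≤ ∑ i, ‖coeff Q (subst (Y q) (ff i j))‖ₑ *
        (w Q * (ENNReal.ofReal (smallDivisor μ Q j))⁻¹) := by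
      intro Q
      by_cases h : Q ∉ A ∧ 2 ≤ Q.degree
      · refine le_trans (le_of_eq ?_) (Finset.single_le_sum
          (f := fun i => ‖coeff Q (subst (Y q) (ff i j))‖ₑ *
            (w Q * (ENNReal.ofReal (smallDivisor μ Q j))⁻¹))
          (fun _ _ => zero_le) (Finset.mem_univ (sel Q h.1 h.2 j)))
        have hδ := hpos Q h.1 h.2 j
        have hne : monomialFun Q (μ (sel Q h.1 h.2 j)) - μ (sel Q h.1 h.2 j) j ≠ 0 := by
          rw [← norm_pos_iff, hsel Q h.1 h.2 j]
          exact hδ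
        rw [hTpos _ _ _ h, div_eq_mul_inv, enorm_mul, enorm_inv hne, ← ofReal_norm
          (monomialFun Q (μ (sel Q h.1 h.2 j)) - μ (sel Q h.1 h.2 j) j), hsel Q h.1 h.2 j]
        ring
      · rw [hTneg _ _ _ h]
        simp
    calc wnorm w (T q j) ≤ ∑' Q, ∑ i, ‖coeff Q (subst (Y q) (ff i j))‖ₑ *
        (w Q * (ENNReal.ofReal (smallDivisor μ Q j))⁻¹) := ENNReal.tsum_le_tsum hterm
      _ = ∑ i, wnorm (fun Q => w Q * (ENNReal.ofReal (smallDivisor μ Q j))⁻¹)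
          (subst (Y q) (ff i j)) := Summable.tsum_finsetSum fun _ _ => ENNReal.summable
      _ ≤ ∑ i, c ^ 2 * wnorm (polyWeight n s₀) (ff i j) := Finset.sum_le_sum fun i _ => hsub i
      _ ≤ c ^ 2 * N := by
          rw [← Finset.mul_sum]
          refine mul_le_mul_right (Finset.sum_le_sum fun i _ => ?_) _
          exact Finset.single_le_sum (f := fun j => wnorm (polyWeight n s₀) (ff i j))
            (fun _ _ => zero_le) (Finset.mem_univ j)
      _ ≤ r := hcN)
  refine ⟨fun k => X k + ψ k, fun j => by simpa using hψ2 j, ?_, ?_⟩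
  -- Linear growth `d Q ≤ D * |Q|` means that the exponential weight costs only the factor `e^{-D}`
  -- in the radius.
  · set t : ℝ≥0 := r * (Real.exp (-D)).toNNReal with ht_def
    refine ⟨t, mul_pos hr (Real.toNNReal_pos.mpr (Real.exp_pos _)), fun j => ?_⟩
    refine ne_top_of_le_ne_top ?_ (wnorm_add_le _ _ _)
    refine ENNReal.add_ne_top.mpr ⟨?_, ?_⟩
    · rw [X, wnorm_monomial, polyWeight]
      exact ENNReal.mul_ne_top enorm_ne_top (ENNReal.pow_ne_top ENNReal.coe_ne_top)
    · refine ne_top_of_le_ne_top ENNReal.coe_ne_top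
        ((wnorm_mono (v := w) fun Q hQ => ?_).trans (hball j))
      have hQA : Q ∉ A := fun h => hQ (hψA j Q (not_not.mpr h))
      have ht : (t : ℝ≥0∞) = r * ENNReal.ofReal (Real.exp (-D)) := by
        rw [ht_def, ENNReal.coe_mul, ENNReal.ofReal]
      simp only [w, hQA, if_false]
      rw [polyWeight, ht, mul_pow, ← ENNReal.ofReal_pow (Real.exp_nonneg _), ← Real.exp_nat_mul]
      refine mul_le_mul' le_rfl (ENNReal.ofReal_le_ofReal (Real.exp_le_exp.mpr ?_))
      linarith [hdD Q]
  · refine vanishOff_conjugacy_of_commute hlin hcomm hA (fun j => by simpa using hψ2 j) ?_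
    intro Q hQ h2 j
    have hne : monomialFun Q (μ (sel Q hQ h2 j)) - μ (sel Q hQ h2 j) j ≠ 0 := by
      rw [← norm_pos_iff, hsel Q hQ h2 j]
      exact hpos Q hQ h2 j
    refine ⟨sel Q hQ h2 j, sub_ne_zero.mp hne, ?_⟩
    have hX : coeff Q (X j : MvPowerSeries (Fin n) ℂ) = 0 := by
      rw [coeff_X, if_neg]
      rintro rfl
      simp at h2
    have h1 : coeff Q (ψ j) = coeff Q (subst (fun k => X k + ψ k) (ff (sel Q hQ h2 j) j)) /
        (monomialFun Q (μ (sel Q hQ h2 j)) - μ (sel Q hQ h2 j) j) := by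
      have := hTpos ψ j Q ⟨hQ, h2⟩
      rwa [hψ, hYψ] at this
    rw [eq_div_iff hne] at h1
    have hΨ0 := hY0 ψ
    rw [hYψ] at hΨ0
    rw [(hlin _).subst_eq hΨ0, map_sub, map_add, coeff_C_mul, coeff_rescale, map_add, hX,
      zero_add, ← h1, ← mpow_eq_monomialFun, mpow]
    ring

/-! ### Taylor maps, normalization and conjugation of germs -/

theorem diagMap_apply (c : Fin n → ℂ) (z : Fin n → ℂ) (j : Fin n) : diagMap c z j = c j * z j := by
  simp [diagMap]

theorem monomialFun_diagMap (R : Fin n →₀ ℕ) (c z : Fin n → ℂ) :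
    monomialFun R (diagMap c z) = monomialFun R c * monomialFun R z := by
  simp only [monomialFun, diagMap_apply, mul_pow, Finset.prod_mul_distrib]

theorem diagMap_mem_zeroSet {S : Set (Fin n →₀ ℕ)} (c : Fin n → ℂ) {z : Fin n → ℂ}
    (hz : z ∈ zeroSet S) : diagMap c z ∈ zeroSet S :=
  fun R hR => by rw [monomialFun_diagMap, hz R hR, mul_zero]

/-- The tuple `p` is the Taylor expansion of the germ `G` of a self-map, and `G` fixes `0`. -/
structure IsTaylorMap (p : Fin n → MvPowerSeries (Fin n) ℂ) (G : (Fin n → ℂ) → Fin n → ℂ) :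
    Prop where
  taylor : ∀ j, IsTaylorExpansion (p j) fun z => G z j
  map_zero : G 0 = 0

namespace IsTaylorMap

variable {p q : Fin n → MvPowerSeries (Fin n) ℂ} {G H : (Fin n → ℂ) → Fin n → ℂ}

theorem constantCoeff (hp : IsTaylorMap p G) (j : Fin n) :
    MvPowerSeries.constantCoeff (p j) = 0 := by
  rw [← (hp.taylor j).apply_zero, hp.map_zero, Pi.zero_apply]

theorem analyticAt (hp : IsTaylorMap p G) : AnalyticAt ℂ G 0 :=
  analyticAt_pi_iff.mpr fun j => (hp.taylor j).analyticAt

theorem tendsto (hp : IsTaylorMap p G) : Filter.Tendsto G (𝓝 0) (𝓝 0) := by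
  have := hp.analyticAt.continuousAt.tendsto
  rwa [hp.map_zero] at this

theorem exists_of_analyticAt (hG : AnalyticAt ℂ G 0) (h0 : G 0 = 0) : ∃ p, IsTaylorMap p G := by
  choose p hp using fun j => exists_isTaylorExpansion (analyticAt_pi_iff.mp hG j)
  exact ⟨p, hp, h0⟩

theorem comp (hp : IsTaylorMap p G) (hq : IsTaylorMap q H) :
    IsTaylorMap (fun j => subst q (p j)) (G ∘ H) :=
  ⟨fun j => (hp.taylor j).comp hq.taylor hq.constantCoeff, by simp [hp.map_zero, hq.map_zero]⟩

theorem unique (hp : IsTaylorMap p G) (hq : IsTaylorMap q H) (h : G =ᶠ[𝓝 0] H) : p = q :=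
  funext fun j => (hp.taylor j).unique (hq.taylor j) (h.fun_comp fun z => z j)

theorem identity : IsTaylorMap (X : Fin n → MvPowerSeries (Fin n) ℂ) id :=
  ⟨fun j => IsTaylorExpansion.X j, rfl⟩

theorem subst_eq_X (hp : IsTaylorMap p G) (hq : IsTaylorMap q H) (h : G ∘ H =ᶠ[𝓝 0] id)
    (j : Fin n) : subst q (p j) = X j :=
  congrFun ((hp.comp hq).unique identity h) j

theorem hasDiagLinearPart (hp : IsTaylorMap p G) {c : Fin n → ℂ}
    (hG : HasFDerivAt G (diagMap c) 0) : HasDiagLinearPart c p := by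
  classical
  intro j
  rw [vanishOff_degGE_iff]
  intro Q hQ
  have h1 := (hasFDerivAt_pi'.mp hG j).unique (hp.taylor j).hasFDerivAt
  rw [map_sub, coeff_C_mul, coeff_X]
  rcases Nat.lt_succ_iff_lt_or_eq.mp hQ with h | h
  · have : Q = 0 := (Finsupp.degree_eq_zero_iff Q).mp (by omega)
    subst this
    rw [if_neg (by
      intro h
      simpa using congrArg Finsupp.degree h)]
    simpa using hp.constantCoeff j
  · obtain ⟨k, rfl⟩ := eq_single_of_degree_eq_one h
    have h2 := congrArg (fun f : (Fin n → ℂ) →L[ℂ] ℂ => f (Pi.single k 1)) h1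
    simp only [ContinuousLinearMap.comp_apply, ContinuousLinearMap.proj_apply, diagMap_apply,
      sum_apply, smul_apply, smul_eq_mul, Pi.single_apply, mul_ite, mul_one, mul_zero,
      Finset.sum_ite_eq', Finset.mem_univ, if_true] at h2
    rw [← h2]
    by_cases hjk : j = k
    · simp [hjk]
    · have : Finsupp.single k 1 ≠ Finsupp.single j 1 := fun h =>
        hjk (Finsupp.single_left_injective one_ne_zero h).symm
      simp [hjk, this]

theorem hasFDerivAt (hp : IsTaylorMap p G) {c : Fin n → ℂ} (hc : HasDiagLinearPart c p) :
    HasFDerivAt G (diagMap c) 0 := by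
  classical
  rw [hasFDerivAt_pi']
  intro j
  convert! (hp.taylor j).hasFDerivAt using 1
  ext1 z
  have h1 : ∀ k, coeff (Finsupp.single k 1) (p j) = if k = j then c j else 0 := by
    intro k
    have h2 := vanishOff_degGE_iff.mp (hc j) (Finsupp.single k 1) (by simp)
    rw [map_sub, coeff_C_mul, coeff_X, sub_eq_zero] at h2
    rw [h2]
    simp only [(Finsupp.single_left_injective one_ne_zero).eq_iff, mul_ite, mul_one, mul_zero]
  simp only [h1, ContinuousLinearMap.comp_apply, ContinuousLinearMap.proj_apply, diagMap_apply,
    sum_apply, smul_apply, smul_eq_mul, ite_mul, zero_mul, Finset.sum_ite_eq', Finset.mem_univ,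
    if_true]

end IsTaylorMap

/-- The diagonal linear equivalence with nonzero entries. -/
def diagEquiv (c : Fin n → ℂ) (hc : ∀ j, c j ≠ 0) : (Fin n → ℂ) ≃L[ℂ] (Fin n → ℂ) :=
  ContinuousLinearEquiv.equivOfInverse (diagMap c) (diagMap c⁻¹)
    (fun z => by ext j; simp [diagMap_apply, hc j]) (fun z => by ext j; simp [diagMap_apply, hc j])

theorem diagMap_one : diagMap (1 : Fin n → ℂ) = ContinuousLinearMap.id ℂ (Fin n → ℂ) := by
  ext z j
  simp [diagMap_apply]

theorem hasDiagLinearPart_one_iff {p : Fin n → MvPowerSeries (Fin n) ℂ} :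
    HasDiagLinearPart 1 p ↔ ∀ j, VanishOff (degGE n 2) (p j - X j) := by
  simp [HasDiagLinearPart]

/-- A germ of self-map with invertible diagonal linear part has an inverse germ, whose linear part
is the inverse diagonal matrix. -/
theorem IsTaylorMap.exists_inverse {p : Fin n → MvPowerSeries (Fin n) ℂ}
    {G : (Fin n → ℂ) → Fin n → ℂ} (hp : IsTaylorMap p G) {c : Fin n → ℂ} (hc : ∀ j, c j ≠ 0)
    (hlin : HasDiagLinearPart c p) :
    ∃ (q : Fin n → MvPowerSeries (Fin n) ℂ) (H : (Fin n → ℂ) → Fin n → ℂ), IsTaylorMap q H ∧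
      H ∘ G =ᶠ[𝓝 0] id ∧ G ∘ H =ᶠ[𝓝 0] id ∧ HasDiagLinearPart c⁻¹ q := by
  obtain ⟨H, hH, hH0, hl, hr, hd⟩ := exists_inverse_germ hp.analyticAt hp.map_zero
    (e := diagEquiv c hc) (hp.hasFDerivAt hlin)
  obtain ⟨q, hq⟩ := IsTaylorMap.exists_of_analyticAt hH hH0
  exact ⟨q, H, hq, hl, hr, hq.hasDiagLinearPart hd⟩

theorem monomial_eq_mpow_X (R : Fin n →₀ ℕ) :
    (monomial R 1 : MvPowerSeries (Fin n) ℂ) = mpow X R := by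
  induction R using exponent_induction with
  | zero => rw [mpow_zero, monomial_zero_one]
  | add k P ih =>
    rw [mpow_add, mpow_single, ← ih, X, monomial_mul_monomial, one_mul]

theorem subst_mpow {a : Fin n → MvPowerSeries (Fin n) ℂ} (ha : HasSubst a)
    (b : Fin n → MvPowerSeries (Fin n) ℂ) (P : Fin n →₀ ℕ) :
    subst a (mpow b P) = mpow (fun j => subst a (b j)) P := by
  simp only [← substAlgHom_apply ha, mpow, Finsupp.prod, map_prod, map_pow]

/-- A germ tangent to the identity may be modified, without changing its inverse off `A`, so that
its nonlinear part has no monomial in `A`. -/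
theorem exists_normalized {A : Set (Fin n →₀ ℕ)} (hA : IsUpperSet A)
    {p : Fin n → MvPowerSeries (Fin n) ℂ} {G : (Fin n → ℂ) → Fin n → ℂ} (hp : IsTaylorMap p G)
    (hlin : ∀ j, VanishOff (degGE n 2) (p j - X j)) :
    ∃ (φ ψ : Fin n → MvPowerSeries (Fin n) ℂ) (Φ Ψ : (Fin n → ℂ) → Fin n → ℂ),
      IsTaylorMap φ Φ ∧ IsTaylorMap ψ Ψ ∧ Ψ ∘ Φ =ᶠ[𝓝 0] id ∧ Φ ∘ Ψ =ᶠ[𝓝 0] id ∧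
      (∀ j, VanishOff (degGE n 2) (φ j - X j)) ∧ (∀ j, VanishOff Aᶜ (φ j - X j)) ∧
      ∀ j, VanishOff A (ψ j - p j) := by
  obtain ⟨φ₀, Φ₀, hφ₀, hl₀, -, hφ₀lin⟩ := hp.exists_inverse (c := 1) (fun _ => one_ne_zero)
    (hasDiagLinearPart_one_iff.mpr hlin)
  rw [inv_one, hasDiagLinearPart_one_iff] at hφ₀lin
  obtain ⟨s, ρ, hsA, hρ⟩ := exists_finset_generators A
  have hX0 : ∀ j, constantCoeff (X j : MvPowerSeries (Fin n) ℂ) = 0 := fun j => by simp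
  obtain ⟨s₀, hs₀, hconv⟩ := IsTaylorExpansion.exists_radius_le hφ₀.taylor
  -- Division is by the powers `φ₀^R` rather than by `x^R`, because substituting `p = φ₀⁻¹` turns
  -- `φ₀^R` into `x^R`, whose exponent lies in `A`. Tangency to the identity makes `x^R` the leading
  -- part of `φ₀^R`.
  have hdiv : ∀ j, ∃ (q : (Fin n →₀ ℕ) → MvPowerSeries (Fin n) ℂ) (r : MvPowerSeries (Fin n) ℂ),
      φ₀ j - X j = ∑ R ∈ s, q R * mpow φ₀ R + r ∧ VanishOff Aᶜ r ∧ VanishOff (degGE n 2) r ∧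
      ∃ t : ℝ≥0, 0 < t ∧ wnorm (polyWeight n t) r ≠ ∞ := by
    intro j
    refine exists_division hρ hs₀ (fun R _ => wnorm_mpow_ne_top hconv R) (fun R _ => ?_) ?_
      (hφ₀lin j)
    · rw [← neg_sub, monomial_eq_mpow_X]
      exact (VanishOff.mpow_sub_degGE hφ₀.constantCoeff hX0 hφ₀lin R).neg
    · refine ne_top_of_le_ne_top ?_ (wnorm_sub_le _ _ _)
      refine ENNReal.add_ne_top.mpr ⟨hconv j, ?_⟩
      rw [X, wnorm_monomial, polyWeight]
      exact ENNReal.mul_ne_top enorm_ne_top (ENNReal.pow_ne_top ENNReal.coe_ne_top)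
  choose q r hqr hrA hr2 t ht hrt using hdiv
  have hφ : IsTaylorMap (fun j => X j + r j) fun z j => z j + evalSeries (r j) z := by
    have hT := fun j => (IsTaylorExpansion.X j).add (IsTaylorExpansion.of_wnorm (ht j) (hrt j))
    refine ⟨hT, funext fun j => ?_⟩
    rw [(hT j).apply_zero, map_add, hX0, constantCoeff_eq_zero_of_vanishOff two_pos (hr2 j)]
    simp
  have hφ2 : ∀ j, VanishOff (degGE n 2) (X j + r j - X j) := fun j => by simpa using hr2 j
  obtain ⟨ψ, Ψ, hψ, hl, hr, -⟩ := hφ.exists_inverse (c := 1) (fun _ => one_ne_zero)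
    (hasDiagLinearPart_one_iff.mpr hφ2)
  refine ⟨_, ψ, _, Ψ, hφ, hψ, hl, hr, hφ2, fun j => by simpa using hrA j, fun j => ?_⟩
  have hsp := hasSubst_of_constantCoeff_zero hp.constantCoeff
  have hsφ := hasSubst_of_constantCoeff_zero hφ.constantCoeff
  have hinv : ∀ j, subst p (φ₀ j) = X j := hφ₀.subst_eq_X hp hl₀
  have h1 : ∀ j, VanishOff A (X j - subst p (X j + r j)) := by
    intro j
    have h2 : X j + r j = φ₀ j - ∑ R ∈ s, q j R * mpow φ₀ R := by
      linear_combination -hqr j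
    have h3 : X j - subst p (X j + r j) = ∑ R ∈ s, subst p (q j R) * monomial R 1 := by
      rw [h2, subst_sub hsp, hinv, sub_sub_cancel, ← substAlgHom_apply hsp, map_sum]
      refine Finset.sum_congr rfl fun R _ => ?_
      rw [map_mul, substAlgHom_apply, substAlgHom_apply, subst_mpow hsp, funext hinv,
        monomial_eq_mpow_X]
    rw [h3]
    refine VanishOff.sum fun R hR => VanishOff.mul_left hA _ fun Q hQ => ?_
    classical
    rw [coeff_monomial, if_neg]
    rintro rfl
    exact hQ (hsA _ hR)
  -- The normalized map composed with `p` is the identity off `A`; applying its inverse `ψ` on the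
  -- left gives `ψ ≡ p` off `A`.
  have h3 := VanishOff.subst_sub HasSubst.X (hasSubst_of_constantCoeff_zero
    (hφ.comp hp).constantCoeff) hA h1 (ψ j)
  rw [subst_self, ← subst_comp_subst_apply hsφ hsp, hψ.subst_eq_X hφ hl, subst_X hsp] at h3
  exact h3

/-- If `Φ⁻¹ = Ψ` conjugates `F` to `diag c` off `I`, then the components of `Φ ∘ F ∘ Ψ - diag c`
belong to `I`. -/
theorem germMem_conjugate {I : Ideal (HolGerm n)} {φ ψ f : Fin n → MvPowerSeries (Fin n) ℂ}
    {Φ Ψ F : (Fin n → ℂ) → Fin n → ℂ} (hφ : IsTaylorMap φ Φ) (hψ : IsTaylorMap ψ Ψ)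
    (hf : IsTaylorMap f F) (hr : Φ ∘ Ψ =ᶠ[𝓝 0] id) {c : Fin n → ℂ}
    (h : ∀ j, VanishOff (exponentSet I) (subst ψ (f j) - rescale c (ψ j))) (j : Fin n) :
    GermMem (fun z => Φ (F (Ψ z)) j - diagMap c z j) I := by
  have hG := hφ.comp (hf.comp hψ)
  have h0 : ∀ k, constantCoeff (rescale c (ψ k)) = 0 := fun k =>
    constantCoeff_rescale c (hψ.constantCoeff k)
  -- Applying `φ` to `F ∘ Ψ ≡ Ψ ∘ diag c` gives `Φ ∘ F ∘ Ψ ≡ Φ ∘ Ψ ∘ diag c = diag c` off the ideal.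
  have h1 := VanishOff.subst_sub (hasSubst_of_constantCoeff_zero (hf.comp hψ).constantCoeff)
    (hasSubst_of_constantCoeff_zero h0) (isUpperSet_exponentSet I) h (φ j)
  rw [← rescale_subst c hψ.constantCoeff, hφ.subst_eq_X hψ hr, rescale_X] at h1
  refine IsTaylorExpansion.germMem ?_ h1
  have h2 := IsTaylorExpansion.monomial (Finsupp.single j 1) (c j)
  simp only [monomialFun_single] at h2
  have h3 : (C (c j) * X j : MvPowerSeries (Fin n) ℂ) = monomial (Finsupp.single j 1) (c j) := by
    rw [X, ← monomial_zero_eq_C_apply, monomial_mul_monomial, zero_add, mul_one]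
  rw [h3]
  have h4 := (hG.taylor j).sub h2
  simp only [diagMap_apply]
  exact h4

/-- If `ψ` conjugates `f` to `diag c` off `A`, then it conjugates the inverse of `f` to the inverse
of `diag c` off `A`. -/
theorem vanishOff_conjugacy_inverse {A : Set (Fin n →₀ ℕ)} (hA : IsUpperSet A)
    {ψ f g : Fin n → MvPowerSeries (Fin n) ℂ} (hψ : ∀ j, constantCoeff (ψ j) = 0)
    (hf : ∀ j, constantCoeff (f j) = 0) (hgf : ∀ j, subst f (g j) = X j) {c : Fin n → ℂ}
    (hc : ∀ j, c j ≠ 0) (h : ∀ j, VanishOff A (subst ψ (f j) - rescale c (ψ j))) (j : Fin n) :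
    VanishOff A (subst ψ (g j) - rescale c⁻¹ (ψ j)) := by
  have h0 : ∀ k, constantCoeff (rescale c⁻¹ (ψ k)) = 0 := fun k => constantCoeff_rescale _ (hψ k)
  have hs := hasSubst_of_constantCoeff_zero h0
  have h1 : ∀ k, VanishOff A (ψ k - subst (fun m => rescale c⁻¹ (ψ m)) (f k)) := by
    intro k
    have h2 := ((h k).rescale c⁻¹).neg
    have hcc : c * c⁻¹ = 1 := funext fun j => mul_inv_cancel₀ (hc j)
    rwa [map_sub, neg_sub, rescale_subst _ hψ, rescale_rescale, hcc, rescale_one,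
      RingHom.id_apply] at h2
  have h3 := VanishOff.subst_sub (hasSubst_of_constantCoeff_zero hψ)
    (hasSubst_of_constantCoeff_zero fun k => constantCoeff_subst_eq_zero hs h0 (hf k)) hA h1 (g j)
  rwa [← subst_comp_subst_apply (hasSubst_of_constantCoeff_zero hf) hs, hgf, subst_X hs] at h3

/-! ### Assembly of the linearization theorem -/

/-- A zero maximum means that all `μ_i^Q - μ_{i,j}` vanish, so `x^Q e_j` is in the centralizer and
`x^Q` in the ideal. -/
theorem smallDivisor_ne_zero_of_centralizer {μ : Fin l → Fin n → ℂ} {S : Set (Fin n →₀ ℕ)}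
    (hC : CentralizerGeneratedBy μ S) {Q : Fin n →₀ ℕ} (hQ : Q ∉ exponentSet (monomialIdeal S))
    (h2 : 2 ≤ Q.degree) (j : Fin n) : smallDivisor μ Q j ≠ 0 := by
  intro h0
  refine hQ (hC Q j ((monomialVector_mem_iff μ Q j).mpr ⟨h2, fun i => ?_⟩))
  have := norm_le_smallDivisor μ Q j i
  rw [h0] at this
  exact sub_eq_zero.mp (norm_le_zero_iff.mp this)

/-- Every resonant monomial has its exponent in the ideal, where the nonlinear part of `φ` has no
term; the linear part is excluded by degree. -/
theorem centralizerProj_eq_zero {μ : Fin l → Fin n → ℂ} {S : Set (Fin n →₀ ℕ)}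
    (hC : CentralizerGeneratedBy μ S) {φ : Fin n → MvPowerSeries (Fin n) ℂ}
    (hφ : ∀ j, VanishOff (exponentSet (monomialIdeal S))ᶜ (φ j - X j)) :
    centralizerProj μ φ = 0 := by
  classical
  funext j
  ext Q
  change (if monomialVector Q j ∈ formalCentralizer μ then coeff Q (φ j) else 0) = 0
  split_ifs with h
  · have h1 := hφ j Q (not_not.mpr (hC Q j h))
    have h2 := ((monomialVector_mem_iff μ Q j).mp h).1
    rw [map_sub, coeff_X, if_neg, sub_zero] at h1
    · exact h1
    · rintro rfl
      simp at h2
  · rfl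

/-- The linearization theorem on the ideal generated by the monomials of `S`. -/
theorem exists_linearizesOn {μ : Fin l → Fin n → ℂ} {F : Fin l → (Fin n → ℂ) → Fin n → ℂ}
    (hF : IsAbelianFamily μ F) {S : Set (Fin n →₀ ℕ)} (hD : IsDiophantineOn μ (monomialIdeal S))
    (hC : CentralizerGeneratedBy μ S) :
    ∃ Φ Ψ : (Fin n → ℂ) → (Fin n → ℂ), LinearizesOn μ F (monomialIdeal S) Φ Ψ ∧
      ∀ i, ∀ᶠ z in 𝓝 (0 : Fin n → ℂ), (Φ (F i (Ψ z)) ∈ zeroSet S ↔ z ∈ zeroSet S) ∧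
        (z ∈ zeroSet S → Φ (F i (Ψ z)) = diagMap (μ i) z) := by
  set I := monomialIdeal S
  have hA := isUpperSet_exponentSet I
  choose Fs hFs using fun i => IsTaylorMap.exists_of_analyticAt (hF.analyticAt i) (hF.map_zero i)
  have hlin := fun i => (hFs i).hasDiagLinearPart (hF.hasFDerivAt i)
  have hcomm : ∀ i i' j, subst (Fs i') (Fs i j) = subst (Fs i) (Fs i' j) := fun i i' j =>
    congrFun (((hFs i).comp (hFs i')).unique ((hFs i').comp (hFs i)) (hF.commute i i')) j
  obtain ⟨s₀, hs₀, hconv⟩ := IsTaylorExpansion.exists_radius_le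
    (p := fun x : Fin l × Fin n => Fs x.1 x.2) fun x => (hFs x.1).taylor x.2
  obtain ⟨p, hp2, ⟨r, hr, hpr⟩, hconj⟩ := exists_convergent_conjugacy hF.ne_zero
    (fun Q hQ h2 j => smallDivisor_ne_zero_of_centralizer hC hQ h2 j) hD hlin hcomm hs₀
    fun i j => hconv (i, j)
  have hp : IsTaylorMap p fun z j => evalSeries (p j) z := by
    have hT := fun j => IsTaylorExpansion.of_wnorm hr (hpr j)
    refine ⟨hT, funext fun j => ?_⟩
    have := constantCoeff_eq_zero_of_vanishOff two_pos (hp2 j)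
    rw [(hT j).apply_zero]
    simpa using this
  obtain ⟨φ, ψ, Φ, Ψ, hφ, hψ, hl, hr, hφ2, hφA, hψp⟩ := exists_normalized hA hp hp2
  have hconj' : ∀ i j, VanishOff (exponentSet I) (subst ψ (Fs i j) - rescale (μ i) (ψ j)) := by
    intro i j
    have h1 := VanishOff.subst_sub (hasSubst_of_constantCoeff_zero hψ.constantCoeff)
      (hasSubst_of_constantCoeff_zero hp.constantCoeff) hA hψp (Fs i j)
    have h2 := (h1.add (hconj i j)).sub ((hψp j).rescale (μ i))
    rw [map_sub] at h2
    convert! h2 using 1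
    ring
  have hmem : ∀ i j, GermMem (fun z => Φ (F i (Ψ z)) j - diagMap (μ i) z j) I := fun i =>
    germMem_conjugate hφ hψ (hFs i) hr (hconj' i)
  refine ⟨Φ, Ψ, ⟨hφ.analyticAt, hψ.analyticAt, hφ.map_zero, hψ.map_zero, hl, hr, ?_,
    ⟨φ, hφ.taylor, centralizerProj_eq_zero hC hφA⟩, hmem⟩, fun i => ?_⟩
  · rw [← diagMap_one]
    exact hφ.hasFDerivAt (hasDiagLinearPart_one_iff.mpr hφ2)
  -- That points off the zero set are not mapped into it needs the inverse germ: `Φ ∘ F_i⁻¹ ∘ Ψ` is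
  -- also diagonal on the zero set, hence brings an image point in the zero set back to a point of
  -- it.
  · obtain ⟨g, H, hg, hHF, -, -⟩ := (hFs i).exists_inverse (hF.ne_zero i) (hlin i)
    have hmem' := germMem_conjugate hφ hψ hg hr (vanishOff_conjugacy_inverse hA hψ.constantCoeff
      (hFs i).constantCoeff (hg.subst_eq_X (hFs i) hHF) (hF.ne_zero i) (hconj' i))
    have hlinear : ∀ {G : (Fin n → ℂ) → Fin n → ℂ} {c : Fin n → ℂ},
        (∀ j, GermMem (fun z => Φ (G (Ψ z)) j - diagMap c z j) I) →
        ∀ᶠ z in 𝓝 (0 : Fin n → ℂ), z ∈ zeroSet S → Φ (G (Ψ z)) = diagMap c z := by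
      intro G c h
      filter_upwards [Filter.eventually_all.mpr fun j => (h j).eventually_eq_zero] with z hz hzS
      exact funext fun j => sub_eq_zero.mp (hz j hzS)
    have hFΨ := (hFs i).tendsto.comp hψ.tendsto
    filter_upwards [hlinear (hmem i), (hφ.tendsto.comp hFΨ).eventually (hlinear hmem'),
      hFΨ.eventually hl, hψ.tendsto.eventually hHF, hr] with z h1 h2 h3 h4 h5
    refine ⟨⟨fun hz => ?_, fun hz => ?_⟩, h1⟩
    · have h6 := h2 hz
      simp only [Function.comp_apply, id_eq] at h3 h4 h5 h6
      rw [h3, h4, h5] at h6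
      rw [h6]
      exact diagMap_mem_zeroSet _ hz
    · rw [h1 hz]
      exact diagMap_mem_zeroSet _ hz

end

end AbelianGerms

theorem mainTheorem3 {n l : ℕ} (μ : Fin l → Fin n → ℂ)
    (F : Fin l → (Fin n → ℂ) → (Fin n → ℂ)) (hF : AbelianGerms.IsAbelianFamily μ F)
    (S : Set (Fin n →₀ ℕ)) (hS : AbelianGerms.GeneratesInvariants μ S)
    (hD : AbelianGerms.IsDiophantineOn μ (AbelianGerms.monomialIdeal S))
    (hC : AbelianGerms.CentralizerGeneratedBy μ S) :
    ∃ Φ Ψ : (Fin n → ℂ) → (Fin n → ℂ),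
      AbelianGerms.LinearizesOn μ F (AbelianGerms.monomialIdeal S) Φ Ψ ∧
      ∀ i, ∀ᶠ z in nhds (0 : Fin n → ℂ),
        (Φ (F i (Ψ z)) ∈ AbelianGerms.zeroSet S ↔ z ∈ AbelianGerms.zeroSet S) ∧
        (z ∈ AbelianGerms.zeroSet S →
          Φ (F i (Ψ z)) = AbelianGerms.diagMap (μ i) z) := by
  exact AbelianGerms.exists_linearizesOn hF hD hC
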